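/- Let $H$ be a separable complex Hilbert space and let $\mathcal{L}^1=\{x\in\mathcal{B}(H):\operatorname{Tr}|x|<\infty\}$ be the algebra of trace class operators on $H$, with norm $\operatorname{Tr}|x|$. Let $PU=U(H)/U(1)$ be the projective unitary group with the topology induced by the norm topology of $U(H)$, acting on $\mathcal{L}^1$ by conjugation. Let $X$ be a compact smooth manifold (without boundary), let $P\to X$ be a smooth principal $PU$-bundle, let $\mathcal{L}^1(P)=P\times_{PU}\mathcal{L}^1$ be the associated bundle of algebras, and let $\mathcal{A}=C^\infty(\mathcal{L}^1(P))$ be the Fréchet algebra of its smooth sections, whose topology is given by the seminorms $\sum_{j\le m}\frac{1}{j!}\sup_{K}\|\partial^j s\|$, where $K$ is a compact subset of a chart of $X$ over which $P$ is trivialized, $m\in\mathbb{N}$, and $\partial^j s$ is the $j$-th derivative of the section $s$ in the chart and the trivialization, measured in the trace norm. Then $\mathcal{A}$ is topologically $H$-unital: its topological bar complex $$\cdots\to\mathcal{A}\hat\otimes_\pi\mathcal{A}\hat\otimes_\pi\mathcal{A}\xrightarrow{\,b'\,}\mathcal{A}\hat\otimes_\pi\mathcal{A}\xrightarrow{\,b'\,}\mathcal{A}\to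 0,\qquad b'(a_0\otimes\cdots\otimes a_k)=\sum_{j=0}^{k-1}(-1)^j a_0\otimes\cdots\otimes a_ja_{j+1}\otimes\cdots\otimes a_k,$$ formed with completed projective tensor products, is contractible, i.e. it has a contracting homotopy consisting of continuous linear maps. -/

import Mathlib

open Set Filter Topology
open scoped ENNReal InnerProductSpace ContDiff Manifold TensorProduct

universe u v w

noncomputable section

namespace TwistedHKR

set_option linter.unusedSectionVars false

/-! ### Trace class operators -/

section TraceClass

variable {H : Type v} [NormedAddCommGroup H] [InnerProductSpace ℂ H] [CompleteSpace H]

/-- `Tr x = ∑ ⟨vᵢ, x vᵢ⟩ ∈ [0, ∞]` for a positive operator `x`, computed in an orthonormal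
basis `v`. -/
def posTrace {ι : Type*} (b : HilbertBasis ι ℂ H) (x : H →L[ℂ] H) : ℝ≥0∞ :=
  ∑' i, ENNReal.ofReal (⟪b i, x (b i)⟫_ℂ).re

/-- The squared Hilbert-Schmidt norm in an orthonormal basis. -/
def hsSq {ι : Type*} (b : HilbertBasis ι ℂ H) (S : H →L[ℂ] H) : ℝ≥0∞ :=
  ∑' i, ‖S (b i)‖ₑ ^ 2

theorem enorm_sq_eq_tsum {ι : Type*} (b : HilbertBasis ι ℂ H) (x : H) :
    ‖x‖ₑ ^ 2 = ∑' i, ‖⟪b i, x⟫_ℂ‖ₑ ^ 2 := by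
  have h := b.hasSum_inner_mul_inner x x
  have h2 : HasSum (fun i => ‖⟪b i, x⟫_ℂ‖ ^ 2) (‖x‖ ^ 2) := by
    have h3 := (Complex.reCLM.hasSum h)
    convert! h3 using 1
    · ext i
      simp only [Complex.reCLM_apply]
      rw [← inner_conj_symm x (b i), ← Complex.normSq_eq_conj_mul_self, Complex.normSq_eq_norm_sq,
        Complex.ofReal_re]
    · simp only [Complex.reCLM_apply]
      rw [inner_self_eq_norm_sq_to_K]
      norm_cast
  have e1 : ∀ y : H, ‖y‖ₑ ^ 2 = ENNReal.ofReal (‖y‖ ^ 2) := fun y => by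
    rw [ENNReal.ofReal_pow (norm_nonneg _), ofReal_norm]
  have e2 : ∀ y : ℂ, ‖y‖ₑ ^ 2 = ENNReal.ofReal (‖y‖ ^ 2) := fun y => by
    rw [ENNReal.ofReal_pow (norm_nonneg _), ofReal_norm]
  simp only [e1, e2]
  rw [← h2.tsum_eq, ENNReal.ofReal_tsum_of_nonneg (fun i => by positivity) h2.summable]

theorem enorm_inner_symm (x y : H) : ‖⟪x, y⟫_ℂ‖ₑ = ‖⟪y, x⟫_ℂ‖ₑ := by
  rw [← ofReal_norm, ← ofReal_norm, norm_inner_symm]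

theorem hsSq_adjoint {ι κ : Type*} (b : HilbertBasis ι ℂ H) (c : HilbertBasis κ ℂ H)
    (S : H →L[ℂ] H) : hsSq b S = hsSq c (ContinuousLinearMap.adjoint S) := by
  unfold hsSq
  simp_rw [fun i => enorm_sq_eq_tsum c (S (b i)),
    fun j => enorm_sq_eq_tsum b (ContinuousLinearMap.adjoint S (c j))]
  rw [ENNReal.tsum_comm]
  refine tsum_congr fun j => tsum_congr fun i => ?_
  rw [ContinuousLinearMap.adjoint_inner_right, enorm_inner_symm]

theorem hsSq_comp_left_le {ι : Type*} (b : HilbertBasis ι ℂ H) (X R : H →L[ℂ] H) (hX : ‖X‖ ≤ 1) :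
    hsSq b (X * R) ≤ hsSq b R := by
  refine ENNReal.tsum_le_tsum fun i => ?_
  have : ‖X (R (b i))‖ₑ ≤ ‖R (b i)‖ₑ := by
    rw [enorm_le_iff_norm_le]
    exact (X.le_of_opNorm_le hX _).trans (by simp)
  exact pow_le_pow_left' this 2

theorem hsSq_comp_right_le {ι : Type*} (b : HilbertBasis ι ℂ H) (X R : H →L[ℂ] H) (hX : ‖X‖ ≤ 1) :
    hsSq b (R * X) ≤ hsSq b R := by
  rw [hsSq_adjoint b b (R * X), hsSq_adjoint b b R]
  have : ContinuousLinearMap.adjoint (R * X) =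
      ContinuousLinearMap.adjoint X * ContinuousLinearMap.adjoint R :=
    ContinuousLinearMap.adjoint_comp R X
  rw [this]
  exact hsSq_comp_left_le b _ _ (by simpa using hX)

theorem posTrace_eq_hsSq {ι : Type*} (b : HilbertBasis ι ℂ H) (x : H →L[ℂ] H) (hx : 0 ≤ x) :
    posTrace b x = hsSq b (CFC.sqrt x) := by
  refine tsum_congr fun i => ?_
  have hs : IsSelfAdjoint (CFC.sqrt x) := IsSelfAdjoint.of_nonneg (CFC.sqrt_nonneg x)
  have hm : CFC.sqrt x * CFC.sqrt x = x := CFC.sqrt_mul_sqrt_self x hx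
  set R := CFC.sqrt x
  have : ⟪b i, x (b i)⟫_ℂ = ⟪R (b i), R (b i)⟫_ℂ := by
    conv_lhs => rw [← hm]
    rw [← ContinuousLinearMap.adjoint_inner_right, hs.adjoint_eq]
    rfl
  rw [this, inner_self_eq_norm_sq_to_K]
  have : (((‖R (b i)‖ : ℂ)) ^ 2).re = ‖R (b i)‖ ^ 2 := by norm_cast
  erw [this]
  rw [ENNReal.ofReal_pow (norm_nonneg _), ofReal_norm]

/-- The trace of a positive operator does not depend on the orthonormal basis. -/
theorem posTrace_basis_indep {ι κ : Type*} (b : HilbertBasis ι ℂ H) (c : HilbertBasis κ ℂ H)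
    (x : H →L[ℂ] H) (hx : 0 ≤ x) : posTrace b x = posTrace c x := by
  have hs : IsSelfAdjoint (CFC.sqrt x) := IsSelfAdjoint.of_nonneg (CFC.sqrt_nonneg x)
  rw [posTrace_eq_hsSq b x hx, posTrace_eq_hsSq c x hx, hsSq_adjoint b c, hs.adjoint_eq]

/-- Polar decomposition. -/
theorem exists_polar (A : H →L[ℂ] H) :
    ∃ W : H →L[ℂ] H, ‖W‖ ≤ 1 ∧ W * CFC.abs A = A ∧
      ∀ x y, ⟪A x, W y⟫_ℂ = ⟪CFC.abs A x, y⟫_ℂ := by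
  set Q := CFC.abs A with hQ
  have hs : IsSelfAdjoint Q := IsSelfAdjoint.of_nonneg (CFC.abs_nonneg A)
  have hQQ : Q * Q = star A * A := CFC.abs_mul_abs A
  have hin : ∀ x w, ⟪A x, A w⟫_ℂ = ⟪Q x, Q w⟫_ℂ := fun x w => by
    rw [← ContinuousLinearMap.adjoint_inner_right A, ← ContinuousLinearMap.adjoint_inner_right Q,
      hs.adjoint_eq]
    exact congrArg (fun T : H →L[ℂ] H => ⟪x, T w⟫_ℂ) hQQ.symm
  have hnorm : ∀ x, ‖A x‖ = ‖Q x‖ := fun x => by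
    have := hin x x
    rw [inner_self_eq_norm_sq_to_K, inner_self_eq_norm_sq_to_K] at this
    have h2 : ‖A x‖ ^ 2 = ‖Q x‖ ^ 2 := by exact_mod_cast this
    exact (sq_eq_sq₀ (norm_nonneg _) (norm_nonneg _)).1 h2
  set K : Submodule ℂ H := (LinearMap.range Q.toLinearMap).topologicalClosure with hK
  have hmem : ∀ x, Q x ∈ K := fun x => Submodule.le_topologicalClosure _ ⟨x, rfl⟩
  have : CompleteSpace K := (Submodule.isClosed_topologicalClosure _).completeSpace_coe
  let e : H →ₗ[ℂ] K := Q.toLinearMap.codRestrict K hmem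
  have hd : DenseRange e := by
    intro z
    rw [closure_subtype]
    have : (Subtype.val '' range e) = (LinearMap.range Q.toLinearMap : Set H) := by
      ext y
      constructor
      · rintro ⟨_, ⟨x, rfl⟩, rfl⟩
        exact ⟨x, rfl⟩
      · rintro ⟨x, rfl⟩
        exact ⟨e x, ⟨x, rfl⟩, rfl⟩
    rw [this]
    exact z.2
  have hb : ∀ x, ‖A.toLinearMap x‖ ≤ 1 * ‖e x‖ := fun x => by
    rw [one_mul]
    exact (hnorm x).le
  let V : K →L[ℂ] H := A.toLinearMap.extendOfNorm e
  have hV : ∀ x, V (e x) = A x := fun x => LinearMap.extendOfNorm_eq hd ⟨1, hb⟩ x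
  have hVn : ‖V‖ ≤ 1 := LinearMap.opNorm_extendOfNorm_le hd zero_le_one hb
  let P : H →L[ℂ] K := K.orthogonalProjectionOnto
  have hP : ‖P‖ ≤ 1 := Submodule.orthogonalProjectionOnto_norm_le K
  refine ⟨V ∘L P, ?_, ?_, ?_⟩
  · exact (ContinuousLinearMap.opNorm_comp_le _ _).trans (mul_le_one₀ hVn (norm_nonneg _) hP)
  · ext x
    have : P (Q x) = e x := Submodule.orthogonalProjectionOnto_mem_subspace_eq_self (e x)
    change V (P (Q x)) = A x
    rw [this, hV]
  · intro x y
    have h1 : ∀ z : K, ⟪A x, V z⟫_ℂ = ⟪Q x, (z : H)⟫_ℂ := by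
      intro z
      refine hd.induction (P := fun z : K => ⟪A x, V z⟫_ℂ = ⟪Q x, (z : H)⟫_ℂ) ?_ ?_ z
      · rintro _ ⟨w, rfl⟩
        rw [hV]
        exact hin x w
      · exact isClosed_eq (by fun_prop) (by fun_prop)
    change ⟪A x, V (P y)⟫_ℂ = _
    rw [h1]
    exact Submodule.inner_orthogonalProjectionOnto_eq_of_mem_left (⟨Q x, hmem x⟩ : K) y

variable (H) in
/-- The index set of a chosen orthonormal basis of `H`. -/
def basisIndex : Set H := (exists_hilbertBasis ℂ H).choose

variable (H) in
/-- A chosen orthonormal basis of `H`. -/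
def stdBasis : HilbertBasis (basisIndex H) ℂ H := (exists_hilbertBasis ℂ H).choose_spec.choose

/-- `Tr |A| ∈ [0, ∞]`, where `|A| = (A* A)^(1/2)`. -/
def traceENorm (A : H →L[ℂ] H) : ℝ≥0∞ := posTrace (stdBasis H) (CFC.abs A)

theorem traceENorm_eq {ι : Type*} (b : HilbertBasis ι ℂ H) (A : H →L[ℂ] H) :
    traceENorm A = posTrace b (CFC.abs A) :=
  posTrace_basis_indep _ _ _ (CFC.abs_nonneg A)

theorem tsum_le_traceENorm (A S U : H →L[ℂ] H) (hS : ‖S‖ ≤ 1) (hU : ‖U‖ ≤ 1) :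
    ∑' i, ‖⟪S (stdBasis H i), A (U (stdBasis H i))⟫_ℂ‖ₑ ≤ traceENorm A := by
  obtain ⟨W, hW, hWA, -⟩ := exists_polar A
  set b := stdBasis H
  have hs : IsSelfAdjoint (CFC.sqrt (CFC.abs A)) := IsSelfAdjoint.of_nonneg (CFC.sqrt_nonneg _)
  have hm : CFC.sqrt (CFC.abs A) * CFC.sqrt (CFC.abs A) = CFC.abs A :=
    CFC.sqrt_mul_sqrt_self _ (CFC.abs_nonneg A)
  have htr : traceENorm A = hsSq b (CFC.sqrt (CFC.abs A)) :=
    posTrace_eq_hsSq b _ (CFC.abs_nonneg A)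
  rw [htr]
  set R := CFC.sqrt (CFC.abs A)
  have hA : A = W * (R * R) := by rw [hm, hWA]
  set X : H →L[ℂ] H := R * (ContinuousLinearMap.adjoint W * S) with hX
  set Y : H →L[ℂ] H := R * U with hY
  have hXle : hsSq b X ≤ hsSq b R := by
    refine hsSq_comp_right_le b _ R ?_
    refine (ContinuousLinearMap.opNorm_comp_le _ _).trans ?_
    exact mul_le_one₀ (by simpa using hW) (norm_nonneg _) hS
  have hYle : hsSq b Y ≤ hsSq b R := hsSq_comp_right_le b _ R hU
  have hterm : ∀ i, 2 * ‖⟪S (b i), A (U (b i))⟫_ℂ‖ₑ ≤ ‖X (b i)‖ₑ ^ 2 + ‖Y (b i)‖ₑ ^ 2 := by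
    intro i
    have h1 : ⟪S (b i), A (U (b i))⟫_ℂ = ⟪X (b i), Y (b i)⟫_ℂ := by
      conv_lhs => rw [hA]
      change ⟪S (b i), W (R (R (U (b i))))⟫_ℂ =
        ⟪R (ContinuousLinearMap.adjoint W (S (b i))), R (U (b i))⟫_ℂ
      rw [← ContinuousLinearMap.adjoint_inner_right R, hs.adjoint_eq,
        ContinuousLinearMap.adjoint_inner_left]
    rw [h1]
    have h2 : 2 * ‖⟪X (b i), Y (b i)⟫_ℂ‖ ≤ ‖X (b i)‖ ^ 2 + ‖Y (b i)‖ ^ 2 := by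
      have := norm_inner_le_norm (𝕜 := ℂ) (X (b i)) (Y (b i))
      nlinarith [sq_nonneg (‖X (b i)‖ - ‖Y (b i)‖)]
    have h3 := ENNReal.ofReal_le_ofReal h2
    rw [ENNReal.ofReal_mul (by norm_num), ENNReal.ofReal_add (by positivity) (by positivity),
      ENNReal.ofReal_pow (norm_nonneg _), ENNReal.ofReal_pow (norm_nonneg _)] at h3
    simpa [ofReal_norm] using h3
  have h4 : 2 * ∑' i, ‖⟪S (b i), A (U (b i))⟫_ℂ‖ₑ ≤ 2 * hsSq b R := by
    rw [← ENNReal.tsum_mul_left]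
    refine (ENNReal.tsum_le_tsum hterm).trans ?_
    rw [ENNReal.tsum_add, two_mul]
    exact add_le_add hXle hYle
  exact (ENNReal.mul_le_mul_iff_right (by norm_num) (by norm_num)).1 h4

theorem exists_traceENorm_eq (A : H →L[ℂ] H) : ∃ W : H →L[ℂ] H, ‖W‖ ≤ 1 ∧
    traceENorm A = ∑' i, ‖⟪W (stdBasis H i), A (stdBasis H i)⟫_ℂ‖ₑ := by
  obtain ⟨W, hW, -, hin⟩ := exists_polar A
  refine ⟨W, hW, tsum_congr fun i => ?_⟩
  set b := stdBasis H
  have hpos := (ContinuousLinearMap.nonneg_iff_isPositive _).1 (CFC.abs_nonneg A)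
  have h1 := hpos.inner_nonneg_right (b i)
  have h2 : ⟪W (b i), A (b i)⟫_ℂ = ⟪b i, CFC.abs A (b i)⟫_ℂ := by
    rw [← inner_conj_symm, hin, inner_conj_symm]
  rw [h2, ← ofReal_norm]
  congr 1
  obtain ⟨h3, h4⟩ := Complex.nonneg_iff.1 h1
  exact (Complex.abs_re_eq_norm.2 h4.symm ▸ (abs_of_nonneg h3).symm)

theorem traceENorm_zero : traceENorm (0 : H →L[ℂ] H) = 0 := by
  simp [traceENorm, posTrace]

theorem traceENorm_add_le (A B : H →L[ℂ] H) :
    traceENorm (A + B) ≤ traceENorm A + traceENorm B := by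
  obtain ⟨W, hW, h⟩ := exists_traceENorm_eq (A + B)
  rw [h]
  refine le_trans (ENNReal.tsum_le_tsum (g := fun i =>
    ‖⟪W (stdBasis H i), A (stdBasis H i)⟫_ℂ‖ₑ + ‖⟪W (stdBasis H i), B (stdBasis H i)⟫_ℂ‖ₑ)
    fun i => ?_) ?_
  · rw [add_apply, inner_add_right]
    exact enorm_add_le _ _
  · rw [ENNReal.tsum_add]
    exact add_le_add (tsum_le_traceENorm A W 1 hW ContinuousLinearMap.norm_id_le)
      (tsum_le_traceENorm B W 1 hW ContinuousLinearMap.norm_id_le)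

theorem traceENorm_smul (c : ℂ) (A : H →L[ℂ] H) :
    traceENorm (c • A) = ‖c‖ₑ * traceENorm A := by
  unfold traceENorm posTrace
  rw [CFC.abs_smul, ← ENNReal.tsum_mul_left]
  refine tsum_congr fun i => ?_
  rw [← ofReal_norm, ← ENNReal.ofReal_mul (norm_nonneg _)]
  congr 1
  simp

theorem traceENorm_mul_le_of_norm_le_one (A B : H →L[ℂ] H) (hA : ‖A‖ ≤ 1) :
    traceENorm (A * B) ≤ traceENorm B := by
  obtain ⟨W, hW, h⟩ := exists_traceENorm_eq (A * B)
  rw [h]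
  refine le_trans (le_of_eq (tsum_congr fun i => ?_))
    (tsum_le_traceENorm B (ContinuousLinearMap.adjoint A * W) 1 ?_ ContinuousLinearMap.norm_id_le)
  · change _ = ‖⟪ContinuousLinearMap.adjoint A (W _), B _⟫_ℂ‖ₑ
    rw [ContinuousLinearMap.adjoint_inner_left]
    rfl
  · refine (ContinuousLinearMap.opNorm_comp_le _ _).trans ?_
    exact mul_le_one₀ (by simpa using hA) (norm_nonneg _) hW

theorem traceENorm_mul_le_left (A B : H →L[ℂ] H) :
    traceENorm (A * B) ≤ ‖A‖ₑ * traceENorm B := by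
  by_cases hA : A = 0
  · simp [hA, traceENorm_zero]
  have hc : (‖A‖ : ℂ) ≠ 0 := by simpa using hA
  have : A * B = (‖A‖ : ℂ) • (((‖A‖ : ℂ)⁻¹ • A) * B) := by
    rw [smul_mul_assoc, smul_smul, mul_inv_cancel₀ hc, one_smul]
  rw [this, traceENorm_smul]
  have h1 : ‖(‖A‖ : ℂ)‖ₑ = ‖A‖ₑ := by
    rw [← ofReal_norm, ← ofReal_norm]
    simp
  rw [h1]
  gcongr
  refine traceENorm_mul_le_of_norm_le_one _ _ ?_
  rw [norm_smul]
  simp [inv_mul_cancel₀ (norm_ne_zero_iff.2 hA)]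

theorem traceENorm_adjoint_le (A : H →L[ℂ] H) : traceENorm (star A) ≤ traceENorm A := by
  obtain ⟨W, hW, h⟩ := exists_traceENorm_eq (star A)
  rw [h]
  refine le_trans (le_of_eq (tsum_congr fun i => ?_))
    (tsum_le_traceENorm A 1 W ContinuousLinearMap.norm_id_le hW)
  rw [ContinuousLinearMap.star_eq_adjoint, ContinuousLinearMap.adjoint_inner_right,
    enorm_inner_symm]
  rfl

theorem traceENorm_star (A : H →L[ℂ] H) : traceENorm (star A) = traceENorm A :=
  le_antisymm (traceENorm_adjoint_le A) (by simpa using traceENorm_adjoint_le (star A))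

theorem traceENorm_mul_le_right (A B : H →L[ℂ] H) :
    traceENorm (A * B) ≤ traceENorm A * ‖B‖ₑ := by
  rw [← traceENorm_star, star_mul, mul_comm, ← traceENorm_star A]
  refine (traceENorm_mul_le_left _ _).trans (le_of_eq ?_)
  rw [← ofReal_norm, norm_star, ofReal_norm]

theorem enorm_le_traceENorm (A : H →L[ℂ] H) : ‖A‖ₑ ≤ traceENorm A := by
  by_cases htop : traceENorm A = ⊤
  · simp [htop]
  obtain ⟨W, hW, hWA, -⟩ := exists_polar A
  set b := stdBasis H
  have hs : IsSelfAdjoint (CFC.sqrt (CFC.abs A)) := IsSelfAdjoint.of_nonneg (CFC.sqrt_nonneg _)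
  have hm : CFC.sqrt (CFC.abs A) * CFC.sqrt (CFC.abs A) = CFC.abs A :=
    CFC.sqrt_mul_sqrt_self _ (CFC.abs_nonneg A)
  have htr : traceENorm A = hsSq b (CFC.sqrt (CFC.abs A)) :=
    posTrace_eq_hsSq b _ (CFC.abs_nonneg A)
  set R := CFC.sqrt (CFC.abs A)
  set t := (traceENorm A).toReal with ht
  have ht0 : 0 ≤ t := ENNReal.toReal_nonneg
  have hR : ∀ x, ‖R x‖ ^ 2 ≤ t * ‖x‖ ^ 2 := by
    intro x
    have h1 : ‖R x‖ₑ ^ 2 ≤ traceENorm A * ‖x‖ₑ ^ 2 := by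
      rw [enorm_sq_eq_tsum b, htr, hsSq, ← ENNReal.tsum_mul_right]
      refine ENNReal.tsum_le_tsum fun i => ?_
      rw [← mul_pow]
      refine pow_le_pow_left' ?_ 2
      rw [← ContinuousLinearMap.adjoint_inner_left, hs.adjoint_eq, ← ofReal_norm,
        ← ofReal_norm, ← ofReal_norm, ← ENNReal.ofReal_mul (norm_nonneg _)]
      exact ENNReal.ofReal_le_ofReal (norm_inner_le_norm _ _)
    have h2 := ENNReal.toReal_mono (ENNReal.mul_ne_top htop (by simp)) h1
    simpa [ENNReal.toReal_mul] using h2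
  have hRn : ‖R‖ ≤ Real.sqrt t := by
    refine R.opNorm_le_bound (Real.sqrt_nonneg _) fun x => ?_
    refine abs_le_of_sq_le_sq' ?_ (by positivity) |>.2
    rw [mul_pow, Real.sq_sqrt ht0]
    exact hR x
  have hA : ‖A‖ ≤ t := by
    have hA : A = W * (R * R) := by rw [hm, hWA]
    rw [hA]
    calc ‖W * (R * R)‖ ≤ ‖W‖ * (‖R‖ * ‖R‖) :=
          (norm_mul_le _ _).trans (by gcongr; exact norm_mul_le _ _)
      _ ≤ 1 * (Real.sqrt t * Real.sqrt t) := by gcongr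
      _ = t := by rw [one_mul, Real.mul_self_sqrt ht0]
  rw [← ofReal_norm, ← ENNReal.ofReal_toReal htop]
  exact ENNReal.ofReal_le_ofReal hA

variable (H) in
/-- The ideal `{x ∈ B(H) : Tr |x| < ∞}`, as a subalgebra of `B(H)`. -/
def traceClassIdeal : NonUnitalSubalgebra ℂ (H →L[ℂ] H) where
  carrier := {A | traceENorm A < ⊤}
  add_mem' {A B} hA hB := (traceENorm_add_le A B).trans_lt (ENNReal.add_lt_top.2 ⟨hA, hB⟩)
  zero_mem' := by simp [traceENorm_zero]
  mul_mem' {A B} _ hB := (traceENorm_mul_le_left A B).trans_lt (ENNReal.mul_lt_top (by simp) hB)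
  smul_mem' c A hA := by
    simp only [mem_ofPred_eq, traceENorm_smul] at hA ⊢
    exact ENNReal.mul_lt_top (by simp) hA

variable (H) in
/-- The algebra `𝓛¹(H)` of trace class operators; it is normed by `‖x‖ = Tr |x|` (and not by the
operator norm). -/
def L1 : Type v := ↥(traceClassIdeal H)

namespace L1

instance : NonUnitalRing (L1 H) := inferInstanceAs (NonUnitalRing (traceClassIdeal H))
instance : Module ℂ (L1 H) := inferInstanceAs (Module ℂ (traceClassIdeal H))
instance : IsScalarTower ℂ (L1 H) (L1 H) :=
  inferInstanceAs (IsScalarTower ℂ (traceClassIdeal H) (traceClassIdeal H))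
instance : SMulCommClass ℂ (L1 H) (L1 H) :=
  inferInstanceAs (SMulCommClass ℂ (traceClassIdeal H) (traceClassIdeal H))

/-- The underlying bounded operator of a trace class operator. -/
def op (T : L1 H) : H →L[ℂ] H := T.1

/-- A bounded operator `A` with `Tr |A| < ∞`, as an element of `𝓛¹(H)`. -/
def mk (A : H →L[ℂ] H) (hA : traceENorm A < ⊤) : L1 H := ⟨A, hA⟩

theorem op_injective : Function.Injective (op : L1 H → (H →L[ℂ] H)) := Subtype.val_injective

@[simp] theorem op_mk (A : H →L[ℂ] H) (hA : traceENorm A < ⊤) : op (mk A hA) = A := rfl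
@[simp] theorem op_add (S T : L1 H) : op (S + T) = op S + op T := rfl
@[simp] theorem op_mul (S T : L1 H) : op (S * T) = op S * op T := rfl
@[simp] theorem op_smul (c : ℂ) (T : L1 H) : op (c • T) = c • op T := rfl
@[simp] theorem op_zero : op (0 : L1 H) = 0 := rfl

theorem traceENorm_op_lt_top (T : L1 H) : traceENorm (op T) < ⊤ := T.2

instance : Norm (L1 H) := ⟨fun T => (traceENorm (op T)).toReal⟩

/-- The trace norm. -/
theorem norm_def (T : L1 H) : ‖T‖ = (traceENorm (op T)).toReal := rfl

theorem normedSpaceCore : NormedSpace.Core ℂ (L1 H) where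
  norm_nonneg _ := ENNReal.toReal_nonneg
  norm_smul c T := by simp [norm_def, traceENorm_smul, ENNReal.toReal_mul]
  norm_triangle S T := by
    rw [norm_def, norm_def, norm_def,
      ← ENNReal.toReal_add (traceENorm_op_lt_top S).ne (traceENorm_op_lt_top T).ne]
    exact ENNReal.toReal_mono
      (ENNReal.add_ne_top.2 ⟨(traceENorm_op_lt_top S).ne, (traceENorm_op_lt_top T).ne⟩)
      (traceENorm_add_le _ _)
  norm_eq_zero_iff T := by
    refine ⟨fun h => ?_, fun h => by simp [h, norm_def, traceENorm_zero]⟩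
    have h1 : traceENorm (op T) = 0 :=
      ((ENNReal.toReal_eq_zero_iff _).1 h).resolve_right (traceENorm_op_lt_top T).ne
    have h2 := enorm_le_traceENorm (op T)
    rw [h1, nonpos_iff_eq_zero, enorm_eq_zero] at h2
    exact op_injective h2

theorem norm_mul_le' (S T : L1 H) : ‖S * T‖ ≤ ‖S‖ * ‖T‖ := by
  rw [norm_def, norm_def, norm_def, ← ENNReal.toReal_mul]
  refine ENNReal.toReal_mono
    (ENNReal.mul_ne_top (traceENorm_op_lt_top S).ne (traceENorm_op_lt_top T).ne) ?_
  refine (traceENorm_mul_le_left _ _).trans ?_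
  exact mul_le_mul' (enorm_le_traceENorm _) le_rfl

instance : NonUnitalNormedRing (L1 H) where
  __ := (inferInstance : NonUnitalRing (L1 H))
  __ := NormedAddCommGroup.ofCore normedSpaceCore
  norm_mul_le := norm_mul_le'

instance : NormedSpace ℂ (L1 H) := NormedSpace.ofCore normedSpaceCore

end L1

end TraceClass

/-! ### Completed projective tensor powers -/

section ProjectiveTensor

variable {E : Type u} [AddCommGroup E] [Module ℂ E] {k : ℕ}

/-- `∑ⱼ |cⱼ| p₁(aⱼ₁) ⋯ pₖ(aⱼₖ)` for a formal sum `∑ⱼ cⱼ aⱼ₁ ⊗ ⋯ ⊗ aⱼₖ`. -/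
def projAux (p : Fin k → Seminorm ℂ E) (c : FreeAddMonoid (ℂ × (Fin k → E))) : ℝ :=
  (c.toList.map fun y => ‖y.1‖ * ∏ i, p i (y.2 i)).sum

theorem projAux_nonneg (p : Fin k → Seminorm ℂ E) (c : FreeAddMonoid (ℂ × (Fin k → E))) :
    0 ≤ projAux p c := by
  refine List.sum_nonneg fun a ha => ?_
  obtain ⟨y, -, rfl⟩ := List.mem_map.1 ha
  exact mul_nonneg (norm_nonneg _) (Finset.prod_nonneg fun i _ => apply_nonneg _ _)

theorem projAux_add (p : Fin k → Seminorm ℂ E) (c d : FreeAddMonoid (ℂ × (Fin k → E))) :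
    projAux p (c + d) = projAux p c + projAux p d := by
  simp [projAux]

theorem projAux_smul (p : Fin k → Seminorm ℂ E) (c : FreeAddMonoid (ℂ × (Fin k → E))) (a : ℂ) :
    projAux p (c.map (fun y : ℂ × (Fin k → E) => (a * y.1, y.2))) = ‖a‖ * projAux p c := by
  simp [projAux, Function.comp_def, mul_assoc, List.sum_map_mul_left]

theorem bddBelow_projAux (p : Fin k → Seminorm ℂ E) (x : ⨂[ℂ] (_ : Fin k), E) :
    BddBelow (range fun c : x.lifts => projAux p c.1) :=
  ⟨0, by rintro _ ⟨c, rfl⟩; exact projAux_nonneg p c.1⟩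

/-- The projective tensor product `p₁ ⊗ ⋯ ⊗ pₖ` of seminorms: the infimum of
`∑ⱼ p₁(aⱼ₁) ⋯ pₖ(aⱼₖ)` over all the ways to write a tensor as `∑ⱼ aⱼ₁ ⊗ ⋯ ⊗ aⱼₖ`. -/
def projSeminorm (p : Fin k → Seminorm ℂ E) : Seminorm ℂ (⨂[ℂ] (_ : Fin k), E) :=
  .ofSMulLE (fun x => ⨅ c : x.lifts, projAux p c.1)
    (le_antisymm ((ciInf_le (bddBelow_projAux p _) ⟨0, PiTensorProduct.lifts_zero⟩).trans
        (by simp [projAux]))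
      (le_ciInf fun c => projAux_nonneg p c.1))
    (fun x y => le_ciInf_add_ciInf fun c d =>
      ciInf_le_of_le (bddBelow_projAux p _) ⟨c.1 + d.1, PiTensorProduct.lifts_add c.2 d.2⟩
        (projAux_add p _ _).le)
    (fun a x => by
      rw [Real.mul_iInf_of_nonneg (norm_nonneg _)]
      refine le_ciInf fun c => ?_
      rw [← projAux_smul]
      exact ciInf_le_of_le (bddBelow_projAux p _) ⟨_, PiTensorProduct.lifts_smul c.2 a⟩ le_rfl)

theorem projSeminorm_apply (p : Fin k → Seminorm ℂ E) (x : ⨂[ℂ] (_ : Fin k), E) :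
    projSeminorm p x = ⨅ c : x.lifts, projAux p c.1 := rfl

/-- A multilinear map which is bounded by `p₁ ⋯ pₖ` is bounded by `p₁ ⊗ ⋯ ⊗ pₖ`. -/
theorem lift_le_projSeminorm {F : Type*} [AddCommGroup F] [Module ℂ F] (q : Seminorm ℂ F)
    (p : Fin k → Seminorm ℂ E) (f : MultilinearMap ℂ (fun _ : Fin k => E) F)
    (h : ∀ a, q (f a) ≤ ∏ i, p i (a i)) (x : ⨂[ℂ] (_ : Fin k), E) :
    q (PiTensorProduct.lift f x) ≤ projSeminorm p x := by
  refine le_ciInf fun c => ?_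
  obtain ⟨c, hc⟩ := c
  rw [PiTensorProduct.mem_lifts_iff] at hc
  subst hc
  simp only [projAux]
  induction c.toList with
  | nil => simp
  | cons y l ih =>
    simp only [List.map_cons, List.sum_cons, map_add, map_smul, PiTensorProduct.lift.tprod]
    refine (map_add_le_add q _ _).trans (add_le_add ?_ ih)
    rw [map_smul_eq_mul]
    exact mul_le_mul_of_nonneg_left (h _) (norm_nonneg _)

theorem projSeminorm_tprod_le (p : Fin k → Seminorm ℂ E) (a : Fin k → E) :
    projSeminorm p (PiTensorProduct.tprod ℂ a) ≤ ∏ i, p i (a i) := by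
  refine (ciInf_le (bddBelow_projAux p _)
    ⟨FreeAddMonoid.of (1, a), by simp [PiTensorProduct.mem_lifts_iff]⟩).trans ?_
  simp [projAux]

/-- The algebraic tensor power `E ⊙ ⋯ ⊙ E` (`k` factors), to be equipped with the projective tensor
product topology. -/
def ProjTensor (k : ℕ) (E : Type u) [AddCommGroup E] [Module ℂ E] : Type u := ⨂[ℂ] (_ : Fin k), E

instance : AddCommGroup (ProjTensor k E) := inferInstanceAs (AddCommGroup (⨂[ℂ] (_ : Fin k), E))
instance : Module ℂ (ProjTensor k E) := inferInstanceAs (Module ℂ (⨂[ℂ] (_ : Fin k), E))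

/-- The universal multilinear map `(a₁, …, aₖ) ↦ a₁ ⊗ ⋯ ⊗ aₖ`. -/
def ProjTensor.tprod : MultilinearMap ℂ (fun _ : Fin k => E) (ProjTensor k E) :=
  PiTensorProduct.tprod ℂ

/-- The linear map on the tensor power induced by a multilinear map. -/
def ProjTensor.lift {F : Type*} [AddCommGroup F] [Module ℂ F]
    (f : MultilinearMap ℂ (fun _ : Fin k => E) F) : ProjTensor k E →ₗ[ℂ] F :=
  PiTensorProduct.lift f

theorem ProjTensor.lift_tprod {F : Type*} [AddCommGroup F] [Module ℂ F]
    (f : MultilinearMap ℂ (fun _ : Fin k => E) F) (a : Fin k → E) :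
    ProjTensor.lift f (ProjTensor.tprod a) = f a :=
  PiTensorProduct.lift.tprod a

/-- The seminorms `p₁ ⊗ ⋯ ⊗ pₖ` on the tensor power, where `p₁, …, pₖ` are continuous seminorms. -/
def ProjTensor.seminormFamily (k : ℕ) (E : Type u) [AddCommGroup E] [Module ℂ E]
    [TopologicalSpace E] :
    SeminormFamily ℂ (ProjTensor k E) (Fin k → {p : Seminorm ℂ E // Continuous p}) :=
  fun p => projSeminorm fun i => (p i).1

variable [TopologicalSpace E]

/-- The projective tensor product topology (with its uniformity), which is generated by the
seminorms `p₁ ⊗ ⋯ ⊗ pₖ`, where `p₁, …, pₖ` are continuous seminorms. -/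
instance : UniformSpace (ProjTensor k E) :=
  ⨅ p, (ProjTensor.seminormFamily k E p).toSeminormedAddCommGroup.toUniformSpace

instance : IsUniformAddGroup (ProjTensor k E) :=
  isUniformAddGroup_iInf fun p =>
    @SeminormedAddCommGroup.to_isUniformAddGroup _
      (ProjTensor.seminormFamily k E p).toSeminormedAddCommGroup

theorem ProjTensor.withSeminorms : WithSeminorms (ProjTensor.seminormFamily k E) :=
  (SeminormFamily.withSeminorms_iff_uniformSpace_eq_iInf _).2 rfl

instance : ContinuousSMul ℂ (ProjTensor k E) := ProjTensor.withSeminorms.continuousSMul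

instance : UniformContinuousConstSMul ℂ (ProjTensor k E) :=
  uniformContinuousConstSMul_of_continuousConstSMul _ _

/-- The completed projective tensor power `E ⊗̂ ⋯ ⊗̂ E` (`k` factors): the Hausdorff completion
of the algebraic tensor power for the projective tensor product topology. -/
abbrev CompletedTensor (k : ℕ) (E : Type u) [AddCommGroup E] [Module ℂ E] [TopologicalSpace E] :
    Type u := UniformSpace.Completion (ProjTensor k E)

/-- The canonical map from the algebraic tensor power to its completion. -/
def CompletedTensor.incl : ProjTensor k E →L[ℂ] CompletedTensor k E where
  toFun := (↑)
  map_add' := UniformSpace.Completion.coe_add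
  map_smul' c x := UniformSpace.Completion.coe_smul c x
  cont := UniformSpace.Completion.continuous_coe _

/-- The extension to the completions of a continuous linear map of tensor powers. -/
def CompletedTensor.map {l : ℕ} (f : ProjTensor k E →L[ℂ] ProjTensor l E) :
    CompletedTensor k E →L[ℂ] CompletedTensor l E :=
  (CompletedTensor.incl ∘L f).extend CompletedTensor.incl

theorem CompletedTensor.map_incl {l : ℕ} (f : ProjTensor k E →L[ℂ] ProjTensor l E)
    (x : ProjTensor k E) :
    CompletedTensor.map f (CompletedTensor.incl x) = CompletedTensor.incl (f x) :=
  ContinuousLinearMap.extend_eq _ (e := CompletedTensor.incl)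
    UniformSpace.Completion.denseRange_coe
    (UniformSpace.Completion.isUniformInducing_coe _) x

end ProjectiveTensor

/-! ### The topological bar complex and `H`-unitality -/

section Bar

variable {A : Type u} [NonUnitalRing A] [Module ℂ A] [IsScalarTower ℂ A A] [SMulCommClass ℂ A A]

theorem contractNth_update {n : ℕ} (j : Fin (n + 1)) (a : Fin (n + 2) → A) (i : Fin (n + 2)) :
    ∃ (k : Fin (n + 1)) (L : A →ₗ[ℂ] A), ∀ x,
      Fin.contractNth j.castSucc (· * ·) (Function.update a i x) =
        Function.update (Fin.contractNth j.castSucc (· * ·) a) k (L x) := by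
  rcases lt_trichotomy (i : ℕ) j with h | h | h
  · refine ⟨⟨i, by omega⟩, LinearMap.id, fun x => funext fun m => ?_⟩
    simp only [Fin.contractNth, Function.update_apply, Fin.ext_iff, Fin.val_castSucc, Fin.val_succ,
      LinearMap.id_apply]
    grind
  · refine ⟨j, LinearMap.mulRight ℂ (a j.succ), fun x => funext fun m => ?_⟩
    simp only [Fin.contractNth, Function.update_apply, Fin.ext_iff, Fin.val_castSucc, Fin.val_succ,
      LinearMap.mulRight_apply]
    grind
  by_cases h' : (i : ℕ) = j + 1
  · refine ⟨j, LinearMap.mulLeft ℂ (a j.castSucc), fun x => funext fun m => ?_⟩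
    simp only [Fin.contractNth, Function.update_apply, Fin.ext_iff, Fin.val_castSucc, Fin.val_succ,
      LinearMap.mulLeft_apply]
    grind
  · refine ⟨⟨i - 1, by omega⟩, LinearMap.id, fun x => funext fun m => ?_⟩
    simp only [Fin.contractNth, Function.update_apply, Fin.ext_iff, Fin.val_castSucc, Fin.val_succ,
      LinearMap.id_apply]
    grind

/-- The multilinear map
`(a₀, …, aₙ₊₁) ↦ a₀ ⊗ ⋯ ⊗ aⱼ aⱼ₊₁ ⊗ ⋯ ⊗ aₙ₊₁`. -/
def barFaceMultilinear (A : Type u) [NonUnitalRing A] [Module ℂ A] [IsScalarTower ℂ A A]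
    [SMulCommClass ℂ A A] (n : ℕ) (j : Fin (n + 1)) :
    MultilinearMap ℂ (fun _ : Fin (n + 2) => A) (ProjTensor (n + 1) A) where
  toFun a := ProjTensor.tprod (Fin.contractNth j.castSucc (· * ·) a)
  map_update_add' {dec} a i x y := by
    rw [Subsingleton.elim dec (instDecidableEqFin _)]
    obtain ⟨k, L, h⟩ := contractNth_update j a i
    simp only [h, map_add, MultilinearMap.map_update_add]
  map_update_smul' {dec} a i c x := by
    rw [Subsingleton.elim dec (instDecidableEqFin _)]
    obtain ⟨k, L, h⟩ := contractNth_update j a i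
    simp only [h, map_smul, MultilinearMap.map_update_smul]

/-- The differential of the algebraic bar complex,
`b'(a₀ ⊗ ⋯ ⊗ aₙ₊₁) = ∑_{j ≤ n} (-1)ʲ a₀ ⊗ ⋯ ⊗ aⱼ aⱼ₊₁ ⊗ ⋯ ⊗ aₙ₊₁`. -/
def algBarD (A : Type u) [NonUnitalRing A] [Module ℂ A] [IsScalarTower ℂ A A]
    [SMulCommClass ℂ A A] (n : ℕ) : ProjTensor (n + 2) A →ₗ[ℂ] ProjTensor (n + 1) A :=
  ∑ j : Fin (n + 1), (-1 : ℂ) ^ (j : ℕ) • ProjTensor.lift (barFaceMultilinear A n j)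

variable [TopologicalSpace A] [PolynormableSpace ℂ A] [ContinuousMul A]

theorem exists_seminorm_mul_le (p : Seminorm ℂ A) (hp : Continuous p) :
    ∃ q : Seminorm ℂ A, Continuous q ∧ ∀ a b, p (a * b) ≤ q a * q b := by
  have hw := PolynormableSpace.withSeminorms ℂ A
  have := hw.topologicalAddGroup
  have h1 : ∀ᶠ z : A × A in 𝓝 ((0 : A), (0 : A)), p (z.1 * z.2) < 1 := by
    have : Continuous fun z : A × A => p (z.1 * z.2) := hp.comp continuous_mul
    refine this.continuousAt.eventually_lt continuousAt_const ?_
    simp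
  rw [nhds_prod_eq] at h1
  obtain ⟨U, hU, V, hV, hUV⟩ := Filter.eventually_prod_iff.1 h1
  obtain ⟨⟨s, ε⟩, hε, hs⟩ := hw.hasBasis_zero_ball.mem_iff.1 (Filter.inter_mem hU hV)
  let f : {p : Seminorm ℂ A // Continuous p} → Seminorm ℂ A := Subtype.val
  have hq : Continuous (s.sup f : Seminorm ℂ A) := Seminorm.continuous_finsetSup fun i _ => i.2
  set q : Seminorm ℂ A := s.sup f
  simp only at hε
  refine ⟨(NNReal.mk ε⁻¹ (inv_pos.2 hε).le) • q, continuous_const.mul hq, fun a b => ?_⟩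
  have key : ∀ σ τ : ℝ, ε⁻¹ * q a < σ → ε⁻¹ * q b < τ → p (a * b) ≤ σ * τ := by
    intro σ τ hσ hτ
    have hσ0 : 0 < σ := lt_of_le_of_lt (by positivity) hσ
    have hτ0 : 0 < τ := lt_of_le_of_lt (by positivity) hτ
    have ha : ((σ⁻¹ : ℝ) : ℂ) • a ∈ q.ball 0 ε := by
      rw [Seminorm.mem_ball_zero, map_smul_eq_mul, Complex.norm_real, Real.norm_of_nonneg (by positivity)]
      rw [inv_mul_lt_iff₀ hε] at hσ
      rw [inv_mul_lt_iff₀ hσ0, mul_comm]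
      exact hσ
    have hb : ((τ⁻¹ : ℝ) : ℂ) • b ∈ q.ball 0 ε := by
      rw [Seminorm.mem_ball_zero, map_smul_eq_mul, Complex.norm_real, Real.norm_of_nonneg (by positivity)]
      rw [inv_mul_lt_iff₀ hε] at hτ
      rw [inv_mul_lt_iff₀ hτ0, mul_comm]
      exact hτ
    have := hUV (hs ha).1 (hs hb).2
    simp only [smul_mul_smul_comm, map_smul_eq_mul] at this
    rw [← Complex.ofReal_mul, Complex.norm_real, Real.norm_of_nonneg (by positivity)] at this
    rw [← mul_inv, inv_mul_lt_iff₀ (by positivity), mul_one] at this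
    exact this.le
  change p (a * b) ≤ (ε⁻¹ * q a) * (ε⁻¹ * q b)
  have hlim : Tendsto (fun t : ℝ => (ε⁻¹ * q a + t) * (ε⁻¹ * q b + t)) (𝓝[>] 0)
      (𝓝 ((ε⁻¹ * q a + 0) * (ε⁻¹ * q b + 0))) := by
    refine Tendsto.mono_left ?_ nhdsWithin_le_nhds
    exact Continuous.tendsto (by fun_prop) 0
  rw [add_zero, add_zero] at hlim
  refine ge_of_tendsto hlim ?_
  filter_upwards [self_mem_nhdsWithin] with t ht
  have ht : 0 < t := ht
  exact key _ _ (by linarith) (by linarith)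

theorem continuous_barFace (n : ℕ) (j : Fin (n + 1)) :
    Continuous (ProjTensor.lift (barFaceMultilinear A n j)) := by
  refine WithSeminorms.continuous_of_continuous_comp ProjTensor.withSeminorms _ fun p => ?_
  obtain ⟨q, hq, hpq⟩ := exists_seminorm_mul_le (p j).1 (p j).2
  let r : Fin (n + 2) → {p : Seminorm ℂ A // Continuous p} := fun i =>
    if h : (i : ℕ) < j then p ⟨i, by omega⟩
    else if h : (i : ℕ) ≤ j + 1 then ⟨q, hq⟩ else p ⟨i - 1, by omega⟩
  refine Seminorm.continuous_of_le (ProjTensor.withSeminorms.continuous_seminorm r) fun x => ?_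
  refine lift_le_projSeminorm (F := ProjTensor (n + 1) A)
    (ProjTensor.seminormFamily (n + 1) A p) (fun i => (r i).1) _ (fun a => ?_) x
  refine (projSeminorm_tprod_le _ _).trans ?_
  rw [Fin.prod_univ_succAbove (fun i => (r i).1 (a i)) j.castSucc,
    ← Finset.mul_prod_erase Finset.univ _ (Finset.mem_univ j),
    ← Finset.mul_prod_erase Finset.univ
      (fun i => (r (j.castSucc.succAbove i)).1 (a (j.castSucc.succAbove i))) (Finset.mem_univ j),
    ← mul_assoc]
  have hr1 : (r j.castSucc).1 = q := by simp [r]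
  have hr2 : (r j.succ).1 = q := by simp [r]
  have hj : j.castSucc.succAbove j = j.succ := Fin.succAbove_castSucc_self j
  rw [hj, hr1, hr2, Fin.contractNth_apply_of_eq _ _ _ _ (by simp)]
  refine mul_le_mul (hpq _ _) (le_of_eq ?_) (Finset.prod_nonneg fun i _ => apply_nonneg _ _)
    (mul_nonneg (apply_nonneg _ _) (apply_nonneg _ _))
  refine Finset.prod_congr rfl fun i hi => ?_
  have hij : i ≠ j := Finset.ne_of_mem_erase hi
  rcases lt_or_gt_of_ne hij with h | h
  · rw [Fin.contractNth_apply_of_lt _ _ _ _ (by simpa using h),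
      Fin.succAbove_of_castSucc_lt _ _ (by simpa using h)]
    have h' : (i : ℕ) < j := h
    simp [r, h']
  · rw [Fin.contractNth_apply_of_gt _ _ _ _ (by simpa using h),
      Fin.succAbove_of_le_castSucc _ _ (by simpa using h.le)]
    have h' : (j : ℕ) < i := h
    have h1 : ¬ ((i : ℕ) + 1 < j) := by omega
    have h2 : ¬ ((i : ℕ) ≤ j) := by omega
    simp [r, h1, h2]

theorem continuous_algBarD (n : ℕ) : Continuous (algBarD A n) := by
  have : ⇑(algBarD A n) = fun x => ∑ j : Fin (n + 1),
      (-1 : ℂ) ^ (j : ℕ) • ProjTensor.lift (barFaceMultilinear A n j) x := by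
    ext x
    simp [algBarD]
  rw [this]
  exact continuous_finsetSum _ fun j _ => (continuous_const_smul _).comp (continuous_barFace n j)

/-- The differential `b' : A^{⊗̂ (n + 2)} → A^{⊗̂ (n + 1)}` of the topological bar complex, whose
term of degree `k ≥ 1` is the completed projective tensor power `A^{⊗̂ k}`. -/
def barD (A : Type u) [NonUnitalRing A] [Module ℂ A] [IsScalarTower ℂ A A] [SMulCommClass ℂ A A]
    [TopologicalSpace A] [PolynormableSpace ℂ A] [ContinuousMul A] (n : ℕ) :
    CompletedTensor (n + 2) A →L[ℂ] CompletedTensor (n + 1) A :=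
  CompletedTensor.map ⟨algBarD A n, continuous_algBarD n⟩

/-- `A` is topologically `H`-unital: its topological bar complex
`⋯ → A ⊗̂ A ⊗̂ A → A ⊗̂ A → A → 0` is contractible, i.e. it has a contracting homotopy which
consists of continuous linear maps. -/
def TopologicallyHUnital (A : Type u) [NonUnitalRing A] [Module ℂ A] [IsScalarTower ℂ A A]
    [SMulCommClass ℂ A A] [TopologicalSpace A] [PolynormableSpace ℂ A] [ContinuousMul A] : Prop :=
  ∃ h : ∀ n : ℕ, CompletedTensor (n + 1) A →L[ℂ] CompletedTensor (n + 2) A,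
    barD A 0 ∘L h 0 = ContinuousLinearMap.id ℂ _ ∧
    ∀ n : ℕ, barD A (n + 1) ∘L h (n + 1) + h n ∘L barD A n = ContinuousLinearMap.id ℂ _

end Bar

/-! ### The projective unitary group and principal bundles -/

section ProjectiveUnitary

variable (H : Type v) [NormedAddCommGroup H] [InnerProductSpace ℂ H] [CompleteSpace H]

/-- The subgroup `U(1)` of scalars in the unitary group `U(H)`. -/
def scalarUnitary : Subgroup (unitary (H →L[ℂ] H)) where
  carrier := {u | ∃ z : ℂ, ‖z‖ = 1 ∧ (u : H →L[ℂ] H) = z • (1 : H →L[ℂ] H)}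
  mul_mem' := by
    rintro u v ⟨z, hz, hu⟩ ⟨w, hw, hv⟩
    refine ⟨z * w, by simp [hz, hw], ?_⟩
    rw [Submonoid.coe_mul, hu, hv, smul_mul_smul_comm, one_mul]
  one_mem' := ⟨1, by simp, by simp⟩
  inv_mem' := by
    rintro u ⟨z, hz, hu⟩
    refine ⟨star z, by simpa using hz, ?_⟩
    rw [← Unitary.star_eq_inv, Unitary.coe_star, hu, star_smul, star_one]

instance : (scalarUnitary H).Normal where
  conj_mem := by
    rintro u ⟨z, hz, hu⟩ g
    refine ⟨z, hz, ?_⟩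
    rw [Submonoid.coe_mul, Submonoid.coe_mul, hu, mul_smul_comm, mul_one, smul_mul_assoc,
      ← Submonoid.coe_mul, mul_inv_cancel, Submonoid.coe_one]

/-- The projective unitary group `PU(H) = U(H) / U(1)`, with the (quotient of the) norm topology. -/
abbrev PU : Type v := unitary (H →L[ℂ] H) ⧸ scalarUnitary H

variable {H}

theorem traceENorm_conj_lt_top (u : unitary (H →L[ℂ] H)) (T : L1 H) :
    traceENorm ((u : H →L[ℂ] H) * L1.op T * star (u : H →L[ℂ] H)) < ⊤ := by
  refine (traceENorm_mul_le_right _ _).trans_lt (ENNReal.mul_lt_top ?_ (by simp))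
  exact (traceENorm_mul_le_left _ _).trans_lt
    (ENNReal.mul_lt_top (by simp) (L1.traceENorm_op_lt_top T))

/-- The action of `U(H)` on `𝓛¹(H)` by conjugation, `T ↦ u T u*`. -/
def conjU : unitary (H →L[ℂ] H) →* (L1 H →ₗ[ℂ] L1 H) where
  toFun u :=
    { toFun := fun T => L1.mk _ (traceENorm_conj_lt_top u T)
      map_add' := fun S T => L1.op_injective (by simp [mul_add, add_mul])
      map_smul' := fun c T => L1.op_injective (by simp) }
  map_one' := LinearMap.ext fun T => L1.op_injective (by simp)
  map_mul' u v := LinearMap.ext fun T => L1.op_injective (by simp [mul_assoc])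

theorem op_conjU (u : unitary (H →L[ℂ] H)) (T : L1 H) :
    L1.op (conjU u T) = (u : H →L[ℂ] H) * L1.op T * star (u : H →L[ℂ] H) := rfl

/-- The adjoint action of `PU(H)` on `𝓛¹(H)`. -/
def Ad : PU H →* (L1 H →ₗ[ℂ] L1 H) :=
  QuotientGroup.lift (scalarUnitary H) conjU (by
    rintro u ⟨z, hz, hu⟩
    refine LinearMap.ext fun T => L1.op_injective ?_
    rw [op_conjU, hu, star_smul, star_one, smul_mul_assoc, one_mul, mul_smul_comm, mul_one,
      smul_smul]
    have : star z * z = 1 := by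
      have := Complex.normSq_eq_conj_mul_self (z := z)
      rw [Complex.normSq_eq_norm_sq, hz] at this
      simpa using this.symm
    rw [this, one_smul]
    rfl)

theorem Ad_coe (u : unitary (H →L[ℂ] H)) : Ad (u : PU H) = conjU u := rfl

theorem Ad_mul (g : PU H) (S T : L1 H) : Ad g (S * T) = Ad g S * Ad g T := by
  induction g using QuotientGroup.induction_on with
  | H u =>
    rw [Ad_coe]
    refine L1.op_injective ?_
    rw [L1.op_mul, op_conjU, op_conjU, op_conjU, L1.op_mul]
    have : star (u : H →L[ℂ] H) * u = 1 := Unitary.coe_star_mul_self u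
    calc (u : H →L[ℂ] H) * (L1.op S * L1.op T) * star (u : H →L[ℂ] H)
        = (u : H →L[ℂ] H) * L1.op S * (star (u : H →L[ℂ] H) * u) * L1.op T
            * star (u : H →L[ℂ] H) := by rw [this]; simp only [mul_assoc, one_mul]
      _ = _ := by simp only [mul_assoc]

theorem Ad_inv_apply (g : PU H) (T : L1 H) : Ad g⁻¹ (Ad g T) = T := by
  rw [← Module.End.mul_apply, ← map_mul, inv_mul_cancel, map_one, Module.End.one_apply]

theorem Ad_apply_inv (g : PU H) (T : L1 H) : Ad g (Ad g⁻¹ T) = T := by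
  rw [← Module.End.mul_apply, ← map_mul, mul_inv_cancel, map_one, Module.End.one_apply]

end ProjectiveUnitary

section Bundle

variable {n : ℕ} {X : Type u} [TopologicalSpace X] [ChartedSpace (EuclideanSpace ℝ (Fin n)) X]
  {H : Type v} [NormedAddCommGroup H] [InnerProductSpace ℂ H] [CompleteSpace H]

variable (n) in
/-- Smoothness on `s ⊆ X` of a map with values in the Banach Lie group `PU(H) = U(H) / U(1)`. As
`U(H) → PU(H)` is a submersion and `U(H)` is a submanifold of the Banach space of bounded operators,
this means that the map lifts locally to a smooth map with values in the unitary operators. -/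
def SmoothIntoPU (g : X → PU H) (s : Set X) : Prop :=
  ∀ x ∈ s, ∃ V : Set X, IsOpen V ∧ x ∈ V ∧ ∃ u : X → unitary (H →L[ℂ] H),
    (∀ y ∈ V ∩ s, (u y : PU H) = g y) ∧
    ContMDiffOn (𝓡 n) 𝓘(ℝ, H →L[ℂ] H) ∞ (fun y => (u y : H →L[ℂ] H)) (V ∩ s)

open MulOpposite in
/-- A smooth principal `PU(H)`-bundle `P → X`: a space with a right action of `PU(H)`, given with a
family of equivariant local trivializations over open sets which cover `X`, such that the transition
functions are smooth maps into `PU(H)`. -/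
structure PrincipalPUBundle (n : ℕ) (X : Type u) [TopologicalSpace X]
    [ChartedSpace (EuclideanSpace ℝ (Fin n)) X] (H : Type v) [NormedAddCommGroup H]
    [InnerProductSpace ℂ H] [CompleteSpace H] where
  /-- The total space `P`. -/
  Total : Type w
  [topology : TopologicalSpace Total]
  /-- The right action of `PU(H)`; `p · g` is written `op g • p`. -/
  [action : MulAction (PU H)ᵐᵒᵖ Total]
  /-- The projection `P → X`. -/
  proj : Total → X
  proj_smul : ∀ (g : PU H) (p : Total), proj (op g • p) = proj p
  /-- The local trivializations `P|_U ≅ U × PU(H)`. -/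
  atlas : Set (Bundle.Trivialization (PU H) proj)
  exists_mem_atlas : ∀ x : X, ∃ e ∈ atlas, x ∈ e.baseSet
  equivariant : ∀ e ∈ atlas, ∀ p : Total, proj p ∈ e.baseSet →
    ∀ g : PU H, (e (op g • p)).2 = (e p).2 * g
  smooth_transition : ∀ e ∈ atlas, ∀ e' ∈ atlas,
    SmoothIntoPU n (fun x => (e' (e.invFun (x, 1))).2) (e.baseSet ∩ e'.baseSet)

namespace PrincipalPUBundle

open MulOpposite

attribute [instance] PrincipalPUBundle.topology PrincipalPUBundle.action

variable (P : PrincipalPUBundle.{u, v, w} n X H)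

theorem exists_smul_eq {p q : P.Total} (h : P.proj p = P.proj q) : ∃ g : PU H, q = op g • p := by
  obtain ⟨e, he, hx⟩ := P.exists_mem_atlas (P.proj p)
  refine ⟨(e p).2⁻¹ * (e q).2, ?_⟩
  have hp : q ∈ e.source := e.mem_source.2 (h ▸ hx)
  have hs : op ((e p).2⁻¹ * (e q).2) • p ∈ e.source := by
    rw [e.mem_source, P.proj_smul]
    exact hx
  refine e.injOn hp hs (Prod.ext ?_ ?_)
  · change (e q).1 = (e _).1
    rw [e.coe_fst hp, e.coe_fst hs, P.proj_smul, h]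
  · change (e q).2 = (e _).2
    rw [P.equivariant e he p hx, mul_inv_cancel_left]

theorem smul_eq_self {p : P.Total} {g : PU H} (h : op g • p = p) : g = 1 := by
  obtain ⟨e, he, hx⟩ := P.exists_mem_atlas (P.proj p)
  have := P.equivariant e he p hx g
  rw [h] at this
  exact left_eq_mul.1 this

theorem exists_proj_eq (x : X) : ∃ p : P.Total, P.proj p = x := by
  obtain ⟨e, he, hx⟩ := P.exists_mem_atlas x
  exact ⟨e.invFun (x, 1), e.proj_symm_apply (e.mem_target.2 hx)⟩

/-! ### The associated bundle of algebras and its smooth sections -/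

/-- The relation `(p g, T) ∼ (p, g T g⁻¹)` on `P|_x × 𝓛¹(H)`. -/
def fiberSetoid (x : X) : Setoid ({p : P.Total // P.proj p = x} × L1 H) where
  r a b := ∃ g : PU H, (b.1 : P.Total) = op g • (a.1 : P.Total) ∧ a.2 = Ad g b.2
  iseqv :=
    { refl := fun a => ⟨1, by simp, by simp⟩
      symm := by
        rintro a b ⟨g, h1, h2⟩
        refine ⟨g⁻¹, ?_, ?_⟩
        · rw [h1, smul_smul, ← op_mul, mul_inv_cancel, op_one, one_smul]
        · rw [h2, Ad_inv_apply]
      trans := by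
        rintro a b c ⟨g, h1, h2⟩ ⟨g', h3, h4⟩
        refine ⟨g * g', ?_, ?_⟩
        · rw [h3, h1, smul_smul, op_mul]
        · rw [h2, h4, map_mul, Module.End.mul_apply] }

/-- The fibre over `x` of the associated bundle `𝓛¹(P) = P ×_{PU(H)} 𝓛¹(H)`. -/
def Fiber (x : X) : Type (max v w) := Quotient (P.fiberSetoid x)

/-- The class `[p, T]` in `𝓛¹(P)`. -/
def fiberMk {x : X} (p : {p : P.Total // P.proj p = x}) (T : L1 H) : P.Fiber x :=
  Quotient.mk (P.fiberSetoid x) (p, T)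

theorem fiberMk_bijective {x : X} (p : {p : P.Total // P.proj p = x}) :
    Function.Bijective (P.fiberMk p) := by
  constructor
  · intro S T h
    obtain ⟨g, h1, h2⟩ := Quotient.exact h
    rw [P.smul_eq_self h1.symm] at h2
    simpa using h2
  · intro y
    induction y using Quotient.inductionOn with
    | h a =>
      obtain ⟨q, T⟩ := a
      obtain ⟨g, hg⟩ := P.exists_smul_eq (p := p) (q := q) (p.2.trans q.2.symm)
      exact ⟨Ad g T, Quotient.sound ⟨g, hg, rfl⟩⟩

/-- The bijection `T ↦ [p, T]` of `𝓛¹(H)` with the fibre of `𝓛¹(P)` which is given by a point `p`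
of `P`. -/
def frame {x : X} (p : {p : P.Total // P.proj p = x}) : L1 H ≃ P.Fiber x :=
  Equiv.ofBijective _ (P.fiberMk_bijective p)

/-- A chosen point of `P` over `x`. -/
def basePoint (x : X) : {p : P.Total // P.proj p = x} :=
  ⟨(P.exists_proj_eq x).choose, (P.exists_proj_eq x).choose_spec⟩

/-- The algebra structure of the fibres of `𝓛¹(P)`, `[p, S] + [p, T] = [p, S + T]` and
`[p, S] [p, T] = [p, S T]`; it does not depend on `p`. -/
instance (x : X) : NonUnitalRing (P.Fiber x) := (P.frame (P.basePoint x)).symm.nonUnitalRing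
instance (x : X) : Module ℂ (P.Fiber x) := (P.frame (P.basePoint x)).symm.module ℂ

theorem exists_frame_eq {x : X} (p q : {p : P.Total // P.proj p = x}) :
    ∃ g : PU H, ∀ T, P.frame p T = P.frame q (Ad g T) := by
  obtain ⟨g, hg⟩ := P.exists_smul_eq (p := q) (q := p) (q.2.trans p.2.symm)
  exact ⟨g, fun T => (Quotient.sound ⟨g, hg, rfl⟩ :
    P.fiberMk q (Ad g T) = P.fiberMk p T).symm⟩

theorem frame_add {x : X} (p : {p : P.Total // P.proj p = x}) (S T : L1 H) :
    P.frame p (S + T) = P.frame p S + P.frame p T := by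
  obtain ⟨g, hg⟩ := P.exists_frame_eq p (P.basePoint x)
  rw [hg, hg, hg, map_add]
  change _ = P.frame _ ((P.frame _).symm _ + (P.frame _).symm _)
  rw [Equiv.symm_apply_apply, Equiv.symm_apply_apply]

theorem frame_mul {x : X} (p : {p : P.Total // P.proj p = x}) (S T : L1 H) :
    P.frame p (S * T) = P.frame p S * P.frame p T := by
  obtain ⟨g, hg⟩ := P.exists_frame_eq p (P.basePoint x)
  rw [hg, hg, hg, Ad_mul]
  change _ = P.frame _ ((P.frame _).symm _ * (P.frame _).symm _)
  rw [Equiv.symm_apply_apply, Equiv.symm_apply_apply]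

theorem frame_smul {x : X} (p : {p : P.Total // P.proj p = x}) (c : ℂ) (T : L1 H) :
    P.frame p (c • T) = c • P.frame p T := by
  obtain ⟨g, hg⟩ := P.exists_frame_eq p (P.basePoint x)
  rw [hg, hg, map_smul]
  change _ = P.frame _ (c • (P.frame _).symm _)
  rw [Equiv.symm_apply_apply]

instance (x : X) : IsScalarTower ℂ (P.Fiber x) (P.Fiber x) where
  smul_assoc c a b := by
    obtain ⟨S, rfl⟩ := (P.frame (P.basePoint x)).surjective a
    obtain ⟨T, rfl⟩ := (P.frame (P.basePoint x)).surjective b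
    rw [smul_eq_mul, smul_eq_mul, ← frame_smul, ← frame_mul, smul_mul_assoc, frame_smul, frame_mul]

instance (x : X) : SMulCommClass ℂ (P.Fiber x) (P.Fiber x) where
  smul_comm c a b := by
    obtain ⟨S, rfl⟩ := (P.frame (P.basePoint x)).surjective a
    obtain ⟨T, rfl⟩ := (P.frame (P.basePoint x)).surjective b
    rw [smul_eq_mul, smul_eq_mul, ← frame_mul, ← frame_smul, ← mul_smul_comm, frame_mul, frame_smul]

/-- The element `T` of `𝓛¹(H)` such that `s(π(p)) = [p, T]`, for a section `s` of `𝓛¹(P)`. -/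
def coord (s : ∀ x, P.Fiber x) (p : P.Total) : L1 H :=
  (P.frame ⟨p, rfl⟩).symm (s (P.proj p))

theorem frame_coord (s : ∀ x, P.Fiber x) (p : P.Total) :
    P.frame ⟨p, rfl⟩ (P.coord s p) = s (P.proj p) := Equiv.apply_symm_apply _ _

theorem coord_add (s t : ∀ x, P.Fiber x) (p : P.Total) :
    P.coord (s + t) p = P.coord s p + P.coord t p := by
  refine (P.frame ⟨p, rfl⟩).injective ?_
  rw [frame_add, frame_coord, frame_coord, frame_coord, Pi.add_apply]

theorem coord_mul (s t : ∀ x, P.Fiber x) (p : P.Total) :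
    P.coord (s * t) p = P.coord s p * P.coord t p := by
  refine (P.frame ⟨p, rfl⟩).injective ?_
  rw [frame_mul, frame_coord, frame_coord, frame_coord, Pi.mul_apply]

theorem coord_smul (c : ℂ) (s : ∀ x, P.Fiber x) (p : P.Total) :
    P.coord (c • s) p = c • P.coord s p := by
  refine (P.frame ⟨p, rfl⟩).injective ?_
  rw [frame_smul, frame_coord, frame_coord, Pi.smul_apply]

/-- The `𝓛¹(H)`-valued function on `U` which represents a section of `𝓛¹(P)` in a local
trivialization `e` of `P` over `U` (it has no meaning outside `U`). -/
def localRep (e : Bundle.Trivialization (PU H) P.proj) (s : ∀ x, P.Fiber x) (x : X) : L1 H :=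
  P.coord s (e.invFun (x, 1))

theorem localRep_add (e : Bundle.Trivialization (PU H) P.proj) (s t : ∀ x, P.Fiber x) :
    P.localRep e (s + t) = P.localRep e s + P.localRep e t := funext fun _ => P.coord_add _ _ _

theorem localRep_mul (e : Bundle.Trivialization (PU H) P.proj) (s t : ∀ x, P.Fiber x) :
    P.localRep e (s * t) = P.localRep e s * P.localRep e t := funext fun _ => P.coord_mul _ _ _

theorem localRep_smul (e : Bundle.Trivialization (PU H) P.proj) (c : ℂ) (s : ∀ x, P.Fiber x) :
    P.localRep e (c • s) = c • P.localRep e s := funext fun _ => P.coord_smul _ _ _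

theorem contMDiffOn_mul {f g : X → L1 H} {s : Set X}
    (hf : ContMDiffOn (𝓡 n) 𝓘(ℝ, L1 H) ∞ f s) (hg : ContMDiffOn (𝓡 n) 𝓘(ℝ, L1 H) ∞ g s) :
    ContMDiffOn (𝓡 n) 𝓘(ℝ, L1 H) ∞ (f * g) s := by
  have hB : ContDiff ℝ ∞ fun z : L1 H × L1 H => z.1 * z.2 :=
    (ContinuousLinearMap.mul ℝ (L1 H)).isBoundedBilinearMap.contDiff
  exact hB.contMDiff.comp_contMDiffOn (hf.prodMk_space hg)

/-- The smooth sections of `𝓛¹(P)`, as a subalgebra of the algebra of all sections: those which are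
represented by smooth `𝓛¹(H)`-valued functions in the local trivializations of `P`. -/
def smoothSections : NonUnitalSubalgebra ℂ (∀ x, P.Fiber x) where
  carrier := {s | ∀ e ∈ P.atlas, ContMDiffOn (𝓡 n) 𝓘(ℝ, L1 H) ∞ (P.localRep e s) e.baseSet}
  add_mem' {s t} hs ht e he := by
    rw [localRep_add]
    exact (hs e he).add (ht e he)
  mul_mem' {s t} hs ht e he := by
    rw [localRep_mul]
    exact contMDiffOn_mul (hs e he) (ht e he)
  zero_mem' e he := by
    have : P.localRep e 0 = fun _ => 0 := by
      simpa [funext_iff] using P.localRep_smul e 0 0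
    rw [this]
    exact contMDiffOn_const
  smul_mem' c s hs e he := by
    rw [localRep_smul]
    have hB : ContDiff ℝ ∞ fun T : L1 H => c • T :=
      ((c • ContinuousLinearMap.id ℂ (L1 H)).restrictScalars ℝ).contDiff
    exact hB.contMDiff.comp_contMDiffOn (hs e he)

/-- The algebra `C^∞(𝓛¹(P))` of smooth sections of `𝓛¹(P)`. -/
def Sections : Type (max u v w) := ↥P.smoothSections

instance : NonUnitalRing P.Sections := inferInstanceAs (NonUnitalRing P.smoothSections)
instance : Module ℂ P.Sections := inferInstanceAs (Module ℂ P.smoothSections)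
instance : IsScalarTower ℂ P.Sections P.Sections :=
  inferInstanceAs (IsScalarTower ℂ P.smoothSections P.smoothSections)
instance : SMulCommClass ℂ P.Sections P.Sections :=
  inferInstanceAs (SMulCommClass ℂ P.smoothSections P.smoothSections)

/-- The section of `𝓛¹(P)` which underlies an element of `C^∞(𝓛¹(P))`. -/
def Sections.val {P : PrincipalPUBundle.{u, v, w} n X H} (s : P.Sections) : ∀ x, P.Fiber x :=
  Subtype.val s

@[simp] theorem Sections.val_add (s t : P.Sections) : (s + t).val = s.val + t.val := rfl
@[simp] theorem Sections.val_mul (s t : P.Sections) : (s * t).val = s.val * t.val := rfl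
@[simp] theorem Sections.val_smul (c : ℂ) (s : P.Sections) : (c • s).val = c • s.val := rfl

theorem Sections.contMDiffOn (s : P.Sections) {e : Bundle.Trivialization (PU H) P.proj}
    (he : e ∈ P.atlas) : ContMDiffOn (𝓡 n) 𝓘(ℝ, L1 H) ∞ (P.localRep e s.val) e.baseSet :=
  Subtype.property s e he

section Topology

variable [IsManifold (𝓡 n) ∞ X] (P : PrincipalPUBundle.{u, v, w} n X H)

/-- The data on which the seminorms of `C^∞(𝓛¹(P))` depend: a chart `φ` of the smooth manifold `X`,
a local trivialization `e` of `P` over `U`, a compact subset `K` of the domain of `φ` on which `e` is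
defined, and an order `m`. -/
structure SeminormIndex where
  φ : OpenPartialHomeomorph X (EuclideanSpace ℝ (Fin n))
  hφ : φ ∈ IsManifold.maximalAtlas (𝓡 n) ∞ X
  e : Bundle.Trivialization (PU H) P.proj
  he : e ∈ P.atlas
  K : Set X
  hK : IsCompact K
  hK_subset : K ⊆ φ.source ∩ e.baseSet
  m : ℕ

variable {P}

namespace SeminormIndex

variable (i : P.SeminormIndex)

/-- The part of the chart over which the trivialization is defined. -/
def dom : Set (EuclideanSpace ℝ (Fin n)) := i.φ.target ∩ i.φ.symm ⁻¹' i.e.baseSet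

theorem isOpen_dom : IsOpen i.dom := i.φ.isOpen_inter_preimage_symm i.e.open_baseSet

/-- A section in the chart and the trivialization. -/
def rep (s : P.Sections) : EuclideanSpace ℝ (Fin n) → L1 H :=
  P.localRep i.e s.val ∘ i.φ.symm

theorem contDiffOn_rep (s : P.Sections) : ContDiffOn ℝ ∞ (i.rep s) i.dom := by
  rw [← contMDiffOn_iff_contDiffOn]
  have h1 := contMDiffOn_symm_of_mem_maximalAtlas (I := 𝓡 n) i.hφ
  exact (Sections.contMDiffOn P s i.he).comp (h1.mono inter_subset_left) inter_subset_right

theorem contDiffAt_rep (s : P.Sections) {y : EuclideanSpace ℝ (Fin n)} (hy : y ∈ i.dom) :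
    ContDiffAt ℝ ∞ (i.rep s) y := (i.contDiffOn_rep s).contDiffAt (i.isOpen_dom.mem_nhds hy)

theorem image_subset_dom : i.φ '' i.K ⊆ i.dom := by
  rintro _ ⟨x, hx, rfl⟩
  obtain ⟨h1, h2⟩ := i.hK_subset hx
  refine ⟨i.φ.map_source h1, ?_⟩
  rw [mem_preimage, i.φ.left_inv h1]
  exact h2

theorem isCompact_image : IsCompact (i.φ '' i.K) :=
  i.hK.image_of_continuousOn (i.φ.continuousOn.mono fun _ hx => (i.hK_subset hx).1)

theorem continuousOn_iteratedFDeriv (s : P.Sections) (j : ℕ) :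
    ContinuousOn (iteratedFDeriv ℝ j (i.rep s)) i.dom :=
  ((i.contDiffOn_rep s).continuousOn_iteratedFDerivWithin (m := j)
    (by exact_mod_cast le_top) i.isOpen_dom.uniqueDiffOn).congr
    fun _ hy => (iteratedFDerivWithin_of_isOpen j i.isOpen_dom hy).symm

theorem bddAbove (s : P.Sections) (j : ℕ) :
    BddAbove (range fun y : i.φ '' i.K => ‖iteratedFDeriv ℝ j (i.rep s) y‖) := by
  have := i.isCompact_image.bddAbove_image
    ((i.continuousOn_iteratedFDeriv s j).mono i.image_subset_dom).norm
  rwa [image_eq_range] at this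

/-- `sup_{K} ‖∂ʲ s‖`, where the norm of the `j`-th derivative, which is a multilinear map with values
in `𝓛¹(H)`, is the operator norm with respect to the trace norm. -/
def supDeriv (j : ℕ) (s : P.Sections) : ℝ :=
  ⨆ y : i.φ '' i.K, ‖iteratedFDeriv ℝ j (i.rep s) y‖

theorem supDeriv_nonneg (j : ℕ) (s : P.Sections) : 0 ≤ i.supDeriv j s :=
  Real.iSup_nonneg fun _ => norm_nonneg _

theorem le_supDeriv (j : ℕ) (s : P.Sections) {y : EuclideanSpace ℝ (Fin n)} (hy : y ∈ i.φ '' i.K) :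
    ‖iteratedFDeriv ℝ j (i.rep s) y‖ ≤ i.supDeriv j s :=
  le_ciSup (i.bddAbove s j) (⟨y, hy⟩ : i.φ '' i.K)

theorem rep_add (s t : P.Sections) : i.rep (s + t) = i.rep s + i.rep t := by
  simp only [rep, Sections.val_add, localRep_add]
  rfl

theorem rep_mul (s t : P.Sections) : i.rep (s * t) = i.rep s * i.rep t := by
  simp only [rep, Sections.val_mul, localRep_mul]
  rfl

theorem rep_smul (c : ℂ) (s : P.Sections) : i.rep (c • s) = c • i.rep s := by
  simp only [rep, Sections.val_smul, localRep_smul]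
  rfl

theorem supDeriv_add_le (j : ℕ) (s t : P.Sections) :
    i.supDeriv j (s + t) ≤ i.supDeriv j s + i.supDeriv j t := by
  refine Real.iSup_le (fun y => ?_) (add_nonneg (i.supDeriv_nonneg j s) (i.supDeriv_nonneg j t))
  have hy := i.image_subset_dom y.2
  rw [rep_add, iteratedFDeriv_add_apply ((i.contDiffAt_rep s hy).of_le (by exact_mod_cast le_top))
    ((i.contDiffAt_rep t hy).of_le (by exact_mod_cast le_top))]
  exact (norm_add_le _ _).trans (add_le_add (i.le_supDeriv j s y.2) (i.le_supDeriv j t y.2))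

theorem supDeriv_smul_le (j : ℕ) (c : ℂ) (s : P.Sections) :
    i.supDeriv j (c • s) ≤ ‖c‖ * i.supDeriv j s := by
  refine Real.iSup_le (fun y => ?_) (mul_nonneg (norm_nonneg _) (i.supDeriv_nonneg j s))
  have hy := i.image_subset_dom y.2
  rw [rep_smul, iteratedFDeriv_const_smul_apply
    ((i.contDiffAt_rep s hy).of_le (by exact_mod_cast le_top)), norm_smul]
  exact mul_le_mul_of_nonneg_left (i.le_supDeriv j s y.2) (norm_nonneg _)

end SeminormIndex

variable (P) in
/-- The seminorms `p(s) = ∑_{j ≤ m} (1 / j!) sup_K ‖∂ʲ s‖` of `C^∞(𝓛¹(P))`, where the derivatives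
are taken in a chart of `X` and a local trivialization of `P`. -/
def sectionSeminorm : SeminormFamily ℂ P.Sections P.SeminormIndex := fun i =>
  .ofSMulLE (fun s => ∑ j ∈ Finset.range (i.m + 1), 1 / (j.factorial : ℝ) * i.supDeriv j s)
    (by
      refine Finset.sum_eq_zero fun j _ => ?_
      have h := i.supDeriv_smul_le j 0 0
      rw [norm_zero, zero_mul, zero_smul] at h
      rw [le_antisymm h (i.supDeriv_nonneg j 0), mul_zero])
    (fun s t => by
      rw [← Finset.sum_add_distrib]
      refine Finset.sum_le_sum fun j _ => ?_
      rw [← mul_add]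
      exact mul_le_mul_of_nonneg_left (i.supDeriv_add_le j s t) (by positivity))
    (fun c s => by
      rw [Finset.mul_sum]
      refine Finset.sum_le_sum fun j _ => ?_
      rw [mul_left_comm]
      exact mul_le_mul_of_nonneg_left (i.supDeriv_smul_le j c s) (by positivity))

theorem sectionSeminorm_apply (i : P.SeminormIndex) (s : P.Sections) :
    sectionSeminorm P i s =
      ∑ j ∈ Finset.range (i.m + 1), 1 / (j.factorial : ℝ) * i.supDeriv j s := rfl

theorem supDeriv_mul_le (i : P.SeminormIndex) (j : ℕ) (s t : P.Sections) :
    i.supDeriv j (s * t) ≤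
      ∑ l ∈ Finset.range (j + 1), (j.choose l : ℝ) * i.supDeriv l s * i.supDeriv (j - l) t := by
  refine Real.iSup_le (fun y => ?_) (Finset.sum_nonneg fun l _ => mul_nonneg
    (mul_nonneg (by positivity) (i.supDeriv_nonneg _ _)) (i.supDeriv_nonneg _ _))
  have hy := i.image_subset_dom y.2
  have h := (ContinuousLinearMap.mul ℝ (L1 H)).norm_iteratedFDerivWithin_le_of_bilinear_of_le_one
    (i.contDiffOn_rep s) (i.contDiffOn_rep t) i.isOpen_dom.uniqueDiffOn hy (n := j)
    (by exact_mod_cast le_top) (ContinuousLinearMap.opNorm_mul_le ℝ (L1 H))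
  simp only [iteratedFDerivWithin_of_isOpen _ i.isOpen_dom hy] at h
  rw [SeminormIndex.rep_mul]
  refine h.trans (Finset.sum_le_sum fun l _ => ?_)
  gcongr
  · exact mul_nonneg (by positivity) (i.supDeriv_nonneg _ _)
  · exact i.le_supDeriv l s y.2
  · exact i.le_supDeriv (j - l) t y.2

/-- The seminorms of `C^∞(𝓛¹(P))` are submultiplicative. -/
theorem sectionSeminorm_mul_le (i : P.SeminormIndex) (s t : P.Sections) :
    sectionSeminorm P i (s * t) ≤ sectionSeminorm P i s * sectionSeminorm P i t := by
  rw [sectionSeminorm_apply, sectionSeminorm_apply, sectionSeminorm_apply]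
  set a : ℕ → ℝ := fun j => 1 / (j.factorial : ℝ) * i.supDeriv j s with ha
  set b : ℕ → ℝ := fun j => 1 / (j.factorial : ℝ) * i.supDeriv j t with hb
  have ha0 : ∀ j, 0 ≤ a j := fun j => mul_nonneg (by positivity) (i.supDeriv_nonneg _ _)
  have hb0 : ∀ j, 0 ≤ b j := fun j => mul_nonneg (by positivity) (i.supDeriv_nonneg _ _)
  have h1 : ∀ j, 1 / (j.factorial : ℝ) * i.supDeriv j (s * t) ≤
      ∑ l ∈ Finset.range (j + 1), a l * b (j - l) := by
    intro j
    refine (mul_le_mul_of_nonneg_left (supDeriv_mul_le i j s t) (by positivity)).trans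
      (le_of_eq ?_)
    rw [Finset.mul_sum]
    refine Finset.sum_congr rfl fun l hl => ?_
    have hl' : l ≤ j := Nat.lt_succ_iff.1 (Finset.mem_range.1 hl)
    simp only [ha, hb]
    rw [Nat.cast_choose ℝ hl']
    have := Nat.factorial_ne_zero j
    field_simp
  refine (Finset.sum_le_sum fun j _ => h1 j).trans ?_
  rw [Finset.sum_range_diag_flip (i.m + 1) fun l k => a l * b k, Finset.sum_mul_sum]
  refine Finset.sum_le_sum fun l _ => Finset.sum_le_sum_of_subset_of_nonneg
    (Finset.range_mono (Nat.sub_le _ _)) fun k _ _ => mul_nonneg (ha0 l) (hb0 k)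

/-- The Fréchet topology of `C^∞(𝓛¹(P))`, which is generated by the seminorms. -/
instance : TopologicalSpace P.Sections :=
  ⨅ i, (sectionSeminorm P i).toSeminormedAddCommGroup.toUniformSpace.toTopologicalSpace

instance : IsTopologicalAddGroup P.Sections :=
  topologicalAddGroup_iInf fun i =>
    @IsUniformAddGroup.to_topologicalAddGroup _
      (sectionSeminorm P i).toSeminormedAddCommGroup.toUniformSpace _
      (@SeminormedAddCommGroup.to_isUniformAddGroup _
        (sectionSeminorm P i).toSeminormedAddCommGroup)

theorem withSeminorms : WithSeminorms (sectionSeminorm P) :=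
  (SeminormFamily.withSeminorms_iff_topologicalSpace_eq_iInf _).2 rfl

instance : PolynormableSpace ℂ P.Sections := withSeminorms.toPolynormableSpace

instance : ContinuousSMul ℂ P.Sections := withSeminorms.continuousSMul

instance : ContinuousMul P.Sections where
  continuous_mul := by
    refine continuous_iff_continuousAt.2 fun z => ?_
    obtain ⟨a, b⟩ := z
    refine (withSeminorms.tendsto_nhds _ _).2 fun i ε hε => ?_
    have hp : Continuous (sectionSeminorm P i) := withSeminorms.continuous_seminorm i
    have hc : Continuous fun z : P.Sections × P.Sections =>
        sectionSeminorm P i (z.1 - a) * sectionSeminorm P i z.2 +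
          sectionSeminorm P i a * sectionSeminorm P i (z.2 - b) := by fun_prop
    have h0 := hc.continuousAt (x := (a, b))
    have := h0.eventually_lt (continuousAt_const (y := ε)) (by simpa using hε)
    filter_upwards [this] with z hz
    refine lt_of_le_of_lt ?_ hz
    have : z.1 * z.2 - a * b = (z.1 - a) * z.2 + a * (z.2 - b) := by
      rw [sub_mul, mul_sub]
      abel
    rw [this]
    exact (map_add_le_add _ _ _).trans
      (add_le_add (sectionSeminorm_mul_le i _ _) (sectionSeminorm_mul_le i _ _))

end Topology

end PrincipalPUBundle

end Bundle

end TwistedHKR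

end

set_option linter.unusedSectionVars false

noncomputable section

namespace TwistedHKR

/-! ### Contractions of the bar complex -/

section BarHomotopy

/-! ### Multilinear maps on tensor powers and their projective seminorms -/

section Algebraic

variable {A : Type u} [AddCommGroup A] [Module ℂ A]

/-! Contractibility comes from a single map: a continuous linear `σ : A → A ⊗̂ A` that commutes with
right multiplication and is a section of the product. Then `h(a₀ ⊗ ⋯ ⊗ aₙ) = σ(a₀) ⊗ a₁ ⊗ ⋯ ⊗ aₙ` is
a contracting homotopy: the zeroth face of `h` gives the identity, and the other faces give `-h b'`
because `σ(a₀ a₁) = σ(a₀) a₁`. Here `σ` is a limit of finite sums `a ↦ ∑ₖ xₖ ⊗ yₖ(a)` with right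
linear `yₖ`. `topologicallyHUnital_of_splitting` says which control suffices: a bound by a
continuous seminorm uniform along the limit, a pointwise Cauchy property, and `∑ₖ xₖ yₖ(a) → a`.

For `𝓛¹(H)` itself, take a unit vector `e`, an orthonormal basis `vⱼ`, and `σ(T) = ∑ⱼ vⱼ⟨e, ·⟩ ⊗
e⟨vⱼ, T ·⟩`. Estimating term by term is useless, since `∑ⱼ ‖T* vⱼ‖` can diverge for a trace class
operator. Instead the partial sums are tested against a bounded bilinear form `β`, which suffices by
Hahn-Banach. The result is `∑ⱼ B(T* vⱼ, vⱼ)` with `B(u, v) = β(v⟨e, ·⟩, e⟨u, ·⟩)`, a partial trace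
of `T R` for a bounded operator `R`, and hence at most `‖B‖ Tr |T|` whatever the finite set of
indices (`norm_sum_bilin_le`). Convergence follows from this uniform bound: the difference of two
partial sums is a partial sum for `T - P T`, with `P` a finite rank projection onto basis vectors,
and `P T → T` in the trace norm (`tendsto_cutoff`).

For sections, take finitely many patches (a chart together with a trivialization), a subordinate
partition of unity `χᵢ`, and cutoffs `ηᵢ` equal to `1` on the support of `χᵢ`. The splitting is `∑ᵢ
∑ⱼ ηᵢ vⱼ⟨e, ·⟩ ⊗ χᵢ e⟨vⱼ, a ·⟩`, each term being written in the trivialization of its patch; as `ηᵢ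
χᵢ = χᵢ`, its product is `∑ᵢ χᵢ a = a`. Continuity for the projective topology is reduced to the
case of one operator by Fourier series: on a unit cube, `χᵢ a` is `∑ₖ exp(2πi⟨k, y⟩) cₖ` with
rapidly decreasing coefficients in `𝓛¹(H)` (`fourierSum_fourierCoeffs`), and for a single frequency
the trace argument gives a bound of polynomial growth in `k` (`LocalPatch.exists_splitting_le`). The
properties of a patch that this uses are collected in `LocalPatch`, and
`topologicallyHUnital_of_localPatch` puts the patches together. -/

theorem ProjTensor.hom_ext {k : ℕ} {F : Type*} [AddCommGroup F] [Module ℂ F]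
    {f g : ProjTensor k A →ₗ[ℂ] F} (h : ∀ a, f (ProjTensor.tprod a) = g (ProjTensor.tprod a)) :
    f = g :=
  PiTensorProduct.ext (MultilinearMap.ext h)

theorem ProjTensor.induction {k : ℕ} {C : ProjTensor k A → Prop} (t : ProjTensor k A)
    (smul_tprod : ∀ (c : ℂ) a, C (c • ProjTensor.tprod a)) (add : ∀ s t, C s → C t → C (s + t)) :
    C t :=
  PiTensorProduct.induction_on (motive := C) t smul_tprod fun s t hs ht => add s t hs ht

/-- The multilinear map `(a₀, …, aₙ) ↦ x ⊗ y a₀ ⊗ a₁ ⊗ ⋯ ⊗ aₙ`. -/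
def insertMultilinear (n : ℕ) (x : A) (y : A →ₗ[ℂ] A) :
    MultilinearMap ℂ (fun _ : Fin (n + 1) => A) (ProjTensor (n + 2) A) :=
  MultilinearMap.compLinearMap ((ProjTensor.tprod (k := n + 2) (E := A)).curryLeft x)
    (Fin.cons (α := fun _ => A →ₗ[ℂ] A) y fun _ => LinearMap.id)

theorem insertMultilinear_apply (n : ℕ) (x : A) (y : A →ₗ[ℂ] A) (a : Fin (n + 1) → A) :
    insertMultilinear n x y a =
      ProjTensor.tprod (Fin.cons x (Fin.cons (y (a 0)) (Fin.tail a) : Fin (n + 1) → A)) := by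
  simp only [insertMultilinear, MultilinearMap.compLinearMap_apply, MultilinearMap.curryLeft_apply]
  congr 2
  funext i
  refine Fin.cases ?_ (fun i => ?_) i
  · simp
  · simp [Fin.tail]

/-- The multilinear map `(a₀, …, aₙ) ↦ f a₀ ⊗ a₁ ⊗ ⋯ ⊗ aₙ`. -/
def headMultilinear (n : ℕ) (f : A →ₗ[ℂ] A) :
    MultilinearMap ℂ (fun _ : Fin (n + 1) => A) (ProjTensor (n + 1) A) :=
  MultilinearMap.compLinearMap (ProjTensor.tprod (k := n + 1) (E := A))
    (Fin.cons (α := fun _ => A →ₗ[ℂ] A) f fun _ => LinearMap.id)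

theorem headMultilinear_apply (n : ℕ) (f : A →ₗ[ℂ] A) (a : Fin (n + 1) → A) :
    headMultilinear n f a =
      ProjTensor.tprod (Fin.cons (f (a 0)) (Fin.tail a) : Fin (n + 1) → A) := by
  simp only [headMultilinear, MultilinearMap.compLinearMap_apply]
  congr 1
  funext i
  refine Fin.cases ?_ (fun i => ?_) i
  · simp
  · simp [Fin.tail]

theorem cons_cons_update {n : ℕ} (z : Fin 2 → A) (b : Fin n → A) (i : Fin 2) (x : A) :
    (Fin.cons (Function.update z i x 0) (Fin.cons (Function.update z i x 1) b : Fin (n + 1) → A) :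
      Fin (n + 2) → A) = Function.update (Fin.cons (z 0) (Fin.cons (z 1) b : Fin (n + 1) → A))
        (i.castLE (by omega)) x := by
  fin_cases i
  · exact (Fin.update_cons_zero _ _ _).symm
  · change Fin.cons (z 0) (Fin.cons x b : Fin (n + 1) → A) =
      Function.update (Fin.cons (z 0) (Fin.cons (z 1) b : Fin (n + 1) → A) : Fin (n + 2) → A) (Fin.succ 0) x
    rw [← Fin.cons_update (α := fun _ => A) (z 0) (Fin.cons (z 1) b : Fin (n + 1) → A) 0 x,
      Fin.update_cons_zero]

/-- The multilinear map `(x, y) ↦ x ⊗ y ⊗ b₁ ⊗ ⋯ ⊗ bₙ`. -/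
def appendMultilinear {n : ℕ} (b : Fin n → A) :
    MultilinearMap ℂ (fun _ : Fin 2 => A) (ProjTensor (n + 2) A) where
  toFun z := ProjTensor.tprod (Fin.cons (z 0) (Fin.cons (z 1) b : Fin (n + 1) → A))
  map_update_add' {dec} z i x y := by
    rw [Subsingleton.elim dec (instDecidableEqFin _)]
    simp only [cons_cons_update, MultilinearMap.map_update_add]
  map_update_smul' {dec} z i c x := by
    rw [Subsingleton.elim dec (instDecidableEqFin _)]
    simp only [cons_cons_update, MultilinearMap.map_update_smul]

/-- Every representation of `x` by elementary tensors bounds the left side by `C` times its cost,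
and the infimum is taken at the end. The constant is kept apart because it will be the contribution
of frozen tensor factors. -/
theorem lift_le_mul_projSeminorm {k : ℕ} {F : Type*} [AddCommGroup F] [Module ℂ F]
    (q : Seminorm ℂ F) (p : Fin k → Seminorm ℂ A) (f : MultilinearMap ℂ (fun _ : Fin k => A) F)
    {C : ℝ} (hC : 0 ≤ C) (h : ∀ a, q (f a) ≤ C * ∏ i, p i (a i)) (x : ⨂[ℂ] (_ : Fin k), A) :
    q (PiTensorProduct.lift f x) ≤ C * projSeminorm p x := by
  rw [projSeminorm_apply, Real.mul_iInf_of_nonneg hC]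
  refine le_ciInf fun c => ?_
  obtain ⟨c, hc⟩ := c
  rw [PiTensorProduct.mem_lifts_iff] at hc
  subst hc
  simp only [projAux]
  induction c.toList with
  | nil => simp
  | cons y l ih =>
    simp only [List.map_cons, List.sum_cons, map_add, map_smul, PiTensorProduct.lift.tprod]
    refine (map_add_le_add q _ _).trans ?_
    rw [mul_add]
    refine add_le_add ?_ ih
    rw [map_smul_eq_mul, mul_left_comm]
    exact mul_le_mul_of_nonneg_left (h _) (norm_nonneg _)

/-- Reduces estimates in a tensor power of any degree to degree two: the frozen factors `b`
contribute only a constant. -/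
theorem projSeminorm_append_le {n : ℕ} (p : Fin (n + 2) → Seminorm ℂ A) (b : Fin n → A)
    (t : ProjTensor 2 A) :
    projSeminorm p (ProjTensor.lift (appendMultilinear b) t) ≤
      (∏ i : Fin n, p i.succ.succ (b i)) * projSeminorm ![p 0, p 1] t := by
  refine lift_le_mul_projSeminorm (F := ProjTensor (n + 2) A) (projSeminorm p) _ _
    (Finset.prod_nonneg fun i _ => apply_nonneg _ _) (fun z => ?_) t
  refine (projSeminorm_tprod_le _ _).trans (le_of_eq ?_)
  rw [Fin.prod_univ_succ, Fin.prod_univ_succ, Fin.prod_univ_two]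
  simp only [Fin.cons_zero, Fin.cons_succ]
  change p 0 (z 0) * (p (Fin.succ 0) (z 1) * _) = _ * (p 0 (z 0) * p (Fin.succ 0) (z 1))
  ring

end Algebraic

/-! ### The algebraic homotopy identity -/

section Faces

variable {A : Type u} [NonUnitalRing A] [Module ℂ A] [IsScalarTower ℂ A A] [SMulCommClass ℂ A A]

theorem lift_barFace_tprod (n : ℕ) (j : Fin (n + 1)) (a : Fin (n + 2) → A) :
    ProjTensor.lift (barFaceMultilinear A n j) (ProjTensor.tprod a) =
      ProjTensor.tprod (Fin.contractNth j.castSucc (· * ·) a) :=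
  ProjTensor.lift_tprod _ _

theorem contractNth_zero_cons_cons {n : ℕ} (x y : A) (b : Fin n → A) :
    Fin.contractNth (0 : Fin (n + 1)).castSucc (· * ·)
      (Fin.cons x (Fin.cons y b : Fin (n + 1) → A) : Fin (n + 2) → A) = Fin.cons (x * y) b := by
  funext i
  refine Fin.cases ?_ (fun i => ?_) i
  · simp [Fin.contractNth]
  · simp [Fin.contractNth]

/-- The shift of the face index from `j` to `j + 1` is what produces the opposite sign in the
homotopy identity. -/
theorem contractNth_succ_cons {n : ℕ} (j : Fin (n + 1)) (x : A) (b : Fin (n + 2) → A) :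
    Fin.contractNth j.succ.castSucc (· * ·) (Fin.cons x b : Fin (n + 3) → A) =
      Fin.cons x (Fin.contractNth j.castSucc (· * ·) b) := by
  funext i
  refine Fin.cases ?_ (fun i => ?_) i
  · simp [Fin.contractNth]
  · simp [Fin.contractNth]

/-- Right linearity matters only for the face `j = 0`, where `y(a₀) a₁` has to be `y(a₀ a₁)`; the
other faces do not touch the first entry. -/
theorem contractNth_cons_map {n : ℕ} (j : Fin (n + 1)) (y : A →ₗ[ℂ] A)
    (hy : ∀ a b, y (a * b) = y a * b) (a : Fin (n + 2) → A) :
    Fin.contractNth j.castSucc (· * ·) (Fin.cons (y (a 0)) (Fin.tail a) : Fin (n + 2) → A) =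
      Fin.cons (y (Fin.contractNth j.castSucc (· * ·) a 0))
        (Fin.tail (Fin.contractNth j.castSucc (· * ·) a)) := by
  funext i
  refine Fin.cases ?_ (fun i => ?_) i
  · by_cases h : j = 0
    · subst h
      simp [Fin.contractNth, hy, Fin.tail]
    · have h' : (0 : ℕ) < j := Nat.pos_of_ne_zero fun h' => h (Fin.ext h')
      simp [Fin.contractNth, h']
  · simp only [Fin.contractNth, Fin.cons_succ, Fin.tail, ← Fin.succ_castSucc]

theorem algBarD_zero_insert (x : A) (y : A →ₗ[ℂ] A) (t : ProjTensor 1 A) :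
    algBarD A 0 (ProjTensor.lift (insertMultilinear 0 x y) t) =
      ProjTensor.lift (headMultilinear 0 (LinearMap.mulLeft ℂ x ∘ₗ y)) t := by
  refine LinearMap.congr_fun (f := algBarD A 0 ∘ₗ ProjTensor.lift (insertMultilinear 0 x y))
    (ProjTensor.hom_ext fun a => ?_) t
  rw [LinearMap.comp_apply, ProjTensor.lift_tprod, ProjTensor.lift_tprod, insertMultilinear_apply,
    headMultilinear_apply, algBarD]
  rw [Fin.sum_univ_succ, Finset.univ_eq_empty, Finset.sum_empty, add_zero, LinearMap.smul_apply,
    lift_barFace_tprod, contractNth_zero_cons_cons]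
  simp

/-- The zeroth face multiplies `x` into `y a₀` and gives the right side. Face `j + 1` after
insertion is insertion after face `j`, with the opposite sign, so all else cancels. Summed over a
family with `∑ₖ xₖ yₖ = id`, the right side would be the identity. -/
theorem algBarD_succ_insert (n : ℕ) (x : A) (y : A →ₗ[ℂ] A) (hy : ∀ a b, y (a * b) = y a * b)
    (t : ProjTensor (n + 2) A) :
    algBarD A (n + 1) (ProjTensor.lift (insertMultilinear (n + 1) x y) t) +
        ProjTensor.lift (insertMultilinear n x y) (algBarD A n t) =
      ProjTensor.lift (headMultilinear (n + 1) (LinearMap.mulLeft ℂ x ∘ₗ y)) t := by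
  refine LinearMap.congr_fun
    (f := algBarD A (n + 1) ∘ₗ ProjTensor.lift (insertMultilinear (n + 1) x y) +
      ProjTensor.lift (insertMultilinear n x y) ∘ₗ algBarD A n)
    (ProjTensor.hom_ext fun a => ?_) t
  rw [LinearMap.add_apply, LinearMap.comp_apply, LinearMap.comp_apply, ProjTensor.lift_tprod,
    ProjTensor.lift_tprod, insertMultilinear_apply, headMultilinear_apply, algBarD, algBarD,
    Fin.sum_univ_succ]
  simp only [LinearMap.add_apply, LinearMap.sum_apply, LinearMap.smul_apply, lift_barFace_tprod,
    map_sum, map_smul, contractNth_zero_cons_cons, contractNth_succ_cons,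
    contractNth_cons_map _ y hy]
  simp only [ProjTensor.lift_tprod, insertMultilinear_apply]
  simp [pow_succ]

end Faces

/-! ### Passage to the limit in the completed tensor powers -/

section Limit

variable {A : Type u} [NonUnitalRing A] [Module ℂ A] [IsScalarTower ℂ A A] [SMulCommClass ℂ A A]
  {κ : Type*}

/-- The tensor `∑ₖ xₖ ⊗ yₖ a`. -/
def splitting (x : κ → A) (y : κ → A →ₗ[ℂ] A) (s : Finset κ) (a : A) : ProjTensor 2 A :=
  ∑ k ∈ s, ProjTensor.tprod ![x k, y k a]

/-- The map `a₀ ⊗ ⋯ ⊗ aₙ ↦ ∑ₖ xₖ ⊗ yₖ a₀ ⊗ a₁ ⊗ ⋯ ⊗ aₙ`. -/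
def splittingHom (n : ℕ) (x : κ → A) (y : κ → A →ₗ[ℂ] A) (s : Finset κ) :
    ProjTensor (n + 1) A →ₗ[ℂ] ProjTensor (n + 2) A :=
  ∑ k ∈ s, ProjTensor.lift (insertMultilinear n (x k) (y k))

theorem splittingHom_tprod (n : ℕ) (x : κ → A) (y : κ → A →ₗ[ℂ] A) (s : Finset κ)
    (a : Fin (n + 1) → A) :
    splittingHom n x y s (ProjTensor.tprod a) =
      ProjTensor.lift (appendMultilinear (Fin.tail a)) (splitting x y s (a 0)) := by
  rw [splittingHom, splitting, LinearMap.sum_apply, map_sum]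
  refine Finset.sum_congr rfl fun k _ => ?_
  rw [ProjTensor.lift_tprod, ProjTensor.lift_tprod, insertMultilinear_apply]
  rfl

/-- The bound `hr` concerns the sum over `s` as a whole, so the sum is first moved inside one
multilinear map instead of being estimated term by term. -/
theorem projSeminorm_splittingHom_le (n : ℕ) (x : κ → A) (y : κ → A →ₗ[ℂ] A) (s : Finset κ)
    (p : Fin (n + 2) → Seminorm ℂ A) (r : Seminorm ℂ A)
    (hr : ∀ a, projSeminorm ![p 0, p 1] (splitting x y s a) ≤ r a) (t : ProjTensor (n + 1) A) :
    projSeminorm p (splittingHom n x y s t) ≤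
      projSeminorm (Fin.cons r fun i => p i.succ.succ : Fin (n + 1) → Seminorm ℂ A) t := by
  have h : splittingHom n x y s = ProjTensor.lift (∑ k ∈ s, insertMultilinear n (x k) (y k)) := by
    refine ProjTensor.hom_ext fun a => ?_
    rw [splittingHom, LinearMap.sum_apply, ProjTensor.lift_tprod, sum_apply]
    exact Finset.sum_congr rfl fun k _ => ProjTensor.lift_tprod _ _
  rw [h]
  refine lift_le_projSeminorm (F := ProjTensor (n + 2) A) (projSeminorm p) _ _ (fun a => ?_) t
  rw [← ProjTensor.lift_tprod, ← h, splittingHom_tprod, Fin.prod_univ_succ]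
  refine (projSeminorm_append_le _ _ _).trans ?_
  rw [mul_comm]
  simp only [Fin.cons_zero, Fin.cons_succ]
  exact mul_le_mul_of_nonneg_right (hr _) (Finset.prod_nonneg fun i _ => apply_nonneg _ _)

variable [TopologicalSpace A] [PolynormableSpace ℂ A] [ContinuousMul A]

/-- At each finite stage the homotopy identity holds with `∑ₖ xₖ yₖ` in place of the identity in the
first factor. `hcauchy` makes the homotopies converge pointwise, `hbound` makes them equicontinuous
and so their limit continuous, and `hlim` turns the defective identity into the true one on a dense
subspace. -/
theorem topologicallyHUnital_of_splitting {D : Type*} [Nonempty D] [SemilatticeSup D]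
    (s : D → Finset κ) (x : κ → A) (y : κ → A →ₗ[ℂ] A) (hy : ∀ k a b, y k (a * b) = y k a * b)
    (hbound : ∀ p q : Seminorm ℂ A, Continuous p → Continuous q →
      ∃ r : Seminorm ℂ A, Continuous r ∧ ∀ d a, projSeminorm ![p, q] (splitting x y (s d) a) ≤ r a)
    (hcauchy : ∀ p q : Seminorm ℂ A, Continuous p → Continuous q → ∀ a, ∀ ε > 0, ∃ d₀, ∀ d ≥ d₀,
      projSeminorm ![p, q] (splitting x y (s d) a - splitting x y (s d₀) a) < ε)
    (hlim : ∀ a, Tendsto (fun d => ∑ k ∈ s d, x k * y k a) atTop (𝓝 a)) :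
    TopologicallyHUnital A := by
  set h : ∀ n, D → ProjTensor (n + 1) A →ₗ[ℂ] ProjTensor (n + 2) A :=
    fun n d => splittingHom n x y (s d) with hh
  -- Equicontinuity at `0`: one neighbourhood of `t` works for all `d`.
  have hequi : ∀ n, ∀ U ∈ 𝓝 (0 : ProjTensor (n + 2) A), ∀ᶠ t in 𝓝 0, ∀ d, h n d t ∈ U := by
    intro n U hU
    obtain ⟨I, ε, hε, hI⟩ := (ProjTensor.withSeminorms.mem_nhds_iff _ _).1 hU
    have : ∀ᶠ t in 𝓝 (0 : ProjTensor (n + 1) A), ∀ i ∈ I, ∀ d,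
        ProjTensor.seminormFamily (n + 2) A i (h n d t) < ε := by
      rw [Filter.eventually_all_finset]
      intro i _
      obtain ⟨r, hrc, hr⟩ := hbound (i 0).1 (i 1).1 (i 0).2 (i 1).2
      let r' : Fin (n + 1) → {p : Seminorm ℂ A // Continuous p} :=
        Fin.cons ⟨r, hrc⟩ fun k => i k.succ.succ
      have hc : Continuous (ProjTensor.seminormFamily (n + 1) A r') :=
        ProjTensor.withSeminorms.continuous_seminorm r'
      have h0 := hc.continuousAt.eventually_lt (continuousAt_const (y := ε))
        (by rwa [map_zero])
      filter_upwards [h0] with t ht d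
      have hr' : (fun k => (r' k).1) =
          (Fin.cons r fun k => (i k.succ.succ).1 : Fin (n + 1) → Seminorm ℂ A) :=
        funext fun k => by refine Fin.cases ?_ (fun k => ?_) k <;> rfl
      change projSeminorm (fun k => (r' k).1) t < ε at ht
      rw [hr'] at ht
      exact (projSeminorm_splittingHom_le n x y (s d) (fun k => (i k).1) r (hr d) t).trans_lt ht
    filter_upwards [this] with t ht d
    refine hI ?_
    rw [Seminorm.mem_ball_zero]
    exact Seminorm.finset_sup_apply_lt hε fun i hi => ht i hi d
  -- The limit exists only in the completion. By linearity it is enough to treat elementary tensors,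
  -- where the Cauchy property in degree two applies to the first entry.
  have hex : ∀ n t, ∃ z, Tendsto (fun d => CompletedTensor.incl (h n d t)) atTop (𝓝 z) := by
    intro n t
    refine ProjTensor.induction (C := fun t => ∃ z, Tendsto (fun d =>
      CompletedTensor.incl (h n d t)) atTop (𝓝 z)) t (fun c a => ?_) ?_
    · have hC : CauchySeq fun d => h n d (ProjTensor.tprod a) := by
        rw [cauchySeq_iff_tendsto, uniformity_eq_comap_nhds_zero, tendsto_comap_iff,
          ProjTensor.withSeminorms.tendsto_nhds _ _]
        intro i ε hε
        set C : ℝ := ∏ k : Fin n, (i k.succ.succ).1 (Fin.tail a k) with hCdef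
        have hC0 : 0 ≤ C := Finset.prod_nonneg fun k _ => apply_nonneg _ _
        -- `C` may vanish, hence `C + 1` in the denominator; the factor `2` pays for comparing two
        -- indices through `d₀`.
        obtain ⟨d₀, hd₀⟩ := hcauchy (i 0).1 (i 1).1 (i 0).2 (i 1).2 (a 0) (ε / (2 * (C + 1)))
          (by positivity)
        have key : ∀ d ≥ d₀, ProjTensor.seminormFamily (n + 2) A i
            (h n d (ProjTensor.tprod a) - h n d₀ (ProjTensor.tprod a)) < ε / 2 := by
          intro d hd
          simp only [hh, splittingHom_tprod, ← map_sub]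
          refine (projSeminorm_append_le _ _ _).trans_lt ?_
          refine (mul_le_mul_of_nonneg_left (hd₀ d hd).le hC0).trans_lt ?_
          rw [← mul_div_assoc, div_lt_div_iff₀ (by positivity) (by positivity)]
          nlinarith
        filter_upwards [eventually_ge_atTop (d₀, d₀)] with d hd
        simp only [Function.comp_apply, Prod.map, sub_zero]
        have e : h n d.2 (ProjTensor.tprod a) - h n d.1 (ProjTensor.tprod a) =
          (h n d.2 (ProjTensor.tprod a) - h n d₀ (ProjTensor.tprod a)) -
          (h n d.1 (ProjTensor.tprod a) - h n d₀ (ProjTensor.tprod a)) := by abel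
        rw [e]
        refine (map_sub_le_add _ _ _).trans_lt ?_
        linarith [key d.1 hd.1, key d.2 hd.2]
      have hC' : CauchySeq fun d => CompletedTensor.incl (h n d (ProjTensor.tprod a)) :=
        (UniformSpace.Completion.uniformContinuous_coe (ProjTensor (n + 2) A)).comp_cauchySeq hC
      obtain ⟨z, hz⟩ := cauchySeq_tendsto_of_complete hC'
      refine ⟨c • z, ?_⟩
      simp only [map_smul]
      exact hz.const_smul c
    · rintro t₁ t₂ ⟨z₁, h₁⟩ ⟨z₂, h₂⟩
      refine ⟨z₁ + z₂, ?_⟩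
      simp only [map_add]
      exact h₁.add h₂
  choose g hg using hex
  let gl : ∀ n, ProjTensor (n + 1) A →ₗ[ℂ] CompletedTensor (n + 2) A := fun n =>
    { toFun := g n
      map_add' := fun t₁ t₂ => tendsto_nhds_unique (hg n (t₁ + t₂)) (by
        simp only [map_add]
        exact (hg n t₁).add (hg n t₂))
      map_smul' := fun c t => tendsto_nhds_unique (hg n (c • t)) (by
        simp only [map_smul]
        exact (hg n t).const_smul c) }
  have hgc : ∀ n, Continuous (gl n) := by
    intro n
    refine continuous_of_continuousAt_zero (gl n) ?_
    -- Closed neighbourhoods suffice, and these retain pointwise limits, so equicontinuity passes to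
    -- the limit map.
    rw [ContinuousAt, map_zero, (closed_nhds_basis _).tendsto_right_iff]
    rintro V ⟨hV, hVc⟩
    have hU : (CompletedTensor.incl : ProjTensor (n + 2) A →L[ℂ] _) ⁻¹' V ∈ 𝓝 0 :=
      CompletedTensor.incl.continuous.continuousAt.preimage_mem_nhds (by simpa using hV)
    filter_upwards [hequi n _ hU] with t ht
    exact hVc.mem_of_tendsto (hg n t) (Eventually.of_forall ht)
  -- The defective identity maps converge to the identity, already on the algebraic tensor power: on
  -- an elementary tensor the error sits in the first entry.
  have hm : ∀ n (t : ProjTensor (n + 1) A), Tendsto (fun d => ∑ k ∈ s d, ProjTensor.lift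
      (headMultilinear n (LinearMap.mulLeft ℂ (x k) ∘ₗ y k)) t) atTop (𝓝 t) := by
    intro n t
    refine ProjTensor.induction (C := fun t => Tendsto (fun d => ∑ k ∈ s d, ProjTensor.lift
      (headMultilinear n (LinearMap.mulLeft ℂ (x k) ∘ₗ y k)) t) atTop (𝓝 t)) t
      (fun c a => ?_) ?_
    · simp only [map_smul, ← Finset.smul_sum]
      refine Tendsto.const_smul ?_ c
      rw [ProjTensor.withSeminorms.tendsto_nhds _ _]
      intro i ε hε
      set C : ℝ := ∏ k : Fin n, (i k.succ).1 (Fin.tail a k) with hCdef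
      have hC0 : 0 ≤ C := Finset.prod_nonneg fun k _ => apply_nonneg _ _
      have h0 : Tendsto (fun d => (i 0).1 (∑ k ∈ s d, x k * y k (a 0) - a 0) * C) atTop (𝓝 0) := by
        have h1 : Continuous fun b => (i 0).1 (b - a 0) * C :=
          have := (PolynormableSpace.withSeminorms ℂ A).topologicalAddGroup
          ((i 0).2.comp (continuous_id.sub continuous_const)).mul continuous_const
        have h2 := (h1.tendsto (a 0)).comp (hlim (a 0))
        rwa [sub_self, map_zero, zero_mul] at h2
      filter_upwards [h0.eventually_lt_const hε] with d hd
      refine lt_of_le_of_lt ?_ hd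
      have e : ∑ k ∈ s d, ProjTensor.lift (headMultilinear n (LinearMap.mulLeft ℂ (x k) ∘ₗ y k))
          (ProjTensor.tprod a) - ProjTensor.tprod a = ProjTensor.tprod
          (Fin.cons (∑ k ∈ s d, x k * y k (a 0) - a 0) (Fin.tail a) : Fin (n + 1) → A) := by
        have hu : ∀ b, (Fin.cons b (Fin.tail a) : Fin (n + 1) → A) = Function.update a 0 b :=
          fun b => by
            conv_rhs => rw [← Fin.cons_self_tail a]
            rw [Fin.update_cons_zero]
        simp only [ProjTensor.lift_tprod, headMultilinear_apply, hu]
        rw [MultilinearMap.map_update_sub, MultilinearMap.map_update_sum,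
          Function.update_eq_self]
        rfl
      rw [e]
      refine (projSeminorm_tprod_le _ _).trans (le_of_eq ?_)
      rw [Fin.prod_univ_succ]
      simp [hCdef]
    · intro t₁ t₂ h₁ h₂
      simp only [map_add, Finset.sum_add_distrib]
      exact h₁.add h₂
  have hext : ∀ n t, ((⟨gl n, hgc n⟩ : ProjTensor (n + 1) A →L[ℂ] CompletedTensor (n + 2) A).extend
      CompletedTensor.incl) (CompletedTensor.incl t) = g n t := fun n t =>
    ContinuousLinearMap.extend_eq _ (e := CompletedTensor.incl)
      UniformSpace.Completion.denseRange_coe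
      (UniformSpace.Completion.isUniformInducing_coe _) t
  have hdense : ∀ n {f f' : CompletedTensor n A →L[ℂ] CompletedTensor n A},
      (∀ t, f (CompletedTensor.incl t) = f' (CompletedTensor.incl t)) → f = f' := by
    intro n f f' hff
    refine ContinuousLinearMap.ext fun z => ?_
    exact congrFun (UniformSpace.Completion.denseRange_coe.equalizer f.continuous f'.continuous
      (funext hff)) z
  have hbar : ∀ n t, Tendsto (fun d => CompletedTensor.incl (algBarD A n (h n d t))) atTop
      (𝓝 (barD A n (g n t))) := by
    intro n t
    have := ((barD A n).continuous.tendsto _).comp (hg n t)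
    refine this.congr fun d => ?_
    exact CompletedTensor.map_incl _ _
  refine ⟨fun n => (⟨gl n, hgc n⟩ : ProjTensor (n + 1) A →L[ℂ] _).extend CompletedTensor.incl,
    hdense _ fun t => ?_, fun n => hdense _ fun t => ?_⟩
  · rw [ContinuousLinearMap.comp_apply, hext, ContinuousLinearMap.id_apply]
    refine tendsto_nhds_unique (hbar 0 t)
      (((CompletedTensor.incl.continuous.tendsto _).comp (hm 0 t)).congr fun d => ?_)
    simp only [Function.comp_apply, hh, splittingHom, LinearMap.sum_apply, map_sum,
      algBarD_zero_insert]
  · rw [add_apply, ContinuousLinearMap.comp_apply,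
      ContinuousLinearMap.comp_apply, hext, ContinuousLinearMap.id_apply]
    have e1 : barD A n (CompletedTensor.incl t) = CompletedTensor.incl (algBarD A n t) :=
      CompletedTensor.map_incl _ _
    rw [e1, hext]
    refine tendsto_nhds_unique ((hbar (n + 1) t).add (hg n (algBarD A n t)))
      (((CompletedTensor.incl.continuous.tendsto _).comp (hm (n + 1) t)).congr fun d => ?_)
    simp only [Function.comp_apply, hh, splittingHom, LinearMap.sum_apply, map_sum]
    rw [← Finset.sum_add_distrib]
    refine Finset.sum_congr rfl fun k _ => ?_
    rw [← algBarD_succ_insert n (x k) (y k) (hy k), map_add]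

end Limit

end BarHomotopy

end TwistedHKR

end

noncomputable section

namespace TwistedHKR

/-! ### Trace class operators as a bimodule over the bounded operators -/

section TraceClassBimodule

variable {H : Type v} [NormedAddCommGroup H] [InnerProductSpace ℂ H] [CompleteSpace H]

theorem tsum_mul_le_sqrt {ι : Type*} (f g : ι → ℝ≥0∞) :
    ∑' i, f i * g i ≤ (∑' i, f i ^ 2) ^ (1 / 2 : ℝ) * (∑' i, g i ^ 2) ^ (1 / 2 : ℝ) := by
  rw [ENNReal.tsum_eq_iSup_sum]
  refine iSup_le fun s => ?_
  refine (ENNReal.inner_le_Lp_mul_Lq s f g Real.HolderConjugate.two_two).trans ?_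
  simp only [ENNReal.rpow_ofNat]
  gcongr <;> exact ENNReal.sum_le_tsum s

/-- Cauchy-Schwarz for Hilbert-Schmidt operators: a contraction `W` computing `Tr |A B|` is moved to
the other side of the inner product, where composing `A*` with it does not increase the
Hilbert-Schmidt norm. -/
theorem traceENorm_mul_le_hsSq (A B : H →L[ℂ] H) :
    traceENorm (A * B) ≤ hsSq (stdBasis H) (ContinuousLinearMap.adjoint A) ^ (1 / 2 : ℝ) *
      hsSq (stdBasis H) B ^ (1 / 2 : ℝ) := by
  obtain ⟨W, hW, h⟩ := exists_traceENorm_eq (A * B)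
  set b := stdBasis H
  have h1 : ∀ i, ‖⟪W (b i), (A * B) (b i)⟫_ℂ‖ₑ ≤
      ‖(ContinuousLinearMap.adjoint A * W) (b i)‖ₑ * ‖B (b i)‖ₑ := by
    intro i
    have : ⟪W (b i), (A * B) (b i)⟫_ℂ = ⟪(ContinuousLinearMap.adjoint A * W) (b i), B (b i)⟫_ℂ := by
      change ⟪W (b i), A (B (b i))⟫_ℂ = ⟪ContinuousLinearMap.adjoint A (W (b i)), B (b i)⟫_ℂ
      rw [ContinuousLinearMap.adjoint_inner_left]
    rw [this, ← ofReal_norm, ← ofReal_norm, ← ofReal_norm, ← ENNReal.ofReal_mul (norm_nonneg _)]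
    exact ENNReal.ofReal_le_ofReal (norm_inner_le_norm _ _)
  rw [h]
  refine (ENNReal.tsum_le_tsum h1).trans ((tsum_mul_le_sqrt _ _).trans ?_)
  gcongr
  · exact hsSq_comp_right_le b W _ hW
  · exact le_rfl

open InnerProductSpace in
-- Against a contraction `W` that computes the trace norm, the terms are products of the
-- coefficients of `W* v` and `w` in the basis; Cauchy-Schwarz and Parseval conclude.
theorem traceENorm_rankOne_le (v w : H) : traceENorm (rankOne ℂ v w) ≤ ‖v‖ₑ * ‖w‖ₑ := by
  obtain ⟨W, hW, h⟩ := exists_traceENorm_eq (rankOne ℂ v w)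
  set b := stdBasis H
  have h1 : ∀ i, ‖⟪W (b i), rankOne ℂ v w (b i)⟫_ℂ‖ₑ =
      ‖⟪b i, ContinuousLinearMap.adjoint W v⟫_ℂ‖ₑ * ‖⟪b i, w⟫_ℂ‖ₑ := by
    intro i
    rw [rankOne_apply, inner_smul_right, enorm_mul, mul_comm,
      ContinuousLinearMap.adjoint_inner_right, enorm_inner_symm w]
  rw [h, tsum_congr h1]
  refine (tsum_mul_le_sqrt _ _).trans ?_
  rw [← enorm_sq_eq_tsum, ← enorm_sq_eq_tsum, ← ENNReal.rpow_natCast_mul,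
    ← ENNReal.rpow_natCast_mul]
  simp only [Nat.cast_ofNat, one_div, ne_eq, OfNat.ofNat_ne_zero, not_false_eq_true,
    mul_inv_cancel₀, ENNReal.rpow_one]
  gcongr
  have : ‖ContinuousLinearMap.adjoint W v‖ ≤ ‖v‖ :=
    (ContinuousLinearMap.le_of_opNorm_le _ (by simpa using hW) v).trans (by simp)
  exact enorm_le_iff_norm_le.2 this

namespace L1

/-- The product of a bounded and a trace class operator, as a bilinear map. -/
def lmulₗ : (H →L[ℂ] H) →ₗ[ℂ] L1 H →ₗ[ℂ] L1 H :=
  LinearMap.mk₂ ℂ (fun A T => mk (A * op T) ((traceENorm_mul_le_left _ _).trans_lt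
      (ENNReal.mul_lt_top (by simp) (traceENorm_op_lt_top T))))
    (fun A B T => op_injective (by simp [add_mul])) (fun c A T => op_injective (by simp))
    (fun A S T => op_injective (by simp [mul_add])) (fun c A T => op_injective (by simp))

/-- The product of a trace class and a bounded operator, as a bilinear map. -/
def rmulₗ : (H →L[ℂ] H) →ₗ[ℂ] L1 H →ₗ[ℂ] L1 H :=
  LinearMap.mk₂ ℂ (fun A T => mk (op T * A) ((traceENorm_mul_le_right _ _).trans_lt
      (ENNReal.mul_lt_top (traceENorm_op_lt_top T) (by simp))))
    (fun A B T => op_injective (by simp [mul_add])) (fun c A T => op_injective (by simp))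
    (fun A S T => op_injective (by simp [add_mul])) (fun c A T => op_injective (by simp))

theorem norm_lmulₗ_le (A : H →L[ℂ] H) (T : L1 H) : ‖lmulₗ A T‖ ≤ 1 * ‖A‖ * ‖T‖ := by
  rw [one_mul, norm_def, norm_def, ← toReal_enorm A, ← ENNReal.toReal_mul]
  exact ENNReal.toReal_mono (ENNReal.mul_ne_top (by simp) (traceENorm_op_lt_top T).ne)
    (traceENorm_mul_le_left _ _)

theorem norm_rmulₗ_le (A : H →L[ℂ] H) (T : L1 H) : ‖rmulₗ A T‖ ≤ 1 * ‖A‖ * ‖T‖ := by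
  rw [one_mul, mul_comm, norm_def, norm_def, ← toReal_enorm A, ← ENNReal.toReal_mul]
  exact ENNReal.toReal_mono (ENNReal.mul_ne_top (traceENorm_op_lt_top T).ne (by simp))
    (traceENorm_mul_le_right _ _)

/-- The product `A T` of a bounded operator `A` and a trace class operator `T`. -/
def lmul : (H →L[ℂ] H) →L[ℂ] L1 H →L[ℂ] L1 H := 
  LinearMap.mkContinuous₂ lmulₗ 1 fun A T => norm_lmulₗ_le A T

/-- The product `T A` of a trace class operator `T` and a bounded operator `A`. -/
def rmul : (H →L[ℂ] H) →L[ℂ] L1 H →L[ℂ] L1 H := 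
  LinearMap.mkContinuous₂ rmulₗ 1 fun A T => norm_rmulₗ_le A T

@[simp] theorem op_lmul (A : H →L[ℂ] H) (T : L1 H) : op (lmul A T) = A * op T := rfl

@[simp] theorem op_rmul (A : H →L[ℂ] H) (T : L1 H) : op (rmul A T) = op T * A := rfl

theorem lmul_mul (A : H →L[ℂ] H) (S T : L1 H) : lmul A (S * T) = lmul A S * T :=
  op_injective (by simp [mul_assoc])

theorem lmul_lmul (A B : H →L[ℂ] H) (T : L1 H) : lmul A (lmul B T) = lmul (A * B) T :=
  op_injective (by simp [mul_assoc])

/-- The operator `v ⟨w, ·⟩`. -/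
def rankOne (v w : H) : L1 H :=
  mk (InnerProductSpace.rankOne ℂ v w)
    ((traceENorm_rankOne_le v w).trans_lt (ENNReal.mul_lt_top (by simp) (by simp)))

@[simp] theorem op_rankOne (v w : H) : op (rankOne v w) = InnerProductSpace.rankOne ℂ v w := rfl

theorem norm_rankOne_le (v w : H) : ‖rankOne v w‖ ≤ ‖v‖ * ‖w‖ := by
  rw [norm_def, ← toReal_enorm v, ← toReal_enorm w, ← ENNReal.toReal_mul]
  exact ENNReal.toReal_mono (ENNReal.mul_ne_top (by simp) (by simp)) (traceENorm_rankOne_le v w)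

theorem rankOne_add_left (v v' w : H) : rankOne (v + v') w = rankOne v w + rankOne v' w :=
  op_injective (by simp)

theorem rankOne_add_right (v w w' : H) : rankOne v (w + w') = rankOne v w + rankOne v w' :=
  op_injective (by simp)

theorem rankOne_smul_left (c : ℂ) (v w : H) : rankOne (c • v) w = c • rankOne v w :=
  op_injective (by simp)

theorem rankOne_smul_right (c : ℂ) (v w : H) : rankOne v (c • w) = star c • rankOne v w :=
  op_injective (by simp)

/-- `T` now enters only through the vector `T* w`; this is what lets the splitting be read as values
of a sesquilinear form. -/
theorem lmul_rankOne (v w : H) (T : L1 H) :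
    lmul (InnerProductSpace.rankOne ℂ v w) T =
      rankOne v (ContinuousLinearMap.adjoint (op T) w) := by
  refine op_injective (ContinuousLinearMap.ext fun z => ?_)
  simp [ContinuousLinearMap.adjoint_inner_left]

end L1

open InnerProductSpace in
variable (H) in
/-- The orthogonal projection to the span of finitely many vectors of the basis. -/
def cutoff (F : Finset (basisIndex H)) : H →L[ℂ] H :=
  ∑ j ∈ F, rankOne ℂ (stdBasis H j) (stdBasis H j)

theorem adjoint_cutoff (F : Finset (basisIndex H)) :
    ContinuousLinearMap.adjoint (cutoff H F) = cutoff H F := by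
  simp [cutoff, map_sum]

open Classical in
theorem cutoff_basis (F : Finset (basisIndex H)) (i : basisIndex H) :
    cutoff H F (stdBasis H i) = if i ∈ F then stdBasis H i else 0 := by
  have := (stdBasis H).orthonormal
  simp only [cutoff, sum_apply, InnerProductSpace.rankOne_apply,
    orthonormal_iff_ite.1 this, ite_smul, one_smul, zero_smul]
  simp

open Classical in
-- Write `T = W R²` with `R = |T|^(1/2)` and factor `(1 - P) T = ((1 - P) W R) R` into
-- Hilbert-Schmidt operators. The adjoint of the first factor is `R W* (1 - P)`, which kills the
-- basis vectors in `F`, so its Hilbert-Schmidt norm is a tail of the series of `f i = ‖R W* vᵢ‖²`,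
-- and `f` does not depend on `F`.
theorem exists_cutoff_bound (T : L1 H) : ∃ f : basisIndex H → ℝ≥0∞,
    ∑' i, f i ≤ traceENorm (L1.op T) ∧ ∀ F : Finset (basisIndex H),
      traceENorm ((1 - cutoff H F) * L1.op T) ≤
        (∑' i, if i ∈ F then 0 else f i) ^ (1 / 2 : ℝ) * traceENorm (L1.op T) ^ (1 / 2 : ℝ) := by
  obtain ⟨W, hW, hWA, -⟩ := exists_polar (L1.op T)
  set b := stdBasis H with hb
  have hs : IsSelfAdjoint (CFC.sqrt (CFC.abs (L1.op T))) :=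
    IsSelfAdjoint.of_nonneg (CFC.sqrt_nonneg _)
  have hm : CFC.sqrt (CFC.abs (L1.op T)) * CFC.sqrt (CFC.abs (L1.op T)) = CFC.abs (L1.op T) :=
    CFC.sqrt_mul_sqrt_self _ (CFC.abs_nonneg _)
  have htr : traceENorm (L1.op T) = hsSq b (CFC.sqrt (CFC.abs (L1.op T))) :=
    posTrace_eq_hsSq b _ (CFC.abs_nonneg _)
  set R := CFC.sqrt (CFC.abs (L1.op T))
  refine ⟨fun i => ‖(R * ContinuousLinearMap.adjoint W) (b i)‖ₑ ^ 2, ?_, fun F => ?_⟩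
  · rw [htr]
    exact hsSq_comp_right_le b _ R (by simpa using hW)
  · have e : (1 - cutoff H F) * L1.op T = ((1 - cutoff H F) * (W * R)) * R := by
      rw [← hWA, ← hm]
      simp only [mul_assoc]
    rw [e, htr]
    refine (traceENorm_mul_le_hsSq _ _).trans ?_
    gcongr
    refine ENNReal.tsum_le_tsum fun i => ?_
    have e2 : ContinuousLinearMap.adjoint ((1 - cutoff H F) * (W * R)) =
        R * ContinuousLinearMap.adjoint W * (1 - cutoff H F) := by
      rw [← ContinuousLinearMap.star_eq_adjoint, star_mul, star_mul, star_sub, star_one,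
        ContinuousLinearMap.star_eq_adjoint, ContinuousLinearMap.star_eq_adjoint,
        ContinuousLinearMap.star_eq_adjoint, adjoint_cutoff, hs.adjoint_eq]
    rw [e2, ← hb]
    change ‖(R * ContinuousLinearMap.adjoint W) (b i - cutoff H F (b i))‖ₑ ^ 2 ≤ _
    rw [hb, cutoff_basis]
    split_ifs <;> simp

/-- Both factors in `exists_cutoff_bound` are at most `(Tr |T|)^(1/2)`. This is the dominating bound
for `tendsto_weightedNorm_cutoff`. -/
theorem norm_sub_cutoff_le (F : Finset (basisIndex H)) (T : L1 H) :
    ‖T - L1.lmul (cutoff H F) T‖ ≤ ‖T‖ := by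
  classical
  obtain ⟨f, hf, h⟩ := exists_cutoff_bound T
  rw [L1.norm_def, L1.norm_def]
  refine ENNReal.toReal_mono (L1.traceENorm_op_lt_top T).ne ?_
  have e : L1.op (T - L1.lmul (cutoff H F) T) = (1 - cutoff H F) * L1.op T := by
    rw [sub_mul, one_mul]
    rfl
  rw [e]
  refine (h F).trans ?_
  have : (∑' i, if i ∈ F then 0 else f i) ≤ traceENorm (L1.op T) :=
    (ENNReal.tsum_le_tsum fun i => by split_ifs <;> simp).trans hf
  calc _ ≤ traceENorm (L1.op T) ^ (1 / 2 : ℝ) * traceENorm (L1.op T) ^ (1 / 2 : ℝ) := by gcongr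
    _ = _ := by
      rw [← ENNReal.rpow_add_of_nonneg _ _ (by norm_num) (by norm_num)]
      norm_num

/-- The first factor in `exists_cutoff_bound` is the square root of a tail of a convergent series.
-/
theorem tendsto_cutoff (T : L1 H) :
    Tendsto (fun F => ‖T - L1.lmul (cutoff H F) T‖) atTop (𝓝 0) := by
  classical
  obtain ⟨f, hf, h⟩ := exists_cutoff_bound T
  have hfin : ∑' i, f i ≠ ⊤ := (hf.trans_lt (L1.traceENorm_op_lt_top T)).ne
  have h1 : Tendsto (fun F : Finset (basisIndex H) => ∑' i, if i ∈ F then 0 else f i) atTop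
      (𝓝 0) := by
    refine (ENNReal.tendsto_tsum_compl_atTop_zero hfin).congr fun F => ?_
    refine (tsum_subtype {i | i ∉ F} f).trans (tsum_congr fun i => ?_)
    by_cases hi : i ∈ F <;> simp [Set.indicator, hi]
  have h2 : Tendsto (fun F : Finset (basisIndex H) => (∑' i, if i ∈ F then 0 else f i) ^ (1 / 2 : ℝ)
      * traceENorm (L1.op T) ^ (1 / 2 : ℝ)) atTop (𝓝 0) := by
    have := ENNReal.Tendsto.mul_const (b := traceENorm (L1.op T) ^ (1 / 2 : ℝ))
      (h1.ennrpow_const (1 / 2)) (Or.inr (ENNReal.rpow_ne_top_of_nonneg (by norm_num)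
        (L1.traceENorm_op_lt_top T).ne))
    simpa using this
  have h3 := tendsto_of_tendsto_of_tendsto_of_le_of_le tendsto_const_nhds h2
    (fun F => zero_le) h
  have h4 := (ENNReal.tendsto_toReal ENNReal.zero_ne_top).comp h3
  refine h4.congr fun F => ?_
  rw [L1.norm_def]
  simp only [Function.comp_apply]
  rw [sub_mul, one_mul]
  rfl

/-- `|∑ⱼ B(T* eⱼ, eⱼ)| ≤ ‖B‖ Tr |T|`. -/
theorem norm_sum_bilin_le (B : H →L⋆[ℂ] H →L[ℂ] ℂ) (F : Finset (basisIndex H)) (T : L1 H) :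
    ‖∑ j ∈ F, B (ContinuousLinearMap.adjoint (L1.op T) (stdBasis H j)) (stdBasis H j)‖ ≤
      ‖B‖ * ‖T‖ := by
  -- Once `B` is represented by a bounded operator with adjoint `R`, the summands are diagonal
  -- entries of `T R`, and the sum of their absolute values is at most `Tr |T R|`.
  set R := ContinuousLinearMap.adjoint (InnerProductSpace.continuousLinearMapOfBilin B) with hR
  have hRn : ‖R‖ ≤ ‖B‖ := by
    rw [hR, LinearIsometryEquiv.norm_map]
    refine ContinuousLinearMap.opNorm_le_bound _ (norm_nonneg B) fun z => ?_
    simp only [InnerProductSpace.continuousLinearMapOfBilin, ContinuousLinearMap.comp_apply]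
    refine le_trans (le_of_eq ?_) (B.le_opNorm z)
    exact LinearIsometryEquiv.norm_map _ _
  have h1 : ∀ j, B (ContinuousLinearMap.adjoint (L1.op T) (stdBasis H j)) (stdBasis H j) =
      ⟪stdBasis H j, (L1.op T * R) (stdBasis H j)⟫_ℂ := by
    intro j
    rw [← InnerProductSpace.continuousLinearMapOfBilin_apply,
      ← ContinuousLinearMap.adjoint_inner_right, ContinuousLinearMap.adjoint_inner_left]
    rfl
  have h2 : ENNReal.ofReal (∑ j ∈ F, ‖⟪stdBasis H j, (L1.op T * R) (stdBasis H j)⟫_ℂ‖) ≤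
      traceENorm (L1.op T) * ‖R‖ₑ := by
    rw [ENNReal.ofReal_sum_of_nonneg fun _ _ => norm_nonneg _]
    simp only [ofReal_norm]
    refine (ENNReal.sum_le_tsum F).trans ?_
    exact (tsum_le_traceENorm (L1.op T * R) 1 1 ContinuousLinearMap.norm_id_le
      ContinuousLinearMap.norm_id_le).trans (traceENorm_mul_le_right _ _)
  have h3 := ENNReal.toReal_mono (ENNReal.mul_ne_top (L1.traceENorm_op_lt_top T).ne (by simp)) h2
  rw [ENNReal.toReal_ofReal (Finset.sum_nonneg fun _ _ => norm_nonneg _), ENNReal.toReal_mul,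
    ← L1.norm_def, toReal_enorm] at h3
  simp only [h1]
  refine (norm_sum_le _ _).trans (h3.trans ?_)
  rw [mul_comm]
  gcongr

end TraceClassBimodule

end TwistedHKR

end

open scoped NNReal
noncomputable section

namespace TwistedHKR

/-! ### Rapidly decreasing families -/

section RapidlyDecreasing

variable {K : Type*} (w : K → ℝ≥0) (E : Type*) [NormedAddCommGroup E] [NormedSpace ℂ E]

/-- The families in `E` which decrease faster than all powers of the weight `w`. -/
def RapidlyDecreasing : Submodule ℂ (K → E) where
  carrier := {c | ∀ m : ℕ, Summable fun k => (w k : ℝ) ^ m * ‖c k‖}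
  zero_mem' m := by simp
  add_mem' {c d} hc hd m := by
    refine Summable.of_nonneg_of_le (fun k => by positivity) (fun k => ?_) ((hc m).add (hd m))
    rw [← mul_add]
    exact mul_le_mul_of_nonneg_left (norm_add_le _ _) (by positivity)
  smul_mem' a c hc m := by
    refine ((hc m).mul_left ‖a‖).congr fun k => ?_
    rw [Pi.smul_apply, norm_smul]
    ring

namespace RapidlyDecreasing

variable {w E}

/-- The norm `∑ₖ w(k)ᵐ ‖c(k)‖`. -/
def weightedNorm (m : ℕ) (c : RapidlyDecreasing w E) : ℝ := ∑' k, (w k : ℝ) ^ m * ‖c.1 k‖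

theorem weightedNorm_nonneg (m : ℕ) (c : RapidlyDecreasing w E) : 0 ≤ weightedNorm m c :=
  tsum_nonneg fun _ => by positivity

/-- A continuous linear map, applied to all the members of a family. -/
def map {F : Type*} [NormedAddCommGroup F] [NormedSpace ℂ F] (L : E →L[ℂ] F) :
    RapidlyDecreasing w E →ₗ[ℂ] RapidlyDecreasing w F where
  toFun c := ⟨fun k => L (c.1 k), fun m => by
    refine Summable.of_nonneg_of_le (fun k => by positivity) (fun k => ?_)
      ((c.2 m).mul_left ‖L‖)
    rw [mul_left_comm]
    exact mul_le_mul_of_nonneg_left (L.le_opNorm _) (by positivity)⟩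
  map_add' c d := Subtype.ext (funext fun k => map_add L _ _)
  map_smul' a c := Subtype.ext (funext fun k => map_smul L _ _)

@[simp] theorem map_apply {F : Type*} [NormedAddCommGroup F] [NormedSpace ℂ F] (L : E →L[ℂ] F)
    (c : RapidlyDecreasing w E) (k : K) : (map L c).1 k = L (c.1 k) := rfl

theorem weightedNorm_map_le {F : Type*} [NormedAddCommGroup F] [NormedSpace ℂ F] (L : E →L[ℂ] F)
    (m : ℕ) (c : RapidlyDecreasing w E) :
    weightedNorm m (map L c) ≤ ‖L‖ * weightedNorm m c := by
  rw [weightedNorm, weightedNorm, ← tsum_mul_left]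
  refine Summable.tsum_le_tsum (fun k => ?_) ((map L c).2 m) ((c.2 m).mul_left _)
  rw [mul_left_comm]
  exact mul_le_mul_of_nonneg_left (L.le_opNorm _) (by positivity)

open Classical in
/-- The family with a single non-zero member. -/
def single (k : K) : E →ₗ[ℂ] RapidlyDecreasing w E where
  toFun x := ⟨Pi.single k x, fun m => summable_of_ne_finset_zero (s := {k}) fun l hl => by
    have : l ≠ k := by simpa using hl
    simp [this]⟩
  map_add' x y := Subtype.ext (by
    change (Pi.single k (x + y) : K → E) = Pi.single k x + Pi.single k y
    exact Pi.single_add (f := fun _ => E) k x y)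
  map_smul' a x := Subtype.ext (by
    change (Pi.single k (a • x) : K → E) = a • Pi.single k x
    exact Pi.single_smul' k a x)

open Classical in
theorem single_val (k : K) (x : E) :
    (single (w := w) k x : RapidlyDecreasing w E).1 = (Pi.single k x : K → E) := rfl

theorem single_apply_same (k : K) (x : E) : (single (w := w) k x).1 k = x := by
  classical
  rw [single_val, Pi.single_eq_same]

theorem single_apply_ne {k l : K} (h : l ≠ k) (x : E) : (single (w := w) k x).1 l = 0 := by
  classical
  rw [single_val, Pi.single_eq_of_ne h]

theorem map_single {F : Type*} [NormedAddCommGroup F] [NormedSpace ℂ F] (L : E →L[ℂ] F)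
    (k : K) (x : E) : map L (single (w := w) k x) = single k (L x) := by
  classical
  refine Subtype.ext (funext fun l => ?_)
  rw [map_apply, single_val, single_val]
  exact Pi.apply_single (fun _ => L) (fun _ => map_zero L) k x l

theorem weightedNorm_single (m : ℕ) (k : K) (x : E) :
    weightedNorm m (single (w := w) k x) = (w k : ℝ) ^ m * ‖x‖ := by
  classical
  rw [weightedNorm, tsum_eq_single k fun l hl => by simp [single_val, hl], single_val,
    Pi.single_eq_same]

/-- A linear map which is bounded for one of the norms is determined by its values on the families
with a single non-zero member. -/
theorem hasSum_single {F : Type*} [SeminormedAddCommGroup F] [NormedSpace ℂ F]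
    (f : RapidlyDecreasing w E →ₗ[ℂ] F) {C : ℝ} {m : ℕ}
    (hf : ∀ c, ‖f c‖ ≤ C * weightedNorm m c) (c : RapidlyDecreasing w E) :
    HasSum (fun k => f (single k (c.1 k))) (f c) := by
  classical
  rw [HasSum, SummationFilter.unconditional_filter, tendsto_iff_norm_sub_tendsto_zero]
  -- Removing finitely many members leaves a tail of the series that defines the weighted norm.
  have h1 : ∀ S : Finset K, weightedNorm m (c - ∑ k ∈ S, single k (c.1 k)) =
      ∑' k : {k // k ∉ S}, (w k : ℝ) ^ m * ‖c.1 k‖ := by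
    intro S
    refine Eq.trans ?_ (tsum_subtype {k | k ∉ S} fun k => (w k : ℝ) ^ m * ‖c.1 k‖).symm
    refine tsum_congr fun k => ?_
    have : (c - ∑ k ∈ S, single k (c.1 k)).1 k = if k ∈ S then 0 else c.1 k := by
      have e : (c - ∑ k ∈ S, single k (c.1 k)).1 = c.1 - ∑ l ∈ S, (Pi.single l (c.1 l) : K → E) := by
        simp [single_val]
      rw [e, Pi.sub_apply, Finset.sum_apply, Finset.sum_pi_single]
      split_ifs <;> simp
    rw [this]
    by_cases hk : k ∈ S <;> simp [Set.indicator, hk]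
  have h2 : Tendsto (fun S : Finset K => C * weightedNorm m (c - ∑ k ∈ S, single k (c.1 k))) atTop
      (𝓝 0) := by
    simp only [h1]
    simpa using (tendsto_tsum_compl_atTop_zero
      fun k => (w k : ℝ) ^ m * ‖c.1 k‖).const_mul C
  refine squeeze_zero (fun _ => norm_nonneg _) (fun S => ?_) h2
  rw [← map_sum, norm_sub_rev, ← map_sub]
  exact hf _

variable {H : Type v} [NormedAddCommGroup H] [InnerProductSpace ℂ H] [CompleteSpace H]

/-- Dominated convergence over the index set: each member converges by `tendsto_cutoff`, and the
series of the weighted norm of `c` dominates by `norm_sub_cutoff_le`. -/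
theorem tendsto_weightedNorm_cutoff (m : ℕ) (c : RapidlyDecreasing w (L1 H)) :
    Tendsto (fun F => weightedNorm m (c - map (L1.lmul (cutoff H F)) c)) atTop (𝓝 0) := by
  have := tendsto_tsum_of_dominated_convergence
    (f := fun F k => (w k : ℝ) ^ m * ‖c.1 k - L1.lmul (cutoff H F) (c.1 k)‖) (𝓕 := atTop)
    (g := fun _ => 0) (c.2 m)
    (fun k => by simpa using (tendsto_cutoff (c.1 k)).const_mul ((w k : ℝ) ^ m))
    (Eventually.of_forall fun F k => by
      rw [Real.norm_of_nonneg (by positivity)]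
      exact mul_le_mul_of_nonneg_left (norm_sub_cutoff_le F _) (by positivity))
  rw [tsum_zero] at this
  exact this

end RapidlyDecreasing

end RapidlyDecreasing

/-! ### Localizations in rapidly decreasing families of trace class operators -/

section Localization

theorem seminorm_sum_le {V ι : Type*} [AddCommGroup V] [Module ℂ V] (N : Seminorm ℂ V)
    (s : Finset ι) (f : ι → V) : N (∑ i ∈ s, f i) ≤ ∑ i ∈ s, N (f i) :=
  Finset.le_sum_of_subadditive N (map_zero N).le (map_add_le_add N) s f

theorem seminorm_sum_apply {V ι : Type*} [AddCommGroup V] [Module ℂ V] (s : Finset ι)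
    (N : ι → Seminorm ℂ V) (x : V) : (∑ i ∈ s, N i) x = ∑ i ∈ s, N i x := by
  rw [← FunLike.coeAddMonoidHom_apply, map_sum, Finset.sum_apply]
  rfl

/-- Hahn-Banach. A projective seminorm is an infimum over representations; this replaces its
estimate by that of a single bilinear form. -/
theorem exists_linear_seminorm_le {V : Type*} [AddCommGroup V] [Module ℂ V] (N : Seminorm ℂ V)
    (t : V) : ∃ φ : V →ₗ[ℂ] ℂ, (∀ x, ‖φ x‖ ≤ N x) ∧ N t ≤ ‖φ t‖ := by
  let _ : SeminormedAddCommGroup V := N.toSeminormedAddCommGroup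
  let _ : NormedSpace ℂ V := { norm_smul_le := fun a x => (map_smul_eq_mul N a x).le }
  obtain ⟨g, hg, hgt⟩ := exists_dual_vector'' ℂ t
  refine ⟨g.toLinearMap, fun x => ?_, ?_⟩
  swap
  · have h : ‖g t‖ = ‖t‖ := by rw [hgt, RCLike.norm_ofReal, abs_of_nonneg (norm_nonneg _)]
    exact h.ge
  have := g.le_of_opNorm_le hg x
  rw [one_mul] at this
  exact this

variable {K : Type*} {w : K → ℝ≥0} {k₀ : K}
  {H : Type v} [NormedAddCommGroup H] [InnerProductSpace ℂ H] [CompleteSpace H]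
  {A : Type u} [NonUnitalRing A] [Module ℂ A] [TopologicalSpace A]

variable (w k₀ H A) in
/-- A pair of linear maps between an algebra `A` and the rapidly decreasing families of trace class
operators, which are continuous and compatible with the multiplications. -/
structure LocalPatch where
  /-- The map which restricts an element of `A`. -/
  res : A →ₗ[ℂ] RapidlyDecreasing w (L1 H)
  /-- The map which extends a family to an element of `A`. -/
  ext : RapidlyDecreasing w (L1 H) →ₗ[ℂ] A
  ext_bound : ∀ p : Seminorm ℂ A, Continuous p →
    ∃ (C : ℝ≥0) (m : ℕ), ∀ c, p (ext c) ≤ C * RapidlyDecreasing.weightedNorm m c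
  res_bound : ∀ m : ℕ, ∃ r : Seminorm ℂ A, Continuous r ∧
    ∀ a, RapidlyDecreasing.weightedNorm m (res a) ≤ r a
  ext_res_mul : ∀ (B : H →L[ℂ] H) (a b : A),
    ext (RapidlyDecreasing.map (L1.lmul B) (res (a * b))) = ext (RapidlyDecreasing.map (L1.lmul B) (res a)) * b
  single_mul_ext_res : ∀ (S : L1 H) (B : H →L[ℂ] H) (a : A),
    ext (RapidlyDecreasing.single k₀ S) * ext (RapidlyDecreasing.map (L1.lmul B) (res a)) =
      ext (RapidlyDecreasing.map (L1.lmul (L1.op S * B)) (res a))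

namespace LocalPatch

open RapidlyDecreasing

variable (L : LocalPatch w k₀ H A)

/-- The extension of the operator `v ⟨e, ·⟩`. -/
def left (e v : H) : A := L.ext (single k₀ (L1.rankOne v e))

/-- The extension of the family `e ⟨v, c ·⟩`. -/
def right (e v : H) : RapidlyDecreasing w (L1 H) →ₗ[ℂ] A :=
  L.ext ∘ₗ RapidlyDecreasing.map (L1.lmul (InnerProductSpace.rankOne ℂ e v))

/-- The tensor `∑ⱼ vⱼ ⟨e, ·⟩ ⊗ e ⟨vⱼ, c ·⟩`, where `vⱼ` is the basis. -/
def splitting (e : H) (F : Finset (basisIndex H)) (c : RapidlyDecreasing w (L1 H)) :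
    ProjTensor 2 A :=
  ∑ j ∈ F, ProjTensor.tprod ![L.left e (stdBasis H j), L.right e (stdBasis H j) c]

theorem update_pair_zero (a b x : A) : Function.update ![a, b] 0 x = ![x, b] := by
  funext i
  fin_cases i <;> rfl

theorem update_pair_one (a b x : A) : Function.update ![a, b] 1 x = ![a, x] := by
  funext i
  fin_cases i <;> rfl

variable (A) in
/-- The universal bilinear map. -/
def tmul : A →ₗ[ℂ] A →ₗ[ℂ] ProjTensor 2 A :=
  LinearMap.mk₂ ℂ (fun a b => ProjTensor.tprod ![a, b])
    (fun a a' b => by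
      have := (ProjTensor.tprod (k := 2) (E := A)).map_update_add ![0, b] 0 a a'
      simpa only [update_pair_zero] using this)
    (fun z a b => by
      have := (ProjTensor.tprod (k := 2) (E := A)).map_update_smul ![0, b] 0 z a
      simpa only [update_pair_zero] using this)
    (fun a b b' => by
      have := (ProjTensor.tprod (k := 2) (E := A)).map_update_add ![a, 0] 1 b b'
      simpa only [update_pair_one] using this)
    (fun z a b => by
      have := (ProjTensor.tprod (k := 2) (E := A)).map_update_smul ![a, 0] 1 z b
      simpa only [update_pair_one] using this)

@[simp] theorem tmul_apply (a b : A) : tmul A a b = ProjTensor.tprod ![a, b] := rfl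

/-- The splitting is bounded uniformly in the finite set of basis vectors. -/
theorem exists_splitting_le {e : H} (he : ‖e‖ ≤ 1) {p q : Seminorm ℂ A} (hp : Continuous p)
    (hq : Continuous q) : ∃ (C : ℝ≥0) (m : ℕ), ∀ F c,
      projSeminorm ![p, q] (L.splitting e F c) ≤ C * weightedNorm m c := by
  obtain ⟨Cp, mp, hCp⟩ := L.ext_bound p hp
  obtain ⟨Cq, mq, hCq⟩ := L.ext_bound q hq
  refine ⟨Cp * (w k₀) ^ mp * Cq, mq, fun F c => ?_⟩
  obtain ⟨φ, hφ, hφt⟩ := exists_linear_seminorm_le (V := ProjTensor 2 A) (projSeminorm ![p, q])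
    (L.splitting e F c)
  -- From here on only the scalars `β(a, b)`, bounded by `p a * q b`, have to be estimated.
  set β : A →ₗ[ℂ] A →ₗ[ℂ] ℂ := (tmul A).compr₂ φ with hβ
  have hβle : ∀ a b, ‖β a b‖ ≤ p a * q b := by
    intro a b
    refine (hφ _).trans ((projSeminorm_tprod_le _ _).trans (le_of_eq ?_))
    rw [Fin.prod_univ_two]
    rfl
  -- The form is conjugate linear in `u`, since the rank one operator `e⟨u, ·⟩` is. The index `k`
  -- enters through the right factor only, whence the growth `(w k) ^ mq`.
  let B₀ : K → H →ₗ⋆[ℂ] H →ₗ[ℂ] ℂ := fun k =>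
    LinearMap.mk₂'ₛₗ (starRingEnd ℂ) (RingHom.id ℂ)
      (fun u v => β (L.ext (single k₀ (L1.rankOne v e))) (L.ext (single k (L1.rankOne e u))))
      (fun u u' v => by simp only [L1.rankOne_add_right, map_add])
      (fun z u v => by
        simp only [L1.rankOne_smul_right, map_smul]
        rfl)
      (fun u v v' => by simp only [L1.rankOne_add_left, map_add, LinearMap.add_apply])
      (fun z u v => by
        simp only [L1.rankOne_smul_left, map_smul, LinearMap.smul_apply]
        rfl)
  have hB₀ : ∀ k u v, ‖B₀ k u v‖ ≤ (Cp * (w k₀) ^ mp * Cq * (w k) ^ mq : ℝ) * ‖u‖ * ‖v‖ := by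
    intro k u v
    have h1 : p (L.ext (single k₀ (L1.rankOne v e))) ≤ Cp * ((w k₀) ^ mp * ‖v‖) := by
      refine (hCp _).trans ?_
      rw [weightedNorm_single]
      gcongr
      refine (L1.norm_rankOne_le _ _).trans ?_
      exact mul_le_of_le_one_right (norm_nonneg _) he
    have h2 : q (L.ext (single k (L1.rankOne e u))) ≤ Cq * ((w k) ^ mq * ‖u‖) := by
      refine (hCq _).trans ?_
      rw [weightedNorm_single]
      gcongr
      refine (L1.norm_rankOne_le _ _).trans ?_
      exact mul_le_of_le_one_left (norm_nonneg _) he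
    refine (hβle _ _).trans ((mul_le_mul h1 h2 (apply_nonneg _ _) (by positivity)).trans_eq ?_)
    ring
  let B : K → H →L⋆[ℂ] H →L[ℂ] ℂ := fun k => (B₀ k).mkContinuous₂ _ (hB₀ k)
  have hB : ∀ k, ‖B k‖ ≤ Cp * (w k₀) ^ mp * Cq * (w k) ^ mq := fun k =>
    LinearMap.mkContinuous₂_norm_le _ (by positivity) _
  let f : RapidlyDecreasing w (L1 H) →ₗ[ℂ] ℂ :=
    ∑ j ∈ F, β (L.left e (stdBasis H j)) ∘ₗ L.right e (stdBasis H j)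
  have hf : ∀ c, f c = φ (L.splitting e F c) := by
    intro c
    simp only [f, LinearMap.sum_apply, LinearMap.comp_apply, splitting, map_sum]
    rfl
  -- The heart of the matter: on a family with one member `T`, the functional is `∑ⱼ B k (T* vⱼ)
  -- vⱼ`, a partial trace, so the bound does not depend on `F`.
  have hfs : ∀ k T, ‖f (single k T)‖ ≤ Cp * (w k₀) ^ mp * Cq * (w k) ^ mq * ‖T‖ := by
    intro k T
    have : f (single k T) = ∑ j ∈ F,
        B k (ContinuousLinearMap.adjoint (L1.op T) (stdBasis H j)) (stdBasis H j) := by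
      simp only [f, LinearMap.sum_apply, LinearMap.comp_apply, right, map_single, L1.lmul_rankOne]
      rfl
    rw [this]
    exact (norm_sum_bilin_le (B k) F T).trans (mul_le_mul_of_nonneg_right (hB k) (norm_nonneg _))
  -- A crude bound whose constant depends on `F`. It serves only to expand `f c` as a series over
  -- `k`; the uniform constant then comes from `hfs`.
  have hfb : ∀ c, ‖f c‖ ≤ (∑ j ∈ F, p (L.left e (stdBasis H j)) *
      (Cq * ‖L1.lmul (InnerProductSpace.rankOne ℂ e (stdBasis H j))‖)) * weightedNorm mq c := by
    intro c
    simp only [f, LinearMap.sum_apply, Finset.sum_mul]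
    refine (norm_sum_le _ _).trans (Finset.sum_le_sum fun j _ => ?_)
    refine (hβle _ _).trans ?_
    rw [mul_assoc]
    refine mul_le_mul_of_nonneg_left ?_ (apply_nonneg _ _)
    rw [mul_assoc]
    exact (hCq _).trans (mul_le_mul_of_nonneg_left (weightedNorm_map_le _ _ _) (by positivity))
  have h1 := hasSum_single f hfb c
  have h2 : ‖f c‖ ≤ ∑' k, (Cp * (w k₀) ^ mp * Cq : ℝ) * ((w k) ^ mq * ‖c.1 k‖) := by
    rw [← h1.tsum_eq]
    refine tsum_of_norm_bounded ((c.2 mq).mul_left _).hasSum fun k => ?_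
    refine (hfs k (c.1 k)).trans_eq ?_
    ring
  rw [hf, tsum_mul_left] at h2
  refine (hφt.trans h2).trans_eq ?_
  rw [weightedNorm]
  push_cast
  rfl

/-- The functional `⟨vⱼ, ·⟩` is unchanged by the projection if `j ∈ F₀` and is killed otherwise, so
subtracting the projected family deletes exactly the terms in `F₀`. With the uniform bound this
gives the Cauchy property. -/
theorem splitting_sub (e : H) {F₀ F : Finset (basisIndex H)} (hF : F₀ ⊆ F)
    (c : RapidlyDecreasing w (L1 H)) :
    L.splitting e F c - L.splitting e F₀ c =
      L.splitting e F (c - map (L1.lmul (cutoff H F₀)) c) := by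
  classical
  have h : ∀ j, L.right e (stdBasis H j) (map (L1.lmul (cutoff H F₀)) c) =
      if j ∈ F₀ then L.right e (stdBasis H j) c else 0 := by
    intro j
    have h1 : InnerProductSpace.rankOne ℂ e (stdBasis H j) * cutoff H F₀ =
        if j ∈ F₀ then InnerProductSpace.rankOne ℂ e (stdBasis H j) else 0 := by
      refine ContinuousLinearMap.ext fun z => ?_
      have : (InnerProductSpace.rankOne ℂ e (stdBasis H j) * cutoff H F₀) z =
          ⟪cutoff H F₀ (stdBasis H j), z⟫_ℂ • e := by
        rw [← adjoint_cutoff, ContinuousLinearMap.adjoint_inner_left, adjoint_cutoff]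
        rfl
      rw [this, cutoff_basis]
      split_ifs <;> simp
    have h2 : map (L1.lmul (InnerProductSpace.rankOne ℂ e (stdBasis H j)))
        (map (L1.lmul (cutoff H F₀)) c) =
        map (L1.lmul (InnerProductSpace.rankOne ℂ e (stdBasis H j) * cutoff H F₀)) c :=
      Subtype.ext (funext fun k => L1.lmul_lmul _ _ _)
    rw [right, LinearMap.comp_apply, h2, h1]
    split_ifs
    · rfl
    · have : map (w := w) (L1.lmul (0 : H →L[ℂ] H)) c = 0 :=
        Subtype.ext (funext fun k => by
          rw [map_apply, map_zero]
          rfl)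
      rw [this, map_zero]
  simp only [splitting, map_sub, h]
  rw [← Finset.sum_sdiff hF, add_sub_cancel_right]
  refine Eq.symm ((Finset.sum_sdiff hF).symm.trans ((congrArg₂ (· + ·)
    (Finset.sum_congr rfl fun j hj => ?_) (Finset.sum_eq_zero fun j hj => ?_)).trans (add_zero _)))
  · rw [if_neg (Finset.mem_sdiff.1 hj).2, sub_zero]
  · rw [if_pos hj, sub_self, ← tmul_apply, map_zero]

/-- Each product contracts to `vⱼ⟨e, e⟩⟨vⱼ, ·⟩`, so `he` is all that is needed of `e`, and the sum
over `F` is the projection. -/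
theorem sum_left_mul_right {e : H} (he : ∀ v : H, ((‖e‖ : ℂ) ^ 2) • v = v)
    (F : Finset (basisIndex H)) (a : A) :
    ∑ j ∈ F, L.left e (stdBasis H j) * L.right e (stdBasis H j) (L.res a) =
      L.ext (map (L1.lmul (cutoff H F)) (L.res a)) := by
  have h : ∀ j, L1.op (L1.rankOne (stdBasis H j) e) *
      InnerProductSpace.rankOne ℂ e (stdBasis H j) =
      InnerProductSpace.rankOne ℂ (stdBasis H j) (stdBasis H j) := by
    intro j
    rw [L1.op_rankOne]
    refine (InnerProductSpace.rankOne_comp_rankOne _ _ _ _).trans ?_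
    rw [inner_self_eq_norm_sq_to_K]
    refine ContinuousLinearMap.ext fun z => ?_
    exact he _
  have h2 : map (L1.lmul (cutoff H F)) (L.res a) = ∑ j ∈ F,
      map (L1.lmul (InnerProductSpace.rankOne ℂ (stdBasis H j) (stdBasis H j))) (L.res a) := by
    refine Subtype.ext (funext fun k => ?_)
    rw [map_apply, cutoff, map_sum, sum_apply, AddSubmonoidClass.coe_finsetSum, Finset.sum_apply]
    rfl
  rw [h2, map_sum]
  refine Finset.sum_congr rfl fun j _ => ?_
  rw [left, right, LinearMap.comp_apply, L.single_mul_ext_res, h]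

theorem right_mul (e v : H) (a b : A) :
    L.right e v (L.res (a * b)) = L.right e v (L.res a) * b :=
  L.ext_res_mul _ a b

end LocalPatch

/-- Phrased so as to include the zero space, which has no unit vector and where `e = 0` works. -/
theorem exists_norm_sq_smul_eq (H : Type v) [NormedAddCommGroup H] [InnerProductSpace ℂ H] :
    ∃ e : H, ‖e‖ ≤ 1 ∧ ∀ v : H, ((‖e‖ : ℂ) ^ 2) • v = v := by
  cases subsingleton_or_nontrivial H
  · exact ⟨0, by simp, fun v => Subsingleton.elim _ _⟩
  · obtain ⟨e, he⟩ := exists_norm_eq H zero_le_one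
    exact ⟨e, he.le, fun v => by simp [he]⟩

variable [IsScalarTower ℂ A A] [SMulCommClass ℂ A A] [PolynormableSpace ℂ A] [ContinuousMul A]

open RapidlyDecreasing in
/-- An algebra which is a finite sum of localizations is topologically `H`-unital. -/
theorem topologicallyHUnital_of_localPatch {ι : Type*} [Fintype ι]
    (L : ι → LocalPatch w k₀ H A) (hL : ∀ a, ∑ i, (L i).ext ((L i).res a) = a) :
    TopologicallyHUnital A := by
  classical
  obtain ⟨e, he, hee⟩ := exists_norm_sq_smul_eq H
  let x : ι × basisIndex H → A := fun z => (L z.1).left e (stdBasis H z.2)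
  let y : ι × basisIndex H → A →ₗ[ℂ] A := fun z =>
    (L z.1).right e (stdBasis H z.2) ∘ₗ (L z.1).res
  -- The limit is over finite sets of basis vectors, with the same set used in every patch.
  let s : Finset (basisIndex H) → Finset (ι × basisIndex H) := fun F => Finset.univ ×ˢ F
  have hsplit : ∀ F a, splitting x y (s F) a =
      ∑ i, (L i).splitting e F ((L i).res a) := fun F a => Finset.sum_product _ _ _
  refine topologicallyHUnital_of_splitting s x y (fun z a b => (L z.1).right_mul _ _ a b)
    (fun p q hp hq => ?_) (fun p q hp hq a ε hε => ?_) (fun a => ?_)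
  · choose C m hC using fun i => (L i).exists_splitting_le he hp hq
    choose r hrc hr using fun i => (L i).res_bound (m i)
    refine ⟨∑ i, C i • r i, ?_, fun F a => ?_⟩
    · have : ⇑(∑ i, C i • r i) = fun a => ∑ i, (C i : ℝ) * r i a :=
        funext fun a => seminorm_sum_apply _ _ a
      rw [this]
      exact continuous_finsetSum _ fun i _ => continuous_const.mul (hrc i)
    · rw [hsplit, seminorm_sum_apply]
      refine (seminorm_sum_le (V := ProjTensor 2 A) (projSeminorm ![p, q]) _ _).trans
        (Finset.sum_le_sum fun i _ => ?_)
      exact (hC i F _).trans (mul_le_mul_of_nonneg_left (hr i a) (by positivity))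
  · choose C m hC using fun i => (L i).exists_splitting_le he hp hq
    -- By `splitting_sub`, the difference between `F ⊇ F₀` and `F₀` is controlled by the defect of
    -- `F₀` alone, so choosing `F₀` is enough.
    have h1 : Tendsto (fun F => ∑ i, (C i : ℝ) * weightedNorm (m i)
        ((L i).res a - map (L1.lmul (cutoff H F)) ((L i).res a))) atTop (𝓝 0) := by
      have := tendsto_finsetSum Finset.univ fun i (_ : i ∈ Finset.univ) =>
        (tendsto_weightedNorm_cutoff (m i) ((L i).res a)).const_mul (C i : ℝ)
      simpa using this
    obtain ⟨F₀, hF₀⟩ := (h1.eventually_lt_const hε).exists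
    refine ⟨F₀, fun F hF => lt_of_le_of_lt ?_ hF₀⟩
    rw [hsplit, hsplit, ← Finset.sum_sub_distrib]
    refine (seminorm_sum_le (V := ProjTensor 2 A) (projSeminorm ![p, q]) _ _).trans
      (Finset.sum_le_sum fun i _ => ?_)
    rw [(L i).splitting_sub e hF]
    exact hC i F _
  · have h1 : ∀ F, ∑ z ∈ s F, x z * y z a =
        ∑ i, (L i).ext (map (L1.lmul (cutoff H F)) ((L i).res a)) := by
      intro F
      rw [Finset.sum_product]
      exact Finset.sum_congr rfl fun i _ => (L i).sum_left_mul_right hee F a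
    simp only [h1]
    have hw := PolynormableSpace.withSeminorms ℂ A
    have := hw.topologicalAddGroup
    conv => rhs; rw [← hL a]
    refine tendsto_finsetSum _ fun i _ => ?_
    rw [hw.tendsto_nhds _ _]
    intro p ε hε
    obtain ⟨C, m, hC⟩ := (L i).ext_bound p.1 p.2
    have h2 := (tendsto_weightedNorm_cutoff m ((L i).res a)).const_mul (C : ℝ)
    rw [mul_zero] at h2
    filter_upwards [h2.eventually_lt_const hε] with F hF
    refine lt_of_le_of_lt ?_ hF
    change p.1 _ ≤ _
    rw [map_sub_rev, ← map_sub]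
    exact hC _

end Localization

end TwistedHKR

end

open scoped NNReal Real FourierTransform
noncomputable section

namespace TwistedHKR

/-! ### Completeness of the trace class operators -/

section Complete

variable {H : Type v} [NormedAddCommGroup H] [InnerProductSpace ℂ H] [CompleteSpace H]

theorem norm_op_le (T : L1 H) : ‖L1.op T‖ ≤ ‖T‖ := by
  rw [L1.norm_def, ← toReal_enorm]
  exact ENNReal.toReal_mono (L1.traceENorm_op_lt_top T).ne (enorm_le_traceENorm _)

theorem L1.op_sub (S T : L1 H) : L1.op (S - T) = L1.op S - L1.op T := rfl

/-- The trace norm is lower semicontinuous for the operator norm. -/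
theorem traceENorm_le_of_tendsto {ι : Type*} {l : Filter ι} [l.NeBot] {A : ι → H →L[ℂ] H}
    {B : H →L[ℂ] H} (hA : Tendsto A l (𝓝 B)) {C : ℝ≥0∞} (hC : ∀ᶠ i in l, traceENorm (A i) ≤ C) :
    traceENorm B ≤ C := by
  -- `W` is chosen for the limit `B` and kept fixed: finite partial sums are then continuous in the
  -- operator norm, and for `A i` they are at most its trace norm.
  obtain ⟨W, hW, h⟩ := exists_traceENorm_eq B
  rw [h, ENNReal.tsum_eq_iSup_sum]
  refine iSup_le fun s => ?_
  have h1 : Tendsto (fun i => ∑ j ∈ s, ‖⟪W (stdBasis H j), A i (stdBasis H j)⟫_ℂ‖ₑ) l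
      (𝓝 (∑ j ∈ s, ‖⟪W (stdBasis H j), B (stdBasis H j)⟫_ℂ‖ₑ)) := by
    refine tendsto_finsetSum _ fun j _ => ?_
    have hc : Continuous fun T : H →L[ℂ] H => ‖⟪W (stdBasis H j), T (stdBasis H j)⟫_ℂ‖ₑ := by
      fun_prop
    exact (hc.tendsto B).comp hA
  refine le_of_tendsto h1 (hC.mono fun i hi => ?_)
  exact (ENNReal.sum_le_tsum s).trans
    ((tsum_le_traceENorm (A i) W 1 hW ContinuousLinearMap.norm_id_le).trans hi)

/-- A Cauchy sequence in the trace norm converges in the operator norm. Lower semicontinuity,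
applied to the differences `T m - T k` with `k → ∞`, shows that the limit is trace class and is also
the limit in the trace norm. -/
instance : CompleteSpace (L1 H) := by
  refine Metric.complete_of_cauchySeq_tendsto fun T hT => ?_
  have h1 : CauchySeq fun m => L1.op (T m) := by
    rw [Metric.cauchySeq_iff] at hT ⊢
    intro ε hε
    obtain ⟨N, hN⟩ := hT ε hε
    refine ⟨N, fun m hm k hk => lt_of_le_of_lt ?_ (hN m hm k hk)⟩
    rw [dist_eq_norm, dist_eq_norm]
    exact norm_op_le (T m - T k)
  obtain ⟨B, hB⟩ := cauchySeq_tendsto_of_complete h1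
  have h2 : ∀ ε > 0, ∃ N, ∀ m ≥ N, traceENorm (L1.op (T m) - B) ≤ ENNReal.ofReal ε := by
    intro ε hε
    obtain ⟨N, hN⟩ := Metric.cauchySeq_iff.1 hT ε hε
    refine ⟨N, fun m hm => traceENorm_le_of_tendsto (l := atTop)
      (A := fun k => L1.op (T m) - L1.op (T k)) (tendsto_const_nhds.sub hB) ?_⟩
    filter_upwards [eventually_ge_atTop N] with k hk
    have := (hN m hm k hk).le
    rw [dist_eq_norm, L1.norm_def, L1.op_sub] at this
    exact (ENNReal.le_ofReal_iff_toReal_le (L1.traceENorm_op_lt_top (T m - T k)).ne hε.le).2 this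
  have hBfin : traceENorm B < ⊤ := by
    obtain ⟨N, hN⟩ := h2 1 one_pos
    have e : B = L1.op (T N) + (-1 : ℂ) • (L1.op (T N) - B) := by
      rw [neg_one_smul]
      abel
    rw [e]
    refine (traceENorm_add_le _ _).trans_lt (ENNReal.add_lt_top.2 ⟨L1.traceENorm_op_lt_top _, ?_⟩)
    rw [traceENorm_smul]
    exact ENNReal.mul_lt_top (by simp) ((hN N le_rfl).trans_lt ENNReal.ofReal_lt_top)
  refine ⟨L1.mk B hBfin, Metric.tendsto_atTop'.2 fun ε hε => ?_⟩
  obtain ⟨N, hN⟩ := h2 (ε / 2) (half_pos hε)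
  refine ⟨N, fun m hm => ?_⟩
  rw [dist_eq_norm, L1.norm_def, L1.op_sub, L1.op_mk]
  refine lt_of_le_of_lt (ENNReal.toReal_le_of_le_ofReal (half_pos hε).le (hN m hm.le)) ?_
  exact half_lt_self hε

end Complete

/-! ### Fourier series of smooth functions with support in a cube -/

section Fourier

variable {n : ℕ}

/-- An element of `ℤⁿ`, as a point of the Euclidean space. -/
def freq (k : Fin n → ℤ) : EuclideanSpace ℝ (Fin n) := WithLp.toLp 2 fun i => (k i : ℝ)

/-- The weight `1 + |k|` on `ℤⁿ`. -/
def freqWeight (k : Fin n → ℤ) : ℝ≥0 := 1 + ‖freq k‖₊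

theorem freqWeight_coe (k : Fin n → ℤ) : (freqWeight k : ℝ) = 1 + ‖freq k‖ := by
  simp [freqWeight]

theorem freqWeight_pos (k : Fin n → ℤ) : 0 < (freqWeight k : ℝ) := by
  rw [freqWeight_coe]
  positivity

/-- The character `y ↦ exp (2 π i ⟨k, y⟩)`. -/
def wave (k : Fin n → ℤ) (y : EuclideanSpace ℝ (Fin n)) : ℂ :=
  Complex.exp (2 * π * Complex.I * (⟪freq k, y⟫_ℝ : ℝ))

theorem norm_wave (k : Fin n → ℤ) (y : EuclideanSpace ℝ (Fin n)) : ‖wave k y‖ = 1 := by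
  have : (2 * π * Complex.I * (⟪freq k, y⟫_ℝ : ℝ) : ℂ) =
      ((2 * π * ⟪freq k, y⟫_ℝ : ℝ) : ℂ) * Complex.I := by
    push_cast
    ring
  rw [wave, this, Complex.norm_exp_ofReal_mul_I]

theorem wave_zero (y : EuclideanSpace ℝ (Fin n)) : wave 0 y = 1 := by
  have : freq (0 : Fin n → ℤ) = 0 := by
    ext i
    simp [freq]
  simp [wave, this]

/-- The frequencies form a lattice, over which inverse powers of the norm are summable for exponents
above the rank. -/
theorem summable_freqWeight : ∃ N : ℕ,
    Summable fun k : Fin n → ℤ => ((freqWeight k : ℝ) ^ N)⁻¹ := by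
  set b := (EuclideanSpace.basisFun (Fin n) ℝ).toBasis
  set L := Submodule.span ℤ (Set.range b)
  have hmem : ∀ k : Fin n → ℤ, freq k ∈ L := by
    intro k
    have : freq k = ∑ i, k i • b i := by
      ext j
      simp [freq, b, Finset.sum_apply, Pi.single_apply]
    rw [this]
    exact Submodule.sum_mem _ fun i _ => Submodule.smul_mem _ _ (Submodule.subset_span ⟨i, rfl⟩)
  have hinj : Function.Injective fun k : Fin n → ℤ => (⟨freq k, hmem k⟩ : L) := by
    intro k l hkl
    have h1 : freq k = freq l := congrArg Subtype.val hkl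
    funext i
    have h2 := congrArg (fun v : EuclideanSpace ℝ (Fin n) => v i) h1
    simpa [freq] using h2
  have hs := (ZLattice.summable_norm_pow_inv (L := L) (Module.finrank ℤ L + 1)
    (Nat.lt_succ_self _)).comp_injective hinj
  refine ⟨Module.finrank ℤ L + 1, Summable.of_norm_bounded_eventually hs ?_⟩
  rw [Filter.eventually_cofinite]
  -- At the frequency `0` the lattice term is `0⁻¹ = 0`, so the comparison holds only away from this
  -- one point.
  refine (Set.finite_singleton (0 : Fin n → ℤ)).subset fun k hk => ?_
  by_contra hk0
  refine hk ?_
  have hne : freq k ≠ 0 := by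
    intro h
    refine hk0 (funext fun i => ?_)
    have h2 := congrArg (fun v : EuclideanSpace ℝ (Fin n) => v i) h
    simpa [freq] using h2
  have hpos : 0 < ‖freq k‖ := norm_pos_iff.2 hne
  rw [Real.norm_of_nonneg (by have := freqWeight_pos k; positivity), freqWeight_coe]
  simp only [Function.comp_apply, Submodule.coe_norm, inv_pow]
  gcongr
  simp

variable {B : Type*} [NormedAddCommGroup B] [NormedSpace ℂ B]

theorem iteratedDeriv_cexp_smul (a : ℂ) (T : B) (j : ℕ) :
    iteratedDeriv j (fun t : ℝ => Complex.exp (a * t) • T) =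
      fun t : ℝ => Complex.exp (a * t) • (a ^ j • T) := by
  induction j with
  | zero => simp
  | succ j ih =>
    rw [iteratedDeriv_succ, ih]
    funext t
    have h1 : HasDerivAt (fun t : ℝ => Complex.exp (a * t)) (Complex.exp (a * t) * a) t := by
      have := ((Complex.ofRealCLM.hasDerivAt (x := t)).const_mul a).cexp
      simpa using this
    rw [(h1.smul_const (a ^ j • T)).deriv, smul_smul, smul_smul]
    congr 1
    ring

theorem contDiff_wave_smul (k : Fin n → ℤ) (T : B) : ContDiff ℝ ∞ fun y => wave k y • T := by
  unfold wave
  have h : ContDiff ℝ ∞ fun y : EuclideanSpace ℝ (Fin n) =>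
      (2 * π * Complex.I * ((⟪freq k, y⟫_ℝ : ℝ) : ℂ)) :=
    contDiff_const.mul (Complex.ofRealCLM.contDiff.comp (contDiff_const.inner ℝ contDiff_id))
  exact h.cexp.smul contDiff_const

/-- The wave factors through the linear functional `⟨k, ·⟩`, of norm `|k|`, so its derivatives are
those of an exponential in one real variable. -/
theorem norm_iteratedFDeriv_wave_le (k : Fin n → ℤ) (T : B) (j : ℕ)
    (y : EuclideanSpace ℝ (Fin n)) :
    ‖iteratedFDeriv ℝ j (fun y => wave k y • T) y‖ ≤
      (2 * π) ^ j * ((freqWeight k : ℝ) ^ j * ‖T‖) := by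
  set a : ℂ := 2 * π * Complex.I
  have ha : ‖a‖ = 2 * π := by
    simp [a, abs_of_pos Real.pi_pos]
  have hg : ContDiff ℝ ∞ fun t : ℝ => Complex.exp (a * t) • T := by
    have : ContDiff ℝ ∞ fun t : ℝ => a * (t : ℂ) := contDiff_const.mul Complex.ofRealCLM.contDiff
    exact this.cexp.smul contDiff_const
  have h1 : (fun y => wave k y • T) =
      (fun t : ℝ => Complex.exp (a * t) • T) ∘ (innerSL ℝ (freq k)) := rfl
  rw [h1, ContinuousLinearMap.iteratedFDeriv_comp_right _ hg _ (i := j) (by exact_mod_cast le_top)]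
  refine (ContinuousMultilinearMap.norm_compContinuousLinearMap_le _ _).trans ?_
  rw [norm_iteratedFDeriv_eq_norm_iteratedDeriv, iteratedDeriv_cexp_smul, Finset.prod_const,
    Finset.card_univ, Fintype.card_fin, innerSL_apply_norm, norm_smul, norm_smul, norm_pow, ha]
  have h2 : ‖Complex.exp (a * ((innerSL ℝ (freq k)) y : ℝ))‖ = 1 := norm_wave k y
  rw [h2, one_mul, mul_assoc, mul_comm ‖T‖]
  gcongr
  rw [freqWeight_coe]
  simp

variable [CompleteSpace B]

open RapidlyDecreasing

/-- The sum of a Fourier series. -/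
def fourierSum (c : RapidlyDecreasing (freqWeight (n := n)) B) (y : EuclideanSpace ℝ (Fin n)) : B :=
  ∑' k, wave k y • c.1 k

theorem summable_wave (c : RapidlyDecreasing (freqWeight (n := n)) B)
    (y : EuclideanSpace ℝ (Fin n)) : Summable fun k => wave k y • c.1 k :=
  Summable.of_norm (by simpa [norm_smul, norm_wave] using c.2 0)

theorem fourierSum_add (c d : RapidlyDecreasing (freqWeight (n := n)) B) :
    fourierSum (c + d) = fourierSum c + fourierSum d := by
  funext y
  simp only [fourierSum, Pi.add_apply]
  rw [← (summable_wave c y).tsum_add (summable_wave d y)]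
  refine tsum_congr fun k => ?_
  rw [← smul_add]
  rfl

theorem fourierSum_smul (z : ℂ) (c : RapidlyDecreasing (freqWeight (n := n)) B) :
    fourierSum (z • c) = z • fourierSum c := by
  funext y
  simp only [fourierSum, Pi.smul_apply]
  rw [← (summable_wave c y).tsum_const_smul]
  refine tsum_congr fun k => ?_
  rw [smul_comm]
  rfl

theorem fourierSum_map (L : B →L[ℂ] B) (c : RapidlyDecreasing (freqWeight (n := n)) B)
    (y : EuclideanSpace ℝ (Fin n)) : fourierSum (map L c) y = L (fourierSum c y) := by
  rw [fourierSum, fourierSum, L.map_tsum (summable_wave c y)]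
  exact tsum_congr fun k => (L.map_smul _ _).symm

theorem fourierSum_single_zero (T : B) (y : EuclideanSpace ℝ (Fin n)) :
    fourierSum (single 0 T) y = T := by
  rw [fourierSum, tsum_eq_single 0 fun k hk => by rw [single_apply_ne hk, smul_zero],
    single_apply_same, wave_zero, one_smul]

theorem summable_deriv_bound (c : RapidlyDecreasing (freqWeight (n := n)) B) (j : ℕ) :
    Summable fun k => (2 * π) ^ j * ((freqWeight k : ℝ) ^ j * ‖c.1 k‖) := (c.2 j).mul_left _

theorem contDiff_fourierSum (c : RapidlyDecreasing (freqWeight (n := n)) B) :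
    ContDiff ℝ ∞ (fourierSum c) :=
  contDiff_tsum (fun k => contDiff_wave_smul k (c.1 k)) (fun j _ => summable_deriv_bound c j)
    fun j k y _ => norm_iteratedFDeriv_wave_le k (c.1 k) j y

theorem norm_iteratedFDeriv_fourierSum_le (c : RapidlyDecreasing (freqWeight (n := n)) B) (j : ℕ)
    (y : EuclideanSpace ℝ (Fin n)) :
    ‖iteratedFDeriv ℝ j (fourierSum c) y‖ ≤ (2 * π) ^ j * weightedNorm j c := by
  have h := iteratedFDeriv_tsum_apply (𝕜 := ℝ) (N := ⊤) (fun k => contDiff_wave_smul k (c.1 k))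
    (fun j _ => summable_deriv_bound c j)
    (fun j k y _ => norm_iteratedFDeriv_wave_le k (c.1 k) j y) (k := j) le_top y
  change ‖iteratedFDeriv ℝ j (fun y => ∑' k, wave k y • c.1 k) y‖ ≤ _
  rw [h, weightedNorm, ← tsum_mul_left]
  exact tsum_of_norm_bounded (summable_deriv_bound c j).hasSum
    fun k => norm_iteratedFDeriv_wave_le k (c.1 k) j y

open MeasureTheory

/-- Powers of `v` become derivatives of `G`, whose integrals cost at most the volume of `K`. It is
essential that `C` depends on `K` and `M` but not on `G`: the analysis map of a patch is continuous
for this reason. -/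
theorem exists_pow_mul_norm_fourier_le {K : Set (EuclideanSpace ℝ (Fin n))} (hK : IsCompact K)
    (M : ℕ) : ∃ C : ℝ, 0 ≤ C ∧ ∀ (G : EuclideanSpace ℝ (Fin n) → B), ContDiff ℝ ∞ G →
      tsupport G ⊆ K → ∀ D, (∀ j ≤ M, ∀ y, ‖iteratedFDeriv ℝ j G y‖ ≤ D) →
      ∀ v, (1 + ‖v‖) ^ M * ‖𝓕 G v‖ ≤ C * D := by
  set V := (volume : Measure (EuclideanSpace ℝ (Fin n))).real K with hV
  have hVfin : volume K < ⊤ := hK.measure_lt_top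
  -- The term `V` comes from order zero, `2 ^ M * ((M + 1) * V)` from order `M`, and the outer `2 ^
  -- M` from `(1 + |v|)^M ≤ 2^M (1 + |v|^M)`.
  refine ⟨2 ^ M * (V + 2 ^ M * ((M + 1) * V)), by positivity, fun G hG hGK D hD v => ?_⟩
  have hcs : HasCompactSupport G := hK.of_isClosed_subset (isClosed_tsupport G) hGK
  have hD0 : 0 ≤ D := (norm_nonneg _).trans (hD 0 (Nat.zero_le _) 0)
  have hcont : ∀ j : ℕ, Continuous fun y => iteratedFDeriv ℝ j G y := fun j =>
    hG.continuous_iteratedFDeriv (m := j) (by exact_mod_cast le_top)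
  have hint : ∀ i j : ℕ, Integrable fun y => ‖y‖ ^ i * ‖iteratedFDeriv ℝ j G y‖ := by
    intro i j
    refine Continuous.integrable_of_hasCompactSupport ?_ ?_
    · exact (continuous_norm.pow i).mul (hcont j).norm
    · exact ((hcs.iteratedFDeriv j).norm).mul_left
  have hle : ∀ j ≤ M, ∫ y, ‖iteratedFDeriv ℝ j G y‖ ≤ V * D := by
    intro j hj
    have h1 : ∫ y, ‖iteratedFDeriv ℝ j G y‖ = ∫ y in K, ‖iteratedFDeriv ℝ j G y‖ := by
      refine (setIntegral_eq_integral_of_forall_compl_eq_zero fun y hy => ?_).symm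
      rw [norm_eq_zero]
      by_contra hne
      exact hy (hGK (support_iteratedFDeriv_subset (𝕜 := ℝ) j hne))
    rw [h1]
    have h2 := norm_setIntegral_le_of_norm_le_const (f := fun y => ‖iteratedFDeriv ℝ j G y‖)
      (C := D) hVfin fun y _ => by
        rw [norm_norm]
        exact hD j hj y
    rw [Real.norm_of_nonneg (integral_nonneg fun _ => norm_nonneg _)] at h2
    rw [mul_comm]
    exact h2
  have hpow : ∀ j ≤ M, ‖v‖ ^ j * ‖𝓕 G v‖ ≤ 2 ^ j * ((j + 1) * (V * D)) := by
    intro j hj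
    have h := Real.pow_mul_norm_iteratedFDeriv_fourier_le (K := ⊤) (N := ⊤) hG
      (fun i j _ _ => hint i j) (k := 0) (n := j) le_top le_top v
    rw [norm_iteratedFDeriv_zero] at h
    refine h.trans ?_
    simp only [pow_zero, one_mul, Nat.cast_zero, mul_zero, zero_add, Finset.range_one,
      Finset.singleton_product, Finset.sum_map, Function.Embedding.coeFn_mk]
    refine mul_le_mul_of_nonneg_left ?_ (by positivity)
    refine (Finset.sum_le_card_nsmul _ _ (V * D) fun l hl => ?_).trans ?_
    · exact hle l ((Nat.lt_succ_iff.1 (Finset.mem_range.1 hl)).trans hj)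
    · rw [Finset.card_range, nsmul_eq_mul]
      push_cast
      rfl
  have h0 := hpow 0 (Nat.zero_le _)
  have hM := hpow M le_rfl
  simp only [pow_zero, one_mul, Nat.cast_zero, zero_add] at h0
  have hbin : (1 + ‖v‖) ^ M ≤ 2 ^ M * (1 + ‖v‖ ^ M) := by
    have h1 := add_pow_le zero_le_one (norm_nonneg v) M
    rw [one_pow] at h1
    refine h1.trans ?_
    gcongr
    · norm_num
    · omega
  calc (1 + ‖v‖) ^ M * ‖𝓕 G v‖ ≤ 2 ^ M * (1 + ‖v‖ ^ M) * ‖𝓕 G v‖ := by gcongr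
    _ = 2 ^ M * (‖𝓕 G v‖ + ‖v‖ ^ M * ‖𝓕 G v‖) := by ring
    _ ≤ 2 ^ M * (V * D + 2 ^ M * ((M + 1) * (V * D))) := by gcongr
    _ = _ := by ring

/-- Decay of order `m + N` is asked of the transform: `m` powers for the weight, and `N` for
summability over the lattice. -/
theorem exists_weighted_fourier_le {K : Set (EuclideanSpace ℝ (Fin n))} (hK : IsCompact K)
    (m : ℕ) : ∃ (M : ℕ) (C : ℝ), 0 ≤ C ∧ ∀ (G : EuclideanSpace ℝ (Fin n) → B), ContDiff ℝ ∞ G →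
      tsupport G ⊆ K → ∀ D, (∀ j ≤ M, ∀ y, ‖iteratedFDeriv ℝ j G y‖ ≤ D) →
      (Summable fun k => (freqWeight k : ℝ) ^ m * ‖𝓕 G (freq k)‖) ∧
      ∑' k, (freqWeight k : ℝ) ^ m * ‖𝓕 G (freq k)‖ ≤ C * D := by
  obtain ⟨N, hN⟩ := summable_freqWeight (n := n)
  obtain ⟨C, hC0, hC⟩ := exists_pow_mul_norm_fourier_le (B := B) hK (m + N)
  refine ⟨m + N, C * ∑' k : Fin n → ℤ, ((freqWeight k : ℝ) ^ N)⁻¹,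
    mul_nonneg hC0 (tsum_nonneg fun k => by positivity), fun G hG hGK D hD => ?_⟩
  have hk : ∀ k, (freqWeight k : ℝ) ^ m * ‖𝓕 G (freq k)‖ ≤
      C * D * ((freqWeight k : ℝ) ^ N)⁻¹ := by
    intro k
    rw [← div_eq_mul_inv, le_div_iff₀ (pow_pos (freqWeight_pos k) N)]
    refine le_trans (le_of_eq ?_) (hC G hG hGK D hD (freq k))
    rw [← freqWeight_coe]
    ring
  have hs : Summable fun k : Fin n → ℤ => (freqWeight k : ℝ) ^ m * ‖𝓕 G (freq k)‖ :=
    Summable.of_nonneg_of_le (fun k => by positivity) hk (hN.mul_left _)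
  refine ⟨hs, ?_⟩
  refine (hs.tsum_le_tsum hk (hN.mul_left _)).trans_eq ?_
  rw [tsum_mul_left]
  ring

/-- The Fourier coefficients of a smooth function with compact support. -/
def fourierCoeffs (G : EuclideanSpace ℝ (Fin n) → B) (hG : ContDiff ℝ ∞ G)
    (hcs : HasCompactSupport G) : RapidlyDecreasing (freqWeight (n := n)) B :=
  ⟨fun k => 𝓕 G (freq k), fun m => by
    obtain ⟨M, C, -, h⟩ := exists_weighted_fourier_le (B := B) hcs.isCompact m
    have hcont : ∀ j : ℕ, Continuous fun y => iteratedFDeriv ℝ j G y := fun j =>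
      hG.continuous_iteratedFDeriv (m := j) (by exact_mod_cast le_top)
    choose D hD using fun j => (hcont j).bounded_above_of_compact_support (hcs.iteratedFDeriv j)
    refine (h G hG subset_rfl (∑ j ∈ Finset.range (M + 1), D j) fun j hj y => ?_).1
    refine (hD j y).trans (Finset.single_le_sum (f := D)
      (fun l _ => (norm_nonneg _).trans (hD l 0)) ?_)
    exact Finset.mem_range.2 (Nat.lt_succ_iff.2 hj)⟩

end Fourier

end TwistedHKR

end

open scoped NNReal Real FourierTransform
noncomputable section

namespace TwistedHKR

/-! ### Fourier inversion on a cube -/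

/-- The image of the compact set is closed, so an extension by zero gains no support at the edge of
the chart. Used for the cube in the torus and for charts of `X`. -/
theorem tsupport_subset_image {Y T : Type*} [TopologicalSpace Y] [TopologicalSpace T] [T2Space T]
    {E : Type*} [Zero E] (e : OpenPartialHomeomorph Y T) {K : Set Y} (hK : IsCompact K)
    (hKs : K ⊆ e.source) {G : T → E} (h0 : ∀ t, (t ∈ e.target → e.symm t ∉ K) → G t = 0) :
    tsupport G ⊆ e '' K := by
  refine closure_minimal (fun t ht => ?_)
    (hK.image_of_continuousOn (e.continuousOn.mono hKs)).isClosed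
  by_contra hn
  exact ht (h0 t fun h1 h2 => hn ⟨_, h2, e.right_inv h1⟩)

section Inversion

open MeasureTheory UnitAddTorus

variable {n : ℕ}

/-- The open unit cube with lowest corner `a`. -/
def cube (a : Fin n → ℝ) : Set (EuclideanSpace ℝ (Fin n)) := {y | ∀ i, y i ∈ Ioo (a i) (a i + 1)}

theorem isOpen_cube (a : Fin n → ℝ) : IsOpen (cube a) := by
  have : cube a = ⋂ i, (fun y : EuclideanSpace ℝ (Fin n) => y i) ⁻¹' Ioo (a i) (a i + 1) := by
    ext y
    simp [cube]
  rw [this]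
  exact isOpen_iInter_of_finite fun i => isOpen_Ioo.preimage (by fun_prop)

/-- The projection of an open unit cube to the torus. -/
def cubeChart (a : Fin n → ℝ) : OpenPartialHomeomorph (Fin n → ℝ) (UnitAddTorus (Fin n)) :=
  OpenPartialHomeomorph.pi fun i => AddCircle.openPartialHomeomorphCoe 1 (a i)

theorem mem_cubeChart_source {a x : Fin n → ℝ} :
    x ∈ (cubeChart a).source ↔ ∀ i, x i ∈ Ioo (a i) (a i + 1) := by
  simp [cubeChart]

theorem mem_cubeChart_target {a : Fin n → ℝ} {t : UnitAddTorus (Fin n)} :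
    t ∈ (cubeChart a).target ↔ ∀ i, t i ≠ (a i : UnitAddCircle) := by
  simp [cubeChart]

theorem cubeChart_apply (a x : Fin n → ℝ) : cubeChart a x = fun i => (x i : UnitAddCircle) := rfl

theorem mFourier_coe (k : Fin n → ℤ) (x : Fin n → ℝ) :
    mFourier k (fun i => (x i : UnitAddCircle)) = wave k (WithLp.toLp 2 x) := by
  change ∏ i, fourier (k i) (x i : UnitAddCircle) = _
  simp only [fourier_coe_apply]
  rw [← Complex.exp_sum, wave]
  congr 1
  simp only [PiLp.inner_apply, freq, RCLike.inner_apply, conj_trivial]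
  push_cast
  rw [Finset.mul_sum]
  refine Finset.sum_congr rfl fun i _ => ?_
  ring

theorem wave_neg (k : Fin n → ℤ) (y : EuclideanSpace ℝ (Fin n)) :
    wave (-k) y = Complex.exp (((-2 * π * ⟪y, freq k⟫_ℝ : ℝ) : ℂ) * Complex.I) := by
  have : freq (-k) = -freq k := by
    ext i
    simp [freq]
  rw [wave, this, inner_neg_left, real_inner_comm]
  congr 1
  push_cast
  ring

/-- A function with compact support in an open cube, as a function on the torus. -/
def periodize (a : Fin n → ℝ) (g : EuclideanSpace ℝ (Fin n) → ℂ) (t : UnitAddTorus (Fin n)) : ℂ :=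
  (cubeChart a).target.indicator (fun t => g (WithLp.toLp 2 ((cubeChart a).symm t))) t

/-- The half-open cube is the fundamental domain for integrals over the torus. On the added faces,
`x i = a i + 1` projects to a point which the chart omits, and both sides are `0`. -/
theorem periodize_coe {a : Fin n → ℝ} {g : EuclideanSpace ℝ (Fin n) → ℂ}
    (h0 : ∀ y ∉ cube a, g y = 0) {x : Fin n → ℝ} (hx : ∀ i, x i ∈ Ioc (a i) (a i + 1)) :
    periodize a g (fun i => (x i : UnitAddCircle)) = g (WithLp.toLp 2 x) := by
  by_cases h : x ∈ (cubeChart a).source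
  · rw [← cubeChart_apply a, periodize, indicator_of_mem ((cubeChart a).map_source h),
      (cubeChart a).left_inv h]
  · have h1 : WithLp.toLp 2 x ∉ cube a := fun hc => h (mem_cubeChart_source.2 hc)
    rw [h0 _ h1, periodize, indicator_of_notMem]
    rw [mem_cubeChart_source, not_forall] at h
    obtain ⟨i, hi⟩ := h
    have h2 : x i = a i + 1 := by
      by_contra hne
      exact hi ⟨(hx i).1, lt_of_le_of_ne (hx i).2 hne⟩
    rw [mem_cubeChart_target]
    refine fun hc => hc i ?_
    rw [h2]
    exact AddCircle.coe_add_period 1 (a i)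

/-- Continuity has to be checked only on the topological support, which lies in the image of `K` and
so well inside the chart. -/
theorem continuous_periodize {a : Fin n → ℝ} {g : EuclideanSpace ℝ (Fin n) → ℂ}
    (hg : Continuous g) {K : Set (EuclideanSpace ℝ (Fin n))} (hK : IsCompact K) (hKs : K ⊆ cube a)
    (h0 : ∀ y ∉ K, g y = 0) : Continuous (periodize a g) := by
  have hK' : IsCompact (WithLp.ofLp '' K) := hK.image (PiLp.continuous_ofLp 2 _)
  have hsub : WithLp.ofLp '' K ⊆ (cubeChart a).source := by
    rintro _ ⟨y, hy, rfl⟩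
    exact mem_cubeChart_source.2 (hKs hy)
  refine continuous_of_tsupport fun t ht => ?_
  have h1 := tsupport_subset_image (cubeChart a) hK' hsub (G := periodize a g) (fun t h => by
    by_cases hT : t ∈ (cubeChart a).target
    · rw [periodize, indicator_of_mem hT]
      exact h0 _ fun hc => h hT ⟨_, hc, rfl⟩
    · rw [periodize, indicator_of_notMem hT]) ht
  obtain ⟨x, hx, rfl⟩ := h1
  have hT := (cubeChart a).map_source (hsub hx)
  have h2 : ContinuousAt (fun t => g (WithLp.toLp 2 ((cubeChart a).symm t))) (cubeChart a x) :=
    (hg.comp (PiLp.continuous_toLp 2 _)).continuousAt.comp ((cubeChart a).continuousAt_symm hT)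
  refine h2.congr ?_
  filter_upwards [(cubeChart a).open_target.mem_nhds hT] with t ht
  rw [periodize, indicator_of_mem ht]

/-- As `g` vanishes off the cube, the integral over a fundamental domain is an integral over the
whole space. Hence decay of the Fourier transform is decay of the coefficients. -/
theorem mFourierCoeff_periodize {a : Fin n → ℝ} {g : EuclideanSpace ℝ (Fin n) → ℂ}
    (h0 : ∀ y ∉ cube a, g y = 0) (k : Fin n → ℤ) :
    mFourierCoeff (periodize a g) k = 𝓕 g (freq k) := by
  rw [mFourierCoeff_eq_integral _ _ a, Real.fourier_eq',
    ← (PiLp.volume_preserving_toLp (Fin n)).integral_comp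
      (MeasurableEquiv.toLp 2 (Fin n → ℝ)).measurableEmbedding]
  have hm : MeasurableSet {x : Fin n → ℝ | ∀ i, x i ∈ Ioc (a i) (a i + 1)} :=
    MeasurableSet.univ_pi' fun i => measurableSet_Ioc
  rw [setIntegral_congr_fun (g := fun x => wave (-k) (WithLp.toLp 2 x) • g (WithLp.toLp 2 x)) hm
    fun x hx => by
      rw [mFourier_coe, periodize_coe h0 hx]]
  rw [setIntegral_eq_integral_of_forall_compl_eq_zero]
  · refine integral_congr_ae (Eventually.of_forall fun x => ?_)
    change _ = _ • _
    rw [← wave_neg]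
  · intro x hx
    rw [h0, smul_zero]
    exact fun hc => hx fun i => Ioo_subset_Ioc_self (hc i)

theorem hasSum_wave_smul_fourier {a : Fin n → ℝ} {g : EuclideanSpace ℝ (Fin n) → ℂ}
    (hg : Continuous g) {K : Set (EuclideanSpace ℝ (Fin n))} (hK : IsCompact K) (hKs : K ⊆ cube a)
    (h0 : ∀ y ∉ K, g y = 0) (hs : Summable fun k => 𝓕 g (freq k))
    {y : EuclideanSpace ℝ (Fin n)} (hy : y ∈ cube a) :
    HasSum (fun k => wave k y • 𝓕 g (freq k)) (g y) := by
  have h0' : ∀ y ∉ cube a, g y = 0 := fun y hy => h0 y fun h => hy (hKs h)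
  let F : C(UnitAddTorus (Fin n), ℂ) := ⟨periodize a g, continuous_periodize hg hK hKs h0⟩
  have hF : ∀ k, mFourierCoeff F k = 𝓕 g (freq k) := mFourierCoeff_periodize h0'
  have h := hasSum_mFourier_series_apply_of_summable (f := F) (by simpa only [funext hF] using hs)
    fun i => (y i : UnitAddCircle)
  have h1 : F (fun i => (y i : UnitAddCircle)) = g y :=
    periodize_coe h0' fun i => Ioo_subset_Ioc_self (hy i)
  rw [h1] at h
  refine h.congr_fun fun k => ?_
  rw [hF, mFourier_coe, smul_eq_mul, smul_eq_mul, mul_comm]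

variable {B : Type*} [NormedAddCommGroup B] [NormedSpace ℂ B] [CompleteSpace B]

theorem integrable_fourier_integrand {G : EuclideanSpace ℝ (Fin n) → B} (hG : Continuous G)
    (hcs : HasCompactSupport G) (w : EuclideanSpace ℝ (Fin n)) :
    Integrable fun v => Real.fourierChar (-⟪v, w⟫_ℝ) • G v := by
  have h := (hG.integrable_of_hasCompactSupport (μ := volume) hcs)
  exact (Real.fourierIntegral_convergent_iff w).2 h

theorem fourier_clm_comp (L : B →L[ℂ] ℂ) {G : EuclideanSpace ℝ (Fin n) → B} (hG : Continuous G)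
    (hcs : HasCompactSupport G) (w : EuclideanSpace ℝ (Fin n)) :
    𝓕 (fun y => L (G y)) w = L (𝓕 G w) := by
  rw [Real.fourier_eq, Real.fourier_eq, ← L.integral_comp_comm (integrable_fourier_integrand hG hcs w)]
  refine integral_congr_ae (Eventually.of_forall fun x => ?_)
  simp only [Circle.smul_def, map_smul]

/-- Fourier inversion for smooth functions with compact support in an open unit cube. -/
theorem fourierSum_fourierCoeffs {a : Fin n → ℝ} {G : EuclideanSpace ℝ (Fin n) → B}
    (hG : ContDiff ℝ ∞ G) (hcs : HasCompactSupport G) (hs : tsupport G ⊆ cube a)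
    {y : EuclideanSpace ℝ (Fin n)} (hy : y ∈ cube a) :
    fourierSum (fourierCoeffs G hG hcs) y = G y := by
  -- Continuous functionals separate points and commute with the series and the integrals, so scalar
  -- inversion on the torus suffices.
  refine (SeparatingDual.eq_iff_forall_dual_eq (R := ℂ)).2 fun L => ?_
  rw [fourierSum, L.map_tsum (summable_wave _ y)]
  have hsum : Summable fun k => 𝓕 G (freq k) :=
    Summable.of_norm (by
      have := (fourierCoeffs G hG hcs).2 0
      simp only [pow_zero, one_mul] at this
      exact this)
  have h := hasSum_wave_smul_fourier (g := fun y => L (G y)) (L.continuous.comp hG.continuous)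
    hcs.isCompact hs (fun y hy => by rw [image_eq_zero_of_notMem_tsupport hy, map_zero])
    (by simpa only [fourier_clm_comp L hG.continuous hcs] using hsum.mapL L) hy
  rw [← h.tsum_eq]
  refine tsum_congr fun k => ?_
  rw [map_smul, fourier_clm_comp L hG.continuous hcs]
  rfl

theorem fourierCoeffs_add {G₁ G₂ : EuclideanSpace ℝ (Fin n) → B} (h₁ : ContDiff ℝ ∞ G₁)
    (h₂ : ContDiff ℝ ∞ G₂) (c₁ : HasCompactSupport G₁) (c₂ : HasCompactSupport G₂) :
    fourierCoeffs (G₁ + G₂) (h₁.add h₂) (c₁.add c₂) =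
      fourierCoeffs G₁ h₁ c₁ + fourierCoeffs G₂ h₂ c₂ := by
  refine Subtype.ext (funext fun k => ?_)
  change 𝓕 (G₁ + G₂) (freq k) = 𝓕 G₁ (freq k) + 𝓕 G₂ (freq k)
  rw [Real.fourier_eq, Real.fourier_eq, Real.fourier_eq,
    ← integral_add (integrable_fourier_integrand h₁.continuous c₁ _)
      (integrable_fourier_integrand h₂.continuous c₂ _)]
  simp only [Pi.add_apply, smul_add]

theorem fourierCoeffs_smul {G : EuclideanSpace ℝ (Fin n) → B} (z : ℂ) (h : ContDiff ℝ ∞ G)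
    (c : HasCompactSupport G) (h' : ContDiff ℝ ∞ (z • G)) (c' : HasCompactSupport (z • G)) :
    fourierCoeffs (z • G) h' c' = z • fourierCoeffs G h c := by
  refine Subtype.ext (funext fun k => ?_)
  change 𝓕 (z • G) (freq k) = z • 𝓕 G (freq k)
  rw [Real.fourier_eq, Real.fourier_eq, ← integral_smul]
  refine integral_congr_ae (Eventually.of_forall fun x => ?_)
  simp only [Circle.smul_def, Pi.smul_apply]
  rw [smul_comm]

end Inversion

end TwistedHKR

end

open scoped NNReal
noncomputable section

namespace TwistedHKR

/-! ### Derivatives of compositions -/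

section Calculus

variable {E E₂ F F' : Type*} [NormedAddCommGroup E] [NormedSpace ℝ E] [NormedAddCommGroup E₂]
  [NormedSpace ℝ E₂] [NormedAddCommGroup F] [NormedSpace ℝ F] [NormedAddCommGroup F']
  [NormedSpace ℝ F']

/-- The normalization `1 ≤ C` is there so that `C ≤ C ^ l` for `l ≥ 1`, the form required by the
bound for derivatives of a composition. -/
theorem exists_eventually_norm_iteratedFDeriv_le {f : E → F} {z₀ : E} (hf : ContDiffAt ℝ ∞ f z₀)
    (j : ℕ) : ∃ C : ℝ, 1 ≤ C ∧ ∀ᶠ z in 𝓝 z₀, ∀ l ≤ j, ‖iteratedFDeriv ℝ l f z‖ ≤ C := by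
  have h : ∀ l : ℕ, ∀ᶠ z in 𝓝 z₀, ‖iteratedFDeriv ℝ l f z‖ < ‖iteratedFDeriv ℝ l f z₀‖ + 1 :=
    fun l => (hf.continuousAt_iteratedFDeriv (k := l) (by exact_mod_cast le_top)).norm.eventually_lt
      continuousAt_const (lt_add_one _)
  refine ⟨1 + ∑ l ∈ Finset.range (j + 1), (‖iteratedFDeriv ℝ l f z₀‖ + 1),
    le_add_of_nonneg_right (Finset.sum_nonneg fun l _ => by positivity), ?_⟩
  have h' : ∀ᶠ z in 𝓝 z₀, ∀ l ∈ Finset.range (j + 1),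
      ‖iteratedFDeriv ℝ l f z‖ < ‖iteratedFDeriv ℝ l f z₀‖ + 1 :=
    (Filter.eventually_all_finset _).2 fun l _ => h l
  filter_upwards [h'] with z hz l hl
  have hl' : l ∈ Finset.range (j + 1) := Finset.mem_range.2 (Nat.lt_succ_iff.2 hl)
  refine (hz l hl').le.trans ((Finset.single_le_sum
    (f := fun l => ‖iteratedFDeriv ℝ l f z₀‖ + 1) (fun l _ => by positivity) hl').trans ?_)
  exact le_add_of_nonneg_left zero_le_one

/-- Smoothness at a point provides a neighbourhood for each finite order, not one for all orders,
hence the fixed `j`. -/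
theorem exists_isOpen_contDiffOn {f : E → F} {z₀ : E} (hf : ContDiffAt ℝ ∞ f z₀) (j : ℕ) :
    ∃ U, IsOpen U ∧ z₀ ∈ U ∧ ContDiffOn ℝ j f U := by
  have h := (hf.of_le (m := (j : ℕ∞ω)) (by exact_mod_cast le_top)).eventually
    (by exact_mod_cast WithTop.coe_ne_top)
  obtain ⟨U, hU, hUo, hz⟩ := eventually_nhds_iff.1 h
  exact ⟨U, hUo, hz, fun z hz => (hU z hz).contDiffWithinAt⟩

/-- The derivatives of `z ↦ L(z) (G (τ z))` are bounded by those of `G`. -/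
theorem exists_norm_iteratedFDeriv_clm_comp_le {L : E → F →L[ℝ] F'} {τ : E → E₂} {z₀ : E}
    (hL : ContDiffAt ℝ ∞ L z₀) (hτ : ContDiffAt ℝ ∞ τ z₀) (j : ℕ) :
    ∃ C : ℝ, 0 ≤ C ∧ ∀ᶠ z in 𝓝 z₀, ∀ G : E₂ → F, ContDiff ℝ ∞ G → ∀ D,
      (∀ l ≤ j, ∀ y, ‖iteratedFDeriv ℝ l G y‖ ≤ D) →
      ‖iteratedFDeriv ℝ j (fun z => L z (G (τ z))) z‖ ≤ C * D := by
  obtain ⟨CL, hCL, hL'⟩ := exists_eventually_norm_iteratedFDeriv_le hL j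
  obtain ⟨Cτ, hCτ, hτ'⟩ := exists_eventually_norm_iteratedFDeriv_le hτ j
  obtain ⟨U, hUo, hzU, hU⟩ := exists_isOpen_contDiffOn hL j
  obtain ⟨V, hVo, hzV, hV⟩ := exists_isOpen_contDiffOn hτ j
  refine ⟨∑ i ∈ Finset.range (j + 1), (j.choose i : ℝ) * CL * ((j - i).factorial * Cτ ^ (j - i)),
    Finset.sum_nonneg fun i _ => by positivity, ?_⟩
  have hWo := hUo.inter hVo
  -- The neighbourhood depends on `L` and `τ` only and is fixed before `G`; this uniformity is
  -- needed to treat all Fourier sums at once.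
  filter_upwards [hL', hτ', hWo.mem_nhds ⟨hzU, hzV⟩] with z h1 h2 hzW G hG D hD
  have hD0 : 0 ≤ D := (norm_nonneg _).trans (hD 0 (Nat.zero_le _) (τ z))
  have hLW : ContDiffOn ℝ j L (U ∩ V) := hU.mono inter_subset_left
  have hτW : ContDiffOn ℝ j τ (U ∩ V) := hV.mono inter_subset_right
  have hGj : ContDiff ℝ j G := hG.of_le (by exact_mod_cast le_top)
  have hcW : ContDiffOn ℝ j (G ∘ τ) (U ∩ V) := hGj.comp_contDiffOn hτW
  have key := norm_iteratedFDerivWithin_clm_apply hLW hcW hWo.uniqueDiffOn hzW (n := j) le_rfl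
  rw [iteratedFDerivWithin_of_isOpen _ hWo hzW] at key
  refine key.trans ?_
  rw [Finset.sum_mul]
  refine Finset.sum_le_sum fun i hi => ?_
  have hij : i ≤ j := Nat.lt_succ_iff.1 (Finset.mem_range.1 hi)
  have h3 : ‖iteratedFDerivWithin ℝ i L (U ∩ V) z‖ ≤ CL := by
    rw [iteratedFDerivWithin_of_isOpen _ hWo hzW]
    exact h1 i hij
  have h4 : ‖iteratedFDerivWithin ℝ (j - i) (G ∘ τ) (U ∩ V) z‖ ≤
      (j - i).factorial * D * Cτ ^ (j - i) := by
    refine norm_iteratedFDerivWithin_comp_le hGj.contDiffOn hτW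
      (by exact_mod_cast Nat.sub_le j i) uniqueDiffOn_univ hWo.uniqueDiffOn (mapsTo_univ _ _) hzW
      (fun l hl => ?_) (fun l hl1 hl2 => ?_)
    · rw [iteratedFDerivWithin_univ]
      exact hD l (hl.trans (Nat.sub_le _ _)) _
    · rw [iteratedFDerivWithin_of_isOpen _ hWo hzW]
      refine (h2 l (hl2.trans (Nat.sub_le _ _))).trans ?_
      exact le_self_pow₀ hCτ (by omega)
  calc _ ≤ (j.choose i : ℝ) * CL * ((j - i).factorial * D * Cτ ^ (j - i)) := by gcongr
    _ = _ := by ring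

end Calculus

/-! ### Sections of the associated bundle in local trivializations -/

section LocalRep

variable {n : ℕ} {X : Type u} [TopologicalSpace X] [ChartedSpace (EuclideanSpace ℝ (Fin n)) X]
  {H : Type v} [NormedAddCommGroup H] [InnerProductSpace ℂ H] [CompleteSpace H]

/-- The map `T ↦ A T A*`. -/
def conjCLM (A : H →L[ℂ] H) : L1 H →L[ℝ] L1 H :=
  (L1.lmul A ∘L L1.rmul (star A)).restrictScalars ℝ

theorem conjCLM_coe (u : unitary (H →L[ℂ] H)) (T : L1 H) : conjCLM (u : H →L[ℂ] H) T = conjU u T :=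
  L1.op_injective (by
    change L1.op (L1.lmul _ (L1.rmul _ T)) = _
    rw [L1.op_lmul, L1.op_rmul, op_conjU, mul_assoc])

/-- `(A, B) ↦ (T ↦ A T B)` is complex bilinear and bounded, but `A ↦ A*` is only real linear, hence
smoothness over the reals. The topology on the operators `A` is the norm topology. -/
theorem contDiff_conjCLM : ContDiff ℝ ∞ (conjCLM : (H →L[ℂ] H) → L1 H →L[ℝ] L1 H) := by
  have ha : ContDiff ℂ ∞ fun z : (H →L[ℂ] H) × (H →L[ℂ] H) => L1.lmul z.1 :=
    (ContinuousLinearMap.contDiff (L1.lmul (H := H))).comp contDiff_fst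
  have hb : ContDiff ℂ ∞ fun z : (H →L[ℂ] H) × (H →L[ℂ] H) => L1.rmul z.2 :=
    (ContinuousLinearMap.contDiff (L1.rmul (H := H))).comp contDiff_snd
  have h1 : ContDiff ℂ ∞ fun z : (H →L[ℂ] H) × (H →L[ℂ] H) => L1.lmul z.1 ∘L L1.rmul z.2 :=
    ha.clm_comp hb
  have h2 : ContDiff ℝ ∞ fun A : H →L[ℂ] H => (A, star A) :=
    contDiff_id.prodMk (starL' ℝ : (H →L[ℂ] H) ≃L[ℝ] (H →L[ℂ] H)).contDiff
  exact (ContinuousLinearMap.restrictScalarsL ℂ (L1 H) (L1 H) ℝ ℝ).contDiff.comp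
    ((h1.restrict_scalars ℝ).comp h2)

namespace PrincipalPUBundle

variable (P : PrincipalPUBundle.{u, v, w} n X H)

open MulOpposite

/-- The point of `P` over `x` which is `1` in the trivialization `e`. -/
def localPoint (e : Bundle.Trivialization (PU H) P.proj) {x : X} (hx : x ∈ e.baseSet) :
    {p : P.Total // P.proj p = x} :=
  ⟨e.invFun (x, 1), e.proj_symm_apply (e.mem_target.2 hx)⟩

theorem coord_eq_iff (s : ∀ x, P.Fiber x) {x : X} (p : {p : P.Total // P.proj p = x}) (T : L1 H) :
    P.coord s p = T ↔ s x = P.frame p T := by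
  obtain ⟨p, rfl⟩ := p
  rw [coord, Equiv.symm_apply_eq]

theorem frame_localRep (e : Bundle.Trivialization (PU H) P.proj) (s : ∀ x, P.Fiber x) {x : X}
    (hx : x ∈ e.baseSet) : P.frame (P.localPoint e hx) (P.localRep e s x) = s x :=
  ((P.coord_eq_iff s (P.localPoint e hx) _).1 rfl).symm

theorem localRep_eq_iff (e : Bundle.Trivialization (PU H) P.proj) (s : ∀ x, P.Fiber x) {x : X}
    (hx : x ∈ e.baseSet) (T : L1 H) :
    P.localRep e s x = T ↔ s x = P.frame (P.localPoint e hx) T :=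
  P.coord_eq_iff s (P.localPoint e hx) T

theorem frame_zero {x : X} (p : {p : P.Total // P.proj p = x}) : P.frame p 0 = 0 := by
  have := P.frame_smul p 0 0
  rwa [zero_smul, zero_smul] at this

theorem coord_eq_Ad (s : ∀ x, P.Fiber x) (p : P.Total) (g : PU H) :
    P.coord s p = Ad g (P.coord s (op g • p)) := by
  have h := P.proj_smul g p
  rw [P.coord_eq_iff s ⟨p, rfl⟩]
  rw [← ((P.coord_eq_iff s ⟨op g • p, h⟩ _).1 rfl).symm]
  exact (Quotient.sound ⟨g, rfl, rfl⟩ :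
    P.fiberMk ⟨p, rfl⟩ (Ad g (P.coord s (op g • p))) = P.fiberMk ⟨op g • p, h⟩ _).symm

/-- By equivariance, the unit points of the two trivializations over `x` differ by the transition
function, and the relation defining the fibre turns this into `Ad`. -/
theorem localRep_eq_Ad {e e' : Bundle.Trivialization (PU H) P.proj} (he' : e' ∈ P.atlas)
    (s : ∀ x, P.Fiber x) {x : X} (hx : x ∈ e.baseSet) (hx' : x ∈ e'.baseSet) :
    P.localRep e' s x = Ad (e' (e.invFun (x, 1))).2 (P.localRep e s x) := by
  set q := e.invFun (x, 1)
  set q' := e'.invFun (x, 1)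
  have hq : P.proj q = x := e.proj_symm_apply (e.mem_target.2 hx)
  have hq' : P.proj q' = x := e'.proj_symm_apply (e'.mem_target.2 hx')
  have h : q = op (e' q).2 • q' := by
    have m1 : q ∈ e'.source := e'.mem_source.2 (hq ▸ hx')
    have m2 : op (e' q).2 • q' ∈ e'.source := by
      rw [e'.mem_source, P.proj_smul, hq']
      exact hx'
    refine e'.injOn m1 m2 (Prod.ext ?_ ?_)
    · change (e' q).1 = (e' _).1
      rw [e'.coe_fst m1, e'.coe_fst m2, P.proj_smul, hq, hq']
    · change (e' q).2 = (e' _).2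
      have h1 : e' q' = (x, 1) := e'.apply_symm_apply (e'.mem_target.2 hx')
      rw [P.equivariant e' he' q' (hq' ▸ hx'), h1, one_mul]
  have := P.coord_eq_Ad s q' (e' q).2
  rw [← h] at this
  exact this

/-- The transition function lifts locally to smooth unitaries, and conjugation depends only on their
classes in `PU`. The operators `Λ x` and the neighbourhood serve all sections simultaneously. -/
theorem exists_transition {e e' : Bundle.Trivialization (PU H) P.proj} (he : e ∈ P.atlas)
    (he' : e' ∈ P.atlas) {x₀ : X} (hx : x₀ ∈ e.baseSet) (hx' : x₀ ∈ e'.baseSet) :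
    ∃ Λ : X → L1 H →L[ℝ] L1 H, ContMDiffAt (𝓡 n) 𝓘(ℝ, L1 H →L[ℝ] L1 H) ∞ Λ x₀ ∧
      ∀ᶠ x in 𝓝 x₀, ∀ s, P.localRep e' s x = Λ x (P.localRep e s x) := by
  obtain ⟨V, hVo, hxV, u, hu, hus⟩ := P.smooth_transition e he e' he' x₀ ⟨hx, hx'⟩
  have hN : V ∩ (e.baseSet ∩ e'.baseSet) ∈ 𝓝 x₀ :=
    (hVo.inter (e.open_baseSet.inter e'.open_baseSet)).mem_nhds ⟨hxV, hx, hx'⟩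
  refine ⟨fun x => conjCLM (u x : H →L[ℂ] H),
    contDiff_conjCLM.contMDiff.contMDiffAt.comp x₀ (hus.contMDiffAt hN), ?_⟩
  filter_upwards [hN] with x hxN s
  have h : (u x : PU H) = (e' (e.invFun (x, 1))).2 := hu x hxN
  rw [P.localRep_eq_Ad he' s hxN.2.1 hxN.2.2, ← h, Ad_coe, conjCLM_coe]

open Classical in
/-- The section which is represented by `f` in the trivialization `e`, and `0` outside. -/
def ofLocalRep (e : Bundle.Trivialization (PU H) P.proj) (f : X → L1 H) (x : X) : P.Fiber x :=
  if hx : x ∈ e.baseSet then P.frame (P.localPoint e hx) (f x) else 0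

theorem localRep_ofLocalRep {e : Bundle.Trivialization (PU H) P.proj} (f : X → L1 H) {x : X}
    (hx : x ∈ e.baseSet) : P.localRep e (P.ofLocalRep e f) x = f x := by
  rw [P.localRep_eq_iff e _ hx, ofLocalRep, dif_pos hx]

theorem ofLocalRep_eq_zero (e : Bundle.Trivialization (PU H) P.proj) {f : X → L1 H} {x : X}
    (h : f x = 0) : P.ofLocalRep e f x = 0 := by
  rw [ofLocalRep]
  split_ifs with hx
  · rw [h, frame_zero]
  · rfl

theorem localRep_eq_zero (e : Bundle.Trivialization (PU H) P.proj) {s : ∀ x, P.Fiber x} {x : X}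
    (hx : x ∈ e.baseSet) (h : s x = 0) : P.localRep e s x = 0 := by
  rw [P.localRep_eq_iff e _ hx, h, frame_zero]

/-- At points of the support the other representatives are `Λ x (f x)`, hence smooth; at all other
points the section vanishes nearby. -/
theorem ofLocalRep_mem_smoothSections {e : Bundle.Trivialization (PU H) P.proj} (he : e ∈ P.atlas)
    {f : X → L1 H} (hf : ContMDiff (𝓡 n) 𝓘(ℝ, L1 H) ∞ f) (hs : tsupport f ⊆ e.baseSet) :
    P.ofLocalRep e f ∈ P.smoothSections := by
  intro e' he' x hx'
  refine ContMDiffAt.contMDiffWithinAt ?_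
  by_cases hx : x ∈ tsupport f
  · obtain ⟨Λ, hΛ, h⟩ := P.exists_transition he he' (hs hx) hx'
    refine (hΛ.clm_apply hf.contMDiffAt).congr_of_eventuallyEq ?_
    filter_upwards [h, e.open_baseSet.mem_nhds (hs hx)] with y hy hye
    rw [hy, P.localRep_ofLocalRep f hye]
  · refine (contMDiffAt_const (c := (0 : L1 H))).congr_of_eventuallyEq ?_
    filter_upwards [(isClosed_tsupport f).isOpen_compl.mem_nhds hx,
      e'.open_baseSet.mem_nhds hx'] with y hy hye
    exact P.localRep_eq_zero e' hye (P.ofLocalRep_eq_zero e (image_eq_zero_of_notMem_tsupport hy))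

end PrincipalPUBundle

end LocalRep

end TwistedHKR

end

open scoped NNReal
noncomputable section

namespace TwistedHKR

/-! ### Patches: synthesis and analysis of sections -/

namespace PrincipalPUBundle

variable {n : ℕ} {X : Type u} [TopologicalSpace X] [ChartedSpace (EuclideanSpace ℝ (Fin n)) X]
  [IsManifold (𝓡 n) ∞ X]
  {H : Type v} [NormedAddCommGroup H] [InnerProductSpace ℂ H] [CompleteSpace H]

/-- A chart of `X` and a local trivialization of `P`, with a smooth function `χ` whose support lies
in the part of their common domain that is mapped to an open unit cube, and with a smooth function
`η` of the same kind which is `1` on the support of `χ`. -/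
structure Patch (P : PrincipalPUBundle.{u, v, w} n X H) where
  φ : OpenPartialHomeomorph X (EuclideanSpace ℝ (Fin n))
  hφ : φ ∈ IsManifold.maximalAtlas (𝓡 n) ∞ X
  e : Bundle.Trivialization (PU H) P.proj
  he : e ∈ P.atlas
  a : Fin n → ℝ
  χ : X → ℝ
  η : X → ℝ
  hχ : ContMDiff (𝓡 n) 𝓘(ℝ, ℝ) ∞ χ
  hη : ContMDiff (𝓡 n) 𝓘(ℝ, ℝ) ∞ η
  η_eq_one : ∀ x ∈ tsupport χ, η x = 1
  tsupport_η : tsupport η ⊆ φ.source ∩ e.baseSet ∩ φ ⁻¹' cube a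

namespace Patch

variable {P : PrincipalPUBundle.{u, v, w} n X H} (W : P.Patch)

theorem tsupport_χ_subset : tsupport W.χ ⊆ tsupport W.η := fun x hx =>
  subset_tsupport _ (by
    rw [Function.mem_support, W.η_eq_one x hx]
    exact one_ne_zero)

theorem η_mul_χ (x : X) : W.η x * W.χ x = W.χ x := by
  by_cases hx : x ∈ tsupport W.χ
  · rw [W.η_eq_one x hx, one_mul]
  · rw [image_eq_zero_of_notMem_tsupport hx, mul_zero]

/-! #### From functions on the Euclidean space to sections -/

theorem tsupport_smul_subset (G : EuclideanSpace ℝ (Fin n) → L1 H) :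
    tsupport (fun x => W.η x • G (W.φ x)) ⊆ tsupport W.η :=
  closure_mono fun x hx h => hx (by
    change W.η x • _ = _
    rw [h, zero_smul])

theorem contMDiff_smul {G : EuclideanSpace ℝ (Fin n) → L1 H} (hG : ContDiff ℝ ∞ G) :
    ContMDiff (𝓡 n) 𝓘(ℝ, L1 H) ∞ fun x => W.η x • G (W.φ x) := by
  refine contMDiff_of_tsupport fun x hx => ?_
  obtain ⟨⟨h1, -⟩, -⟩ := W.tsupport_η (W.tsupport_smul_subset G hx)
  have h2 : ContMDiffAt (𝓡 n) 𝓘(ℝ, EuclideanSpace ℝ (Fin n)) ∞ W.φ x :=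
    (contMDiffOn_of_mem_maximalAtlas (I := 𝓡 n) W.hφ).contMDiffAt (W.φ.open_source.mem_nhds h1)
  exact W.hη.contMDiffAt.smul (hG.contMDiff.contMDiffAt.comp x h2)

/-- The section which is represented by `η • (G ∘ φ)` in the trivialization `e`. -/
def glue (G : EuclideanSpace ℝ (Fin n) → L1 H) (hG : ContDiff ℝ ∞ G) : P.Sections :=
  ⟨P.ofLocalRep W.e fun x => W.η x • G (W.φ x),
    P.ofLocalRep_mem_smoothSections W.he (W.contMDiff_smul hG)
      fun _ hx => (W.tsupport_η (W.tsupport_smul_subset G hx)).1.2⟩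

theorem val_glue (G : EuclideanSpace ℝ (Fin n) → L1 H) (hG : ContDiff ℝ ∞ G) :
    (W.glue G hG).val = P.ofLocalRep W.e fun x => W.η x • G (W.φ x) := rfl

theorem glue_eq_zero (G : EuclideanSpace ℝ (Fin n) → L1 H) (hG : ContDiff ℝ ∞ G) {x : X}
    (hx : x ∉ tsupport W.η) : (W.glue G hG).val x = 0 := by
  rw [val_glue]
  refine P.ofLocalRep_eq_zero W.e ?_
  rw [image_eq_zero_of_notMem_tsupport hx, zero_smul]

theorem localRep_glue (G : EuclideanSpace ℝ (Fin n) → L1 H) (hG : ContDiff ℝ ∞ G) {x : X}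
    (hx : x ∈ W.e.baseSet) : P.localRep W.e (W.glue G hG).val x = W.η x • G (W.φ x) :=
  P.localRep_ofLocalRep _ hx

/-- Two sections are equal if they have the same representatives over the support of `η` and vanish
elsewhere. -/
theorem sections_eq {s t : P.Sections}
    (h1 : ∀ x ∈ tsupport W.η, P.localRep W.e s.val x = P.localRep W.e t.val x)
    (h2 : ∀ x ∉ tsupport W.η, s.val x = 0 ∧ t.val x = 0) : s = t := by
  refine Subtype.val_injective (funext fun x => ?_)
  by_cases hx : x ∈ tsupport W.η
  · have hb := (W.tsupport_η hx).1.2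
    have := h1 x hx
    rw [P.localRep_eq_iff W.e _ hb, P.frame_localRep] at this
    exact this
  · exact (h2 x hx).1.trans (h2 x hx).2.symm

/-- The synthesis map: a Fourier series, multiplied by `η` and viewed as a section. -/
def ext : RapidlyDecreasing (freqWeight (n := n)) (L1 H) →ₗ[ℂ] P.Sections where
  toFun c := W.glue (fourierSum c) (contDiff_fourierSum c)
  map_add' c d := W.sections_eq
    (fun x hx => by
      have hb := (W.tsupport_η hx).1.2
      rw [Sections.val_add, localRep_add, Pi.add_apply, W.localRep_glue _ _ hb,
        W.localRep_glue _ _ hb, W.localRep_glue _ _ hb, fourierSum_add, Pi.add_apply, smul_add])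
    (fun x hx => by
      rw [Sections.val_add, Pi.add_apply, W.glue_eq_zero _ _ hx, W.glue_eq_zero _ _ hx,
        W.glue_eq_zero _ _ hx, add_zero]
      exact ⟨rfl, rfl⟩)
  map_smul' z c := W.sections_eq
    (fun x hx => by
      have hb := (W.tsupport_η hx).1.2
      rw [RingHom.id_apply, Sections.val_smul, localRep_smul, Pi.smul_apply,
        W.localRep_glue _ _ hb, W.localRep_glue _ _ hb, fourierSum_smul, Pi.smul_apply, smul_comm])
    (fun x hx => by
      rw [RingHom.id_apply, Sections.val_smul, Pi.smul_apply, W.glue_eq_zero _ _ hx,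
        W.glue_eq_zero _ _ hx, smul_zero]
      exact ⟨rfl, rfl⟩)

theorem ext_eq_zero (c : RapidlyDecreasing (freqWeight (n := n)) (L1 H)) {x : X}
    (hx : x ∉ tsupport W.η) : (W.ext c).val x = 0 :=
  W.glue_eq_zero _ (contDiff_fourierSum c) hx

theorem localRep_ext (c : RapidlyDecreasing (freqWeight (n := n)) (L1 H)) {x : X}
    (hx : x ∈ tsupport W.η) :
    P.localRep W.e (W.ext c).val x = W.η x • fourierSum c (W.φ x) :=
  W.localRep_glue _ (contDiff_fourierSum c) (W.tsupport_η hx).1.2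

/-! #### From sections to functions on the Euclidean space -/

/-- A section in the chart and the trivialization, multiplied by `χ`. -/
def loc (s : P.Sections) : EuclideanSpace ℝ (Fin n) → L1 H :=
  W.φ.target.indicator fun y => W.χ (W.φ.symm y) • P.localRep W.e s.val (W.φ.symm y)

theorem loc_apply (s : P.Sections) {x : X} (hx : x ∈ W.φ.source) :
    W.loc s (W.φ x) = W.χ x • P.localRep W.e s.val x := by
  rw [loc, indicator_of_mem (W.φ.map_source hx), W.φ.left_inv hx]

theorem loc_add (s t : P.Sections) : W.loc (s + t) = W.loc s + W.loc t := by
  refine Eq.trans ?_ (indicator_add' _ _ _)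
  rw [loc]
  congr 1
  funext y
  simp only [Sections.val_add, localRep_add, Pi.add_apply, smul_add]

theorem loc_smul (z : ℂ) (s : P.Sections) : W.loc (z • s) = z • W.loc s := by
  change W.loc (z • s) = fun y => z • W.loc s y
  refine Eq.trans ?_ (indicator_const_smul _ z _)
  rw [loc]
  congr 1
  funext y
  simp only [Sections.val_smul, localRep_smul, Pi.smul_apply]
  rw [smul_comm]

variable [CompactSpace X]

/-- The index of the seminorms which are needed to bound the Fourier coefficients. -/
def seminormIndex (m : ℕ) : P.SeminormIndex where
  φ := W.φ
  hφ := W.hφ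
  e := W.e
  he := W.he
  K := tsupport W.χ
  hK := (isClosed_tsupport _).isCompact
  hK_subset _ hx := (W.tsupport_η (W.tsupport_χ_subset hx)).1
  m := m

/-- The image of the support of `χ` in the chart. -/
def locSupport : Set (EuclideanSpace ℝ (Fin n)) := W.φ '' tsupport W.χ

theorem isCompact_locSupport : IsCompact W.locSupport := (W.seminormIndex 0).isCompact_image

theorem locSupport_subset_cube : W.locSupport ⊆ cube W.a := by
  rintro _ ⟨x, hx, rfl⟩
  exact (W.tsupport_η (W.tsupport_χ_subset hx)).2

theorem tsupport_loc (s : P.Sections) : tsupport (W.loc s) ⊆ W.locSupport := by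
  refine tsupport_subset_image W.φ (isClosed_tsupport W.χ).isCompact
    (fun x hx => (W.tsupport_η (W.tsupport_χ_subset hx)).1.1) fun y hy => ?_
  by_cases h : y ∈ W.φ.target
  · rw [loc, indicator_of_mem h, image_eq_zero_of_notMem_tsupport (hy h), zero_smul]
  · rw [loc, indicator_of_notMem h]

theorem contDiffAt_χ {y : EuclideanSpace ℝ (Fin n)} (hy : y ∈ W.φ.target) :
    ContDiffAt ℝ ∞ (fun y => W.χ (W.φ.symm y)) y := by
  rw [← contMDiffAt_iff_contDiffAt]
  exact W.hχ.contMDiffAt.comp y ((contMDiffOn_symm_of_mem_maximalAtlas (I := 𝓡 n) W.hφ).contMDiffAt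
    (W.φ.open_target.mem_nhds hy))

theorem loc_eventuallyEq (s : P.Sections) {y : EuclideanSpace ℝ (Fin n)} (hy : y ∈ W.φ.target) :
    W.loc s =ᶠ[𝓝 y] fun y => W.χ (W.φ.symm y) • (W.seminormIndex 0).rep s y := by
  filter_upwards [W.φ.open_target.mem_nhds hy] with z hz
  rw [loc, indicator_of_mem hz]
  rfl

theorem contDiff_loc (s : P.Sections) : ContDiff ℝ ∞ (W.loc s) := by
  rw [← contMDiff_iff_contDiff]
  refine contMDiff_of_tsupport fun y hy => ?_
  rw [contMDiffAt_iff_contDiffAt]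
  have hd := (W.seminormIndex 0).image_subset_dom (W.tsupport_loc s hy)
  exact ((W.contDiffAt_χ hd.1).smul ((W.seminormIndex 0).contDiffAt_rep s hd)).congr_of_eventuallyEq
    (W.loc_eventuallyEq s hd.1)

theorem hasCompactSupport_loc (s : P.Sections) : HasCompactSupport (W.loc s) :=
  W.isCompact_locSupport.of_isClosed_subset (isClosed_tsupport _) (W.tsupport_loc s)

/-- The analysis map: the Fourier coefficients of a section. -/
def res : P.Sections →ₗ[ℂ] RapidlyDecreasing (freqWeight (n := n)) (L1 H) where
  toFun s := fourierCoeffs (W.loc s) (W.contDiff_loc s) (W.hasCompactSupport_loc s)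
  map_add' s t := by
    rw [← fourierCoeffs_add]
    congr 1
    exact W.loc_add s t
  map_smul' z s := by
    have h := W.loc_smul z s
    rw [RingHom.id_apply, ← fourierCoeffs_smul z (W.contDiff_loc s) (W.hasCompactSupport_loc s)
      (h ▸ W.contDiff_loc (z • s)) (h ▸ W.hasCompactSupport_loc (z • s))]
    congr 1

theorem fourierSum_res (s : P.Sections) {x : X} (hx : x ∈ tsupport W.η) :
    fourierSum (W.res s) (W.φ x) = W.χ x • P.localRep W.e s.val x := by
  obtain ⟨⟨h1, -⟩, h2⟩ := W.tsupport_η hx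
  rw [← W.loc_apply s h1]
  exact fourierSum_fourierCoeffs (W.contDiff_loc s) (W.hasCompactSupport_loc s)
    ((W.tsupport_loc s).trans W.locSupport_subset_cube) h2

/-- An operator applied to all Fourier coefficients acts pointwise on the function, so analysis
followed by synthesis leaves just a factor `χ`, the cutoff `η` being absorbed. The algebraic
properties of a patch rest on this formula. -/
theorem localRep_ext_map_res (L : L1 H →L[ℂ] L1 H) (s : P.Sections) {x : X}
    (hx : x ∈ tsupport W.η) :
    P.localRep W.e (W.ext (RapidlyDecreasing.map L (W.res s))).val x =
      W.χ x • L (P.localRep W.e s.val x) := by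
  have h : L (W.χ x • P.localRep W.e s.val x) = W.χ x • L (P.localRep W.e s.val x) :=
    (L.restrictScalars ℝ).map_smul _ _
  rw [W.localRep_ext _ hx, fourierSum_map, W.fourierSum_res s hx, h, smul_smul, W.η_mul_χ]

theorem ext_res_mul (B : H →L[ℂ] H) (s t : P.Sections) :
    W.ext (RapidlyDecreasing.map (L1.lmul B) (W.res (s * t))) =
      W.ext (RapidlyDecreasing.map (L1.lmul B) (W.res s)) * t := by
  refine W.sections_eq (fun x hx => ?_) fun x hx => ?_
  · rw [W.localRep_ext_map_res _ _ hx, Sections.val_mul, Sections.val_mul, localRep_mul,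
      localRep_mul, Pi.mul_apply, Pi.mul_apply, W.localRep_ext_map_res _ _ hx, L1.lmul_mul,
      smul_mul_assoc]
  · rw [Sections.val_mul, Pi.mul_apply, W.ext_eq_zero _ hx, W.ext_eq_zero _ hx, zero_mul]
    exact ⟨rfl, rfl⟩

/-- The wave of frequency `0` is constant, so `single 0 S` yields the section `η S`, and `η χ = χ`.
-/
theorem single_mul_ext_res (S : L1 H) (B : H →L[ℂ] H) (s : P.Sections) :
    W.ext (RapidlyDecreasing.single 0 S) * W.ext (RapidlyDecreasing.map (L1.lmul B) (W.res s)) =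
      W.ext (RapidlyDecreasing.map (L1.lmul (L1.op S * B)) (W.res s)) := by
  refine W.sections_eq (fun x hx => ?_) fun x hx => ?_
  · rw [Sections.val_mul, localRep_mul, Pi.mul_apply, W.localRep_ext_map_res _ _ hx,
      W.localRep_ext_map_res _ _ hx, W.localRep_ext _ hx, fourierSum_single_zero,
      smul_mul_smul_comm, W.η_mul_χ]
    congr 1
  · rw [Sections.val_mul, Pi.mul_apply, W.ext_eq_zero _ hx, W.ext_eq_zero _ hx, zero_mul,
      W.ext_eq_zero _ hx]
    exact ⟨rfl, rfl⟩

theorem val_ext_res (s : P.Sections) (x : X) :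
    (W.ext (W.res s)).val x = (W.χ x : ℂ) • s.val x := by
  by_cases hx : x ∈ tsupport W.η
  · have hb := (W.tsupport_η hx).1.2
    rw [← P.frame_localRep W.e (W.ext (W.res s)).val hb, ← P.frame_localRep W.e s.val hb, ← frame_smul,
      W.localRep_ext _ hx, W.fourierSum_res s hx, smul_smul, W.η_mul_χ, Complex.coe_smul]
  · rw [W.ext_eq_zero _ hx, image_eq_zero_of_notMem_tsupport fun h => hx (W.tsupport_χ_subset h),
      Complex.ofReal_zero, zero_smul]

end Patch

end PrincipalPUBundle

end TwistedHKR

end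

open scoped NNReal Real
noncomputable section

/-! ### Seminorm estimates for patches, and the finite cover -/

namespace TwistedHKR

open RapidlyDecreasing

theorem exists_bound_iteratedFDeriv_of_isCompact {E F : Type*} [NormedAddCommGroup E]
    [NormedSpace ℝ E] [NormedAddCommGroup F] [NormedSpace ℝ F] {f : E → F} {K : Set E}
    (hK : IsCompact K) (hf : ∀ y ∈ K, ContDiffAt ℝ ∞ f y) (M : ℕ) :
    ∃ C : ℝ, 0 ≤ C ∧ ∀ y ∈ K, ∀ l ≤ M, ‖iteratedFDeriv ℝ l f y‖ ≤ C := by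
  have h : ∀ l : ℕ, ∃ C, ∀ y ∈ K, ‖iteratedFDeriv ℝ l f y‖ ≤ C := fun l =>
    hK.exists_bound_of_continuousOn fun y hy =>
      ((hf y hy).continuousAt_iteratedFDeriv (k := l) (by exact_mod_cast le_top)).continuousWithinAt
  choose C hC using h
  refine ⟨∑ l ∈ Finset.range (M + 1), |C l|, Finset.sum_nonneg fun l _ => abs_nonneg _,
    fun y hy l hl => ?_⟩
  exact ((hC l y hy).trans (le_abs_self _)).trans (Finset.single_le_sum (f := fun l => |C l|)
    (fun l _ => abs_nonneg _) (Finset.mem_range.2 (Nat.lt_succ_iff.2 hl)))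

theorem one_le_freqWeight {n : ℕ} (k : Fin n → ℤ) : (1 : ℝ) ≤ freqWeight k := by
  rw [freqWeight_coe]
  exact le_add_of_nonneg_right (norm_nonneg _)

theorem weightedNorm_mono {n : ℕ} {B : Type*} [NormedAddCommGroup B] [NormedSpace ℂ B]
    (c : RapidlyDecreasing (freqWeight (n := n)) B) {l m : ℕ} (h : l ≤ m) :
    weightedNorm l c ≤ weightedNorm m c :=
  (c.2 l).tsum_le_tsum (fun k => mul_le_mul_of_nonneg_right
    (pow_le_pow_right₀ (one_le_freqWeight k) h) (norm_nonneg _)) (c.2 m)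

namespace PrincipalPUBundle

variable {n : ℕ} {X : Type u} [TopologicalSpace X] [ChartedSpace (EuclideanSpace ℝ (Fin n)) X]
  [IsManifold (𝓡 n) ∞ X]
  {H : Type v} [NormedAddCommGroup H] [InnerProductSpace ℂ H] [CompleteSpace H]
  {P : PrincipalPUBundle.{u, v, w} n X H}

theorem supDeriv_le_sectionSeminorm (i : P.SeminormIndex) {j : ℕ} (hj : j ≤ i.m) (s : P.Sections) :
    i.supDeriv j s ≤ j.factorial * sectionSeminorm P i s := by
  have h := Finset.single_le_sum (f := fun j => 1 / (j.factorial : ℝ) * i.supDeriv j s)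
    (fun l _ => mul_nonneg (by positivity) (i.supDeriv_nonneg l s))
    (Finset.mem_range.2 (Nat.lt_succ_iff.2 hj))
  rw [← sectionSeminorm_apply] at h
  have hpos : (0 : ℝ) < j.factorial := by positivity
  calc i.supDeriv j s = j.factorial * (1 / (j.factorial : ℝ) * i.supDeriv j s) := by field_simp
    _ ≤ _ := by gcongr

namespace Patch

variable (W : P.Patch)

/-! #### The synthesis map is continuous -/

/-- Near a point of the support of `η`, the representative in any other chart and trivialization is
`η Λ` applied to the Fourier sum after a change of coordinates; elsewhere it vanishes locally. The
constant and the neighbourhood precede `c`, ready for a compactness argument. -/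
theorem exists_eventually_rep_ext_le (i : P.SeminormIndex) (j : ℕ)
    {z₀ : EuclideanSpace ℝ (Fin n)} (hz : z₀ ∈ i.dom) : ∃ C : ℝ, 0 ≤ C ∧ ∀ᶠ z in 𝓝 z₀, ∀ c,
      ‖iteratedFDeriv ℝ j (i.rep (W.ext c)) z‖ ≤ C * weightedNorm j c := by
  have hsymm : ContMDiffAt 𝓘(ℝ, EuclideanSpace ℝ (Fin n)) (𝓡 n) ∞ i.φ.symm z₀ :=
    (contMDiffOn_symm_of_mem_maximalAtlas (I := 𝓡 n) i.hφ).contMDiffAt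
      (i.φ.open_target.mem_nhds hz.1)
  by_cases hx : i.φ.symm z₀ ∈ tsupport W.η
  · obtain ⟨⟨hx1, hx2⟩, -⟩ := W.tsupport_η hx
    obtain ⟨Λ, hΛ, hrep⟩ := P.exists_transition W.he i.he hx2 hz.2
    have hη : ContDiffAt ℝ ∞ (fun z => W.η (i.φ.symm z)) z₀ := by
      rw [← contMDiffAt_iff_contDiffAt]
      exact W.hη.contMDiffAt.comp z₀ hsymm
    have hΛ' : ContDiffAt ℝ ∞ (fun z => Λ (i.φ.symm z)) z₀ := by
      rw [← contMDiffAt_iff_contDiffAt]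
      exact hΛ.comp z₀ hsymm
    have hτ : ContDiffAt ℝ ∞ (fun z => W.φ (i.φ.symm z)) z₀ := by
      rw [← contMDiffAt_iff_contDiffAt]
      exact ((contMDiffOn_of_mem_maximalAtlas (I := 𝓡 n) W.hφ).contMDiffAt
        (W.φ.open_source.mem_nhds hx1)).comp z₀ hsymm
    obtain ⟨C, hC0, hC⟩ := exists_norm_iteratedFDeriv_clm_comp_le (hη.smul hΛ') hτ j
    have hnear : ∀ᶠ z in 𝓝 z₀, ∀ c, i.rep (W.ext c) z =
        (W.η (i.φ.symm z) • Λ (i.φ.symm z)) (fourierSum c (W.φ (i.φ.symm z))) := by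
      have hcont : Tendsto i.φ.symm (𝓝 z₀) (𝓝 (i.φ.symm z₀)) := i.φ.continuousAt_symm hz.1
      filter_upwards [hcont.eventually hrep,
        hcont.eventually (W.e.open_baseSet.mem_nhds hx2)] with z hz1 hz2 c
      change P.localRep i.e (W.ext c).val (i.φ.symm z) = _
      rw [hz1]
      have : P.localRep W.e (W.ext c).val (i.φ.symm z) =
        W.η (i.φ.symm z) • fourierSum c (W.φ (i.φ.symm z)) :=
        W.localRep_glue _ (contDiff_fourierSum c) hz2
      rw [this, map_smul]
      rfl
    refine ⟨C * (2 * π) ^ j, by positivity, ?_⟩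
    -- A derivative at `z` needs the formula on a neighbourhood of `z`, not just at `z`.
    filter_upwards [hC, hnear.eventually_nhds] with z h1 h2 c
    have h3 : i.rep (W.ext c) =ᶠ[𝓝 z] fun z =>
        (W.η (i.φ.symm z) • Λ (i.φ.symm z)) (fourierSum c (W.φ (i.φ.symm z))) :=
      h2.mono fun z hz => hz c
    rw [(h3.iteratedFDeriv ℝ j).self_of_nhds, mul_assoc]
    refine h1 (fourierSum c) (contDiff_fourierSum c) _ fun l hl y => ?_
    refine (norm_iteratedFDeriv_fourierSum_le c l y).trans ?_
    have hπ : (1 : ℝ) ≤ 2 * π := by linarith [Real.pi_gt_three]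
    exact mul_le_mul (pow_le_pow_right₀ hπ hl) (weightedNorm_mono c hl) (weightedNorm_nonneg _ _)
      (by positivity)
  · refine ⟨0, le_rfl, ?_⟩
    have hnear : ∀ᶠ z in 𝓝 z₀, ∀ c, i.rep (W.ext c) z = 0 := by
      have hcont : Tendsto i.φ.symm (𝓝 z₀) (𝓝 (i.φ.symm z₀)) := i.φ.continuousAt_symm hz.1
      filter_upwards [hcont.eventually ((isClosed_tsupport W.η).isOpen_compl.mem_nhds hx),
        i.isOpen_dom.mem_nhds hz] with z hz1 hz2 c
      exact P.localRep_eq_zero i.e hz2.2 (W.ext_eq_zero c hz1)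
    filter_upwards [hnear.eventually_nhds] with z h2 c
    have h3 : i.rep (W.ext c) =ᶠ[𝓝 z] fun _ => 0 := h2.mono fun z hz => hz c
    rw [(h3.iteratedFDeriv ℝ j).self_of_nhds]
    simp

/-- The local constants are joined over the compact image of `K` by induction on its subsets. -/
theorem exists_supDeriv_ext_le (i : P.SeminormIndex) (j : ℕ) : ∃ C : ℝ, 0 ≤ C ∧ ∀ c,
    i.supDeriv j (W.ext c) ≤ C * weightedNorm j c := by
  have h : ∃ C : ℝ, 0 ≤ C ∧ ∀ z ∈ i.φ '' i.K, ∀ c,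
      ‖iteratedFDeriv ℝ j (i.rep (W.ext c)) z‖ ≤ C * weightedNorm j c := by
    refine i.isCompact_image.induction_on (p := fun S => ∃ C : ℝ, 0 ≤ C ∧ ∀ z ∈ S, ∀ c,
      ‖iteratedFDeriv ℝ j (i.rep (W.ext c)) z‖ ≤ C * weightedNorm j c) ?_ ?_ ?_ ?_
    · exact ⟨0, le_rfl, fun z hz => hz.elim⟩
    · rintro S T hST ⟨C, hC0, hC⟩
      exact ⟨C, hC0, fun z hz => hC z (hST hz)⟩
    · rintro S T ⟨C, hC0, hC⟩ ⟨D, hD0, hD⟩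
      refine ⟨max C D, le_max_of_le_left hC0, ?_⟩
      rintro z (hz | hz) c
      · exact (hC z hz c).trans
          (mul_le_mul_of_nonneg_right (le_max_left _ _) (weightedNorm_nonneg _ _))
      · exact (hD z hz c).trans
          (mul_le_mul_of_nonneg_right (le_max_right _ _) (weightedNorm_nonneg _ _))
    · intro z hz
      obtain ⟨C, hC0, hC⟩ := W.exists_eventually_rep_ext_le i j (i.image_subset_dom hz)
      exact ⟨_, mem_nhdsWithin_of_mem_nhds hC, C, hC0, fun z hz => hz⟩
  obtain ⟨C, hC0, hC⟩ := h
  exact ⟨C, hC0, fun c => Real.iSup_le (fun y => hC y y.2 c)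
    (mul_nonneg hC0 (weightedNorm_nonneg _ _))⟩

theorem exists_sectionSeminorm_ext_le (i : P.SeminormIndex) : ∃ C : ℝ≥0, ∀ c,
    sectionSeminorm P i (W.ext c) ≤ C * weightedNorm i.m c := by
  choose C hC0 hC using W.exists_supDeriv_ext_le i
  refine ⟨NNReal.mk (∑ j ∈ Finset.range (i.m + 1), 1 / (j.factorial : ℝ) * C j)
    (Finset.sum_nonneg fun j _ => mul_nonneg (by positivity) (hC0 j)), fun c => ?_⟩
  rw [sectionSeminorm_apply, NNReal.coe_mk, Finset.sum_mul]
  refine Finset.sum_le_sum fun j hj => ?_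
  rw [mul_assoc]
  refine mul_le_mul_of_nonneg_left ((hC j c).trans ?_) (by positivity)
  exact mul_le_mul_of_nonneg_left
    (weightedNorm_mono c (Nat.lt_succ_iff.1 (Finset.mem_range.1 hj))) (hC0 j)

theorem ext_bound (p : Seminorm ℂ P.Sections) (hp : Continuous p) : ∃ (C : ℝ≥0) (m : ℕ), ∀ c,
    p (W.ext c) ≤ C * weightedNorm m c := by
  obtain ⟨s, D, -, hD⟩ := Seminorm.bound_of_continuous withSeminorms p hp
  choose C hC using W.exists_sectionSeminorm_ext_le
  refine ⟨D * ∑ i ∈ s, C i, s.sup fun i => i.m, fun c => ?_⟩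
  have h1 : p (W.ext c) ≤ D * s.sup (sectionSeminorm P) (W.ext c) := hD _
  refine h1.trans ?_
  rw [NNReal.coe_mul, mul_assoc]
  refine mul_le_mul_of_nonneg_left ?_ D.2
  refine (Seminorm.finset_sup_le_sum (sectionSeminorm P) s (W.ext c)).trans ?_
  rw [seminorm_sum_apply, NNReal.coe_sum, Finset.sum_mul]
  refine Finset.sum_le_sum fun i hi => (hC i c).trans (mul_le_mul_of_nonneg_left ?_ (C i).2)
  exact weightedNorm_mono c (Finset.le_sup (f := fun i : P.SeminormIndex => i.m) hi)

/-! #### The analysis map is continuous -/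

variable [CompactSpace X]

/-- Leibniz rule on the image of the support of `χ`, which is the compact set of the chosen
seminorm; off it all derivatives vanish. The factorials undo the weights `1 / j!`. -/
theorem exists_norm_iteratedFDeriv_loc_le (M : ℕ) : ∃ C : ℝ, 0 ≤ C ∧ ∀ s, ∀ j ≤ M, ∀ y,
    ‖iteratedFDeriv ℝ j (W.loc s) y‖ ≤ C * sectionSeminorm P (W.seminormIndex M) s := by
  set i := W.seminormIndex M
  obtain ⟨C, hC0, hC⟩ := exists_bound_iteratedFDeriv_of_isCompact W.isCompact_locSupport
    (fun y hy => W.contDiffAt_χ (i.image_subset_dom hy).1) M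
  refine ⟨∑ j ∈ Finset.range (M + 1), ∑ l ∈ Finset.range (j + 1),
    (j.choose l : ℝ) * C * (j - l).factorial,
    Finset.sum_nonneg fun j _ => Finset.sum_nonneg fun l _ => by positivity, fun s j hj y => ?_⟩
  have hp0 : 0 ≤ sectionSeminorm P i s := apply_nonneg _ _
  by_cases hy : y ∈ W.locSupport
  · have hd := i.image_subset_dom hy
    have h1 := (W.loc_eventuallyEq s hd.1).iteratedFDeriv ℝ j
    rw [h1.self_of_nhds]
    have hχ : ContDiffOn ℝ ∞ (fun y => W.χ (W.φ.symm y)) i.dom :=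
      fun y hy => (W.contDiffAt_χ hy.1).contDiffWithinAt
    have h2 := norm_iteratedFDerivWithin_smul_le hχ (i.contDiffOn_rep s) i.isOpen_dom.uniqueDiffOn
      hd (n := j) (by exact_mod_cast le_top)
    simp only [iteratedFDerivWithin_of_isOpen _ i.isOpen_dom hd] at h2
    refine h2.trans ?_
    refine le_trans ?_ (mul_le_mul_of_nonneg_right (Finset.single_le_sum
      (f := fun j => ∑ l ∈ Finset.range (j + 1), (j.choose l : ℝ) * C * (j - l).factorial)
      (fun j _ => Finset.sum_nonneg fun l _ => by positivity)
      (Finset.mem_range.2 (Nat.lt_succ_iff.2 hj))) hp0)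
    rw [Finset.sum_mul]
    refine Finset.sum_le_sum fun l hl => ?_
    have hlj : l ≤ j := Nat.lt_succ_iff.1 (Finset.mem_range.1 hl)
    have h3 : ‖iteratedFDeriv ℝ (j - l) (i.rep s) y‖ ≤
        (j - l).factorial * sectionSeminorm P i s :=
      (i.le_supDeriv (j - l) s hy).trans
        (supDeriv_le_sectionSeminorm i ((Nat.sub_le _ _).trans hj) s)
    have h4 := hC y hy l (hlj.trans hj)
    calc _ ≤ (j.choose l : ℝ) * C * ((j - l).factorial * sectionSeminorm P i s) := by gcongr
      _ = _ := by ring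
  · have h0 : iteratedFDeriv ℝ j (W.loc s) y = 0 := by
      by_contra hne
      exact hy (W.tsupport_loc s (support_iteratedFDeriv_subset (𝕜 := ℝ) j hne))
    rw [h0, norm_zero]
    exact mul_nonneg (Finset.sum_nonneg fun j _ => Finset.sum_nonneg fun l _ => by positivity) hp0

theorem res_bound (m : ℕ) : ∃ r : Seminorm ℂ P.Sections, Continuous r ∧
    ∀ s, weightedNorm m (W.res s) ≤ r s := by
  obtain ⟨M, C, hC0, hC⟩ := exists_weighted_fourier_le (B := L1 H) W.isCompact_locSupport m
  obtain ⟨D, hD0, hD⟩ := W.exists_norm_iteratedFDeriv_loc_le M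
  refine ⟨NNReal.mk (C * D) (mul_nonneg hC0 hD0) • sectionSeminorm P (W.seminormIndex M), ?_,
    fun s => ?_⟩
  · exact (withSeminorms.continuous_seminorm (W.seminormIndex M)).const_smul _
  · refine (hC (W.loc s) (W.contDiff_loc s) (W.tsupport_loc s) _ (hD s)).2.trans_eq ?_
    rw [← mul_assoc]
    rfl

/-- The splitting data which come from a patch. -/
def toLocalPatch : LocalPatch (freqWeight (n := n)) 0 H P.Sections where
  res := W.res
  ext := W.ext
  ext_bound := W.ext_bound
  res_bound := W.res_bound
  ext_res_mul := W.ext_res_mul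
  single_mul_ext_res := W.single_mul_ext_res

end Patch

/-- Finitely many patches suffice. -/
theorem exists_patches [T2Space X] [CompactSpace X] (P : PrincipalPUBundle.{u, v, w} n X H) :
    ∃ (t : Finset X) (W : t → P.Patch), ∀ x, ∑ i, (W i).χ x = 1 := by
  choose e he hxe using P.exists_mem_atlas
  let φ : X → OpenPartialHomeomorph X (EuclideanSpace ℝ (Fin n)) := fun x => chartAt _ x
  -- The unit cube is centred at the image of `x`.
  let a : X → Fin n → ℝ := fun x i => φ x x i - 1 / 2
  let U : X → Set X := fun x => (φ x).source ∩ (e x).baseSet ∩ φ x ⁻¹' cube (a x)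
  have hUo : ∀ x, IsOpen (U x) := by
    intro x
    have h1 := (φ x).isOpen_inter_preimage (isOpen_cube (a x))
    have h2 : U x = ((φ x).source ∩ φ x ⁻¹' cube (a x)) ∩ (e x).baseSet := inter_right_comm _ _ _
    rw [h2]
    exact h1.inter (e x).open_baseSet
  have hxU : ∀ x, x ∈ U x := fun x =>
    ⟨⟨mem_chart_source _ x, hxe x⟩, fun i => ⟨by simp only [a]; linarith, by simp only [a]; linarith⟩⟩
  obtain ⟨t, ht⟩ := isCompact_univ.elim_finite_subcover U hUo
    fun x _ => mem_iUnion.2 ⟨x, hxU x⟩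
  obtain ⟨f, hf⟩ := SmoothPartitionOfUnity.exists_isSubordinate (𝓡 n) isClosed_univ
    (fun i : t => U i) (fun i => hUo i) (by
      intro x hx
      obtain ⟨i, hi, hxi⟩ := mem_iUnion₂.1 (ht hx)
      exact mem_iUnion.2 ⟨⟨i, hi⟩, hxi⟩)
  have hη : ∀ i : t, ∃ η : X → ℝ, ContMDiff (𝓡 n) 𝓘(ℝ, ℝ) ∞ η ∧
      (∀ x ∈ tsupport (f i), η x = 1) ∧ tsupport η ⊆ U i := by
    intro i
    -- `η` is to vanish off `V`; since the closure of `V` lies in `U i`, so does the support of `η`.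
    obtain ⟨V, hVo, hfV, hVU⟩ := normal_exists_closure_subset (isClosed_tsupport (f i)) (hUo i) (hf i)
    obtain ⟨η, h0, h1, -⟩ := exists_contMDiffMap_zero_one_of_isClosed (n := ⊤) (𝓡 n)
      hVo.isClosed_compl (isClosed_tsupport (f i)) (disjoint_compl_left_iff_subset.2 hfV)
    refine ⟨η, η.contMDiff, fun x hx => h1 hx, (closure_mono fun x hx => ?_).trans hVU⟩
    by_contra hxV
    exact hx (h0 hxV)
  choose η hη1 hη2 hη3 using hη
  refine ⟨t, fun i =>
    { φ := φ i
      hφ := IsManifold.chart_mem_maximalAtlas (i : X)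
      e := e i
      he := he i
      a := a i
      χ := f i
      η := η i
      hχ := (f i).contMDiff
      hη := hη1 i
      η_eq_one := hη2 i
      tsupport_η := hη3 i }, fun x => ?_⟩
  have := f.sum_eq_one (mem_univ x)
  rwa [finsum_eq_sum_of_fintype] at this

end PrincipalPUBundle

end TwistedHKR

end

theorem mainTheorem8 {n : ℕ} {X : Type u} [TopologicalSpace X]
    [ChartedSpace (EuclideanSpace ℝ (Fin n)) X] [IsManifold (𝓡 n) ∞ X] [T2Space X] [CompactSpace X]
    {H : Type v} [NormedAddCommGroup H] [InnerProductSpace ℂ H] [CompleteSpace H]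
    [TopologicalSpace.SeparableSpace H]
    (P : TwistedHKR.PrincipalPUBundle.{u, v, w} n X H) :
    TwistedHKR.TopologicallyHUnital P.Sections := by
  obtain ⟨t, W, hW⟩ := P.exists_patches
  refine TwistedHKR.topologicallyHUnital_of_localPatch (fun i => (W i).toLocalPatch) fun s => ?_
  refine Subtype.val_injective (funext fun x => ?_)
  have h1 : (∑ i, (W i).ext ((W i).res s)).val x = ∑ i, ((W i).ext ((W i).res s)).val x := by
    let ev : P.Sections →+ P.Fiber x :=
      { toFun := fun s => s.val x
        map_zero' := rfl
        map_add' := fun _ _ => rfl }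
    exact map_sum ev _ _
  refine h1.trans ?_
  -- Each patch reproduces `χᵢ s`, and the partition of unity adds these up to `s`.
  simp only [TwistedHKR.PrincipalPUBundle.Patch.val_ext_res]
  rw [← Finset.sum_smul, ← Complex.ofReal_sum, hW x, Complex.ofReal_one, one_smul]
  rfl
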